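/- Let $V=\mathbb{C}^3$, $\mathbb{P}^2=\mathbb{P}(V)$ (lines in $V$), and let $T=T_{\mathbb{P}^2}$ be its tangent bundle, with fibre $\mathrm{Hom}(p,V/p)$ at the line $p$. Let $\mathbb{P}(T)$ be the projective bundle of one-dimensional quotients of the fibres of $T$, embedded in $\mathbb{P}^7$ by the complete linear system of $\mathcal{O}_{\mathbb{P}(T)}(1)$: for a basis $s_1,\dots,s_8$ of $H^0(\mathbb{P}^2,T)=\mathrm{End}(V)/\mathbb{C}\cdot\mathrm{id}$, the point $(p,[q])$, with $0\ne q\in T_p^*$, goes to $[q(s_1(p)):\dots:q(s_8(p))]$. Let $H\subset\mathbb{P}^7$ be any hyperplane and let $Y=H\cap\mathbb{P}(T)$ be the scheme-theoretic intersection. Then either (i) $Y$ is an irreducible and reduced surface of degree six that spans $H\cong\mathbb{P}^6$, or (ii) $Y$ is the scheme-theoretic union of two distinct irreducible and reduced surfaces of degree three. Moreover, if $Y$ is irreducible, then $Y$ is reduced, and either $Y$ is a nonsingular Del Pezzo surface of degree six (a nonsingular surface of degree six spanning $H\cong\mathbb{P}^6$ with canonical sheaf $\omega_Y\cong\mathcal{O}_Y(-1)$),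 or $Y$ is singular at exactly one point, and the (Hilbert–Samuel) multiplicity of $Y$ at that point is two or three. -/

import Mathlib

open scoped LinearAlgebra.Projectivization

noncomputable section

namespace TangentPlane

/-! ### The projectivized tangent bundle of the plane and its natural embedding -/

/-- The vector space `V` with `ℙ² = ℙ(V)`, the set of lines in `V`. -/
abbrev V : Type := Fin 3 → ℂ

/-- The tangent space of `ℙ² = ℙ(V)` at the line `p ⊆ V`, that is, `Hom(p, V / p)`. -/
abbrev TangentAt (p : ℙ ℂ V) : Type :=
  p.submodule →ₗ[ℂ] (V ⧸ p.submodule)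

/-- The points of `ℙ(T_{ℙ²})`: a point `p` of `ℙ²` with a one-dimensional quotient of the
tangent space at `p`, given as the line that a nonzero functional on the tangent space spans.
(The convention is the one in which `𝒪(1)` is a quotient of the pull-back of the bundle.) -/
abbrev ProjTangent : Type :=
  Σ p : ℙ ℂ V, ℙ ℂ (Module.Dual ℂ (TangentAt p))

/-- The space `H⁰(ℙ², T) = H⁰(ℙ(T), 𝒪(1))`: by the Euler sequence
`0 → 𝒪 → 𝒪(1)³ → T → 0` it consists of the triples of linear forms (the endomorphisms of `V`)
modulo the multiples of the triple of coordinates (the identity). -/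
abbrev Sections : Type :=
  Module.End ℂ V ⧸ Submodule.span ℂ {(1 : Module.End ℂ V)}

/-- The value at `p` of the vector field given by an endomorphism `A`:
the composite `p → V → V → V / p` of the inclusion, `A` and the projection. -/
def evalEnd (p : ℙ ℂ V) : Module.End ℂ V →ₗ[ℂ] TangentAt p where
  toFun A := p.submodule.mkQ ∘ₗ A ∘ₗ p.submodule.subtype
  map_add' A B := by ext; simp
  map_smul' c A := by ext; simp

/-- The value at `p` of a section of the tangent bundle. -/
def evalSection (p : ℙ ℂ V) : Sections →ₗ[ℂ] TangentAt p :=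
  (Submodule.span ℂ {(1 : Module.End ℂ V)}).liftQ (evalEnd p) (by
    rw [Submodule.span_singleton_le_iff_mem, LinearMap.mem_ker]
    ext x
    simp [evalEnd])

/-- The tangent bundle is globally generated. -/
theorem evalSection_surjective (p : ℙ ℂ V) : Function.Surjective (evalSection p) := by
  intro t
  obtain ⟨g, hg⟩ := Module.projective_lifting_property p.submodule.mkQ t
    (Submodule.mkQ_surjective _)
  obtain ⟨A, hA⟩ := LinearMap.exists_extend g
  refine ⟨Submodule.Quotient.mk A, ?_⟩
  change evalEnd p A = t
  rw [← hg, ← hA]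
  rfl

theorem finrank_sections : Module.finrank ℂ Sections = 8 := by
  have h := Submodule.finrank_quotient_add_finrank
    (Submodule.span ℂ {(1 : Module.End ℂ V)})
  rw [finrank_span_singleton one_ne_zero, Module.finrank_linearMap] at h
  simp at h
  exact h

/-- The natural morphism of `ℙ(T)` to projective space, in the homogeneous coordinates given by a
basis `b` of `H⁰(T)`: the point `(p, [q])` goes to `[q(b₁(p)) : … : q(bₘ(p))]`. -/
def naturalEmbedding {ι : Type} [Finite ι] (b : Module.Basis ι ℂ Sections) (x : ProjTangent) :
    ℙ ℂ (ι → ℂ) :=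
  Projectivization.map
    ((b.constr ℂ (M' := ℂ)).symm.toLinearMap ∘ₗ (evalSection x.1).dualMap)
    ((b.constr ℂ (M' := ℂ)).symm.injective.comp
      (LinearMap.dualMap_injective_of_surjective (evalSection_surjective x.1)))
    x.2

/-! ### Multiplicities of local rings and differential 2-forms on fields -/

/-- The function `H` agrees for large arguments with a polynomial of degree `r` whose leading
coefficient is `e / r!`. -/
def HasGrowth (H : ℕ → ℕ) (r e : ℕ) : Prop :=
  ∃ P : Polynomial ℚ, (∀ᶠ n : ℕ in Filter.atTop, (H n : ℚ) = P.eval (n : ℚ)) ∧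
    P.natDegree = r ∧ P.leadingCoeff * (r.factorial : ℚ) = e

/-- The local ring `R` of dimension `r` has (Hilbert–Samuel) multiplicity `e`: the length of
`R / 𝔪ⁿ⁺¹` is for large `n` a polynomial in `n` with leading term `(e / r!) nʳ`. -/
def HasMultiplicity (R : Type) [CommRing R] (r e : ℕ) : Prop :=
  ∃ _ : IsLocalRing R, ringKrullDim R = r ∧
    HasGrowth (fun n =>
      (Module.length R (R ⧸ IsLocalRing.maximalIdeal R ^ (n + 1))).toNat) r e

/-- The differential 2-forms `⋀² Ω` of a field of functions `K` over `ℂ`. -/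
abbrev TwoForms (K : Type) [Field K] [Algebra ℂ K] : Type :=
  ⋀[K]^2 (Ω[K⁄ℂ])

/-- The 2-form `da ∧ db`. -/
def wedgeD {K : Type} [Field K] [Algebra ℂ K] (a b : K) : TwoForms K :=
  exteriorPower.ιMulti K 2 ![KaehlerDifferential.D ℂ K a, KaehlerDifferential.D ℂ K b]

/-- The 2-forms that are regular over a subring `A` of `K`: the `A`-module generated by the forms
`da ∧ db` with `a, b ∈ A`. If `K` is the function field of a surface and `A` is the local ring at a
nonsingular point, this is the stalk of the canonical sheaf `ω = ⋀² Ω` at that point. -/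
def regularTwoForms {K : Type} [Field K] [Algebra ℂ K] (A : Subalgebra ℂ K) :
    Submodule A (TwoForms K) :=
  Submodule.span A {w | ∃ a ∈ A, ∃ b ∈ A, w = wedgeD a b}

/-! ### Closed subschemes of projective space, given by homogeneous ideals -/

section Projective

variable {ι : Type}

/-- The ideal of the polynomials that vanish on a set of points of projective space. -/
def vanishingIdeal (Z : Set (ℙ ℂ (ι → ℂ))) : Ideal (MvPolynomial ι ℂ) where
  carrier := {f | ∀ (v : ι → ℂ) (hv : v ≠ 0), Projectivization.mk ℂ v hv ∈ Z →
    MvPolynomial.eval v f = 0}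
  zero_mem' := by intro v hv hZ; simp
  add_mem' := by
    intro f g hf hg v hv hZ
    simp [hf v hv hZ, hg v hv hZ]
  smul_mem' := by
    intro c f hf v hv hZ
    simp [hf v hv hZ]

/-- The saturation of an ideal with respect to the irrelevant ideal: the largest
ideal that defines the same closed subscheme of projective space. -/
def saturation (I : Ideal (MvPolynomial ι ℂ)) : Ideal (MvPolynomial ι ℂ) where
  carrier := {f | ∀ i, ∃ k : ℕ, MvPolynomial.X i ^ k * f ∈ I}
  zero_mem' := fun i => ⟨0, by simp⟩
  add_mem' := by
    intro f g hf hg i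
    obtain ⟨k, hk⟩ := hf i
    obtain ⟨l, hl⟩ := hg i
    refine ⟨k + l, ?_⟩
    have h1 := I.mul_mem_left (MvPolynomial.X i ^ l) hk
    have h2 := I.mul_mem_left (MvPolynomial.X i ^ k) hl
    convert I.add_mem h1 h2 using 1
    ring
  smul_mem' := by
    intro c f hf i
    obtain ⟨k, hk⟩ := hf i
    refine ⟨k, ?_⟩
    convert I.mul_mem_left c hk using 1
    simp only [smul_eq_mul]
    ring

/-- The saturated ideal of the scheme-theoretic intersection of the closed set `Z` (with its
reduced structure) with the hyperplane `h = 0`. -/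
def hyperplaneSection (Z : Set (ℙ ℂ (ι → ℂ))) (h : MvPolynomial ι ℂ) :
    Ideal (MvPolynomial ι ℂ) :=
  saturation (vanishingIdeal Z ⊔ Ideal.span {h})

/-- The Hilbert function `n ↦ dim (S / I)ₙ` of a homogeneous ideal. -/
def hilbertFunction (I : Ideal (MvPolynomial ι ℂ)) (n : ℕ) : ℕ :=
  Module.finrank ℂ (MvPolynomial.homogeneousSubmodule ι ℂ n ⧸
    (I.restrictScalars ℂ).submoduleOf (MvPolynomial.homogeneousSubmodule ι ℂ n))

/-- `I` is the homogeneous ideal of an irreducible (and reduced) projective surface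
of degree `d`. -/
structure IsIrreducibleSurface (I : Ideal (MvPolynomial ι ℂ)) (d : ℕ) : Prop where
  isPrime : I.IsPrime
  isHomogeneous : ∀ f ∈ I, ∀ n : ℕ, MvPolynomial.homogeneousComponent n f ∈ I
  hilbert : HasGrowth (hilbertFunction I) 2 d

/-- The closed subscheme with saturated ideal `I` spans a linear subspace of dimension `m`. -/
def SpansDim (I : Ideal (MvPolynomial ι ℂ)) (m : ℕ) : Prop :=
  hilbertFunction I 1 = m + 1

/-- The (closed) points of the closed subscheme defined by `I`. -/
def points (I : Ideal (MvPolynomial ι ℂ)) : Set (ℙ ℂ (ι → ℂ)) :=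
  {p | I ≤ vanishingIdeal {p}}

/-! ### Local rings and the canonical sheaf of a projective variety -/

variable (P : Ideal (MvPolynomial ι ℂ)) [P.IsPrime]

/-- The field of fractions of the homogeneous coordinate ring. -/
abbrev ConeField : Type := FractionRing (MvPolynomial ι ℂ ⧸ P)

/-- A polynomial as an element of the field of fractions of the homogeneous coordinate ring. -/
def toConeField (f : MvPolynomial ι ℂ) : ConeField P :=
  algebraMap (MvPolynomial ι ℂ ⧸ P) (ConeField P) (Ideal.Quotient.mk P f)

/-- The function field of the projective variety with homogeneous prime ideal `P`,
generated by the fractions of forms of equal degree, as a subfield of the field of fractions of the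
homogeneous coordinate ring. -/
def functionSubfield : IntermediateField ℂ (ConeField P) :=
  IntermediateField.adjoin ℂ {x | ∃ (n : ℕ) (f g : MvPolynomial ι ℂ),
    f.IsHomogeneous n ∧ g.IsHomogeneous n ∧ g ∉ P ∧ x = toConeField P f / toConeField P g}

/-- The function field of the projective variety with homogeneous prime ideal `P`. -/
def FunctionField : Type := functionSubfield P

instance : Field (FunctionField P) := inferInstanceAs (Field (functionSubfield P))

instance : Algebra ℂ (FunctionField P) := inferInstanceAs (Algebra ℂ (functionSubfield P))

/-- The inclusion of the function field into the field of fractions of the homogeneous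
coordinate ring. -/
def FunctionField.incl : FunctionField P →ₐ[ℂ] ConeField P := (functionSubfield P).val

/-- The rational function `x` is the fraction `f / g` of two forms of equal degree. -/
def IsFraction (x : FunctionField P) (f g : MvPolynomial ι ℂ) : Prop :=
  (∃ n : ℕ, f.IsHomogeneous n ∧ g.IsHomogeneous n) ∧
    FunctionField.incl P x = toConeField P f / toConeField P g

/-- The local ring at the point `p` of the projective variety with homogeneous prime
ideal `P`, as a subring of the function field: the fractions of forms of equal degree whose
denominator does not vanish at `p`. -/
def localRing (p : ℙ ℂ (ι → ℂ)) : Subalgebra ℂ (FunctionField P) :=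
  Algebra.adjoin ℂ {x | ∃ f g : MvPolynomial ι ℂ, g ∉ vanishingIdeal {p} ∧ IsFraction P x f g}

/-- The singular points of a projective variety. -/
def singularLocus : Set (ℙ ℂ (ι → ℂ)) :=
  {p | p ∈ points P ∧ ¬ IsRegularLocalRing (localRing P p)}

/-- The (Hilbert–Samuel) multiplicity of the surface with homogeneous prime ideal `P` at the
point `p` is `e`. -/
def HasMultiplicityAt (p : ℙ ℂ (ι → ℂ)) (e : ℕ) : Prop :=
  HasMultiplicity (localRing P p) 2 e

/-- The canonical sheaf `ω` of a nonsingular surface is isomorphic to `𝒪(-1)`. If `l₀` is a linear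
form that does not vanish identically on the surface, then `𝒪(-1)`, multiplied by `l₀`, is the sheaf
of rational functions whose stalk at `p` is generated by `l₀ / l`, for any linear form `l` with
`l(p) ≠ 0`; an isomorphism with `ω` is multiplication by a rational 2-form `η`. -/
def CanonicalIsMinusOne : Prop :=
  ∃ l₀ : MvPolynomial ι ℂ, l₀.IsHomogeneous 1 ∧ l₀ ∉ P ∧ ∃ η : TwoForms (FunctionField P),
    ∀ p ∈ points P, ∀ l : MvPolynomial ι ℂ, l.IsHomogeneous 1 → l ∉ vanishingIdeal {p} →
      ∀ c : FunctionField P, IsFraction P c l₀ l →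
        regularTwoForms (localRing P p) = Submodule.span (localRing P p) {c • η}

/-- `P` is the homogeneous ideal of a nonsingular Del Pezzo surface of degree `d`: a nonsingular
surface of degree `d` that spans a projective space of dimension `d` and has `ω ≅ 𝒪(-1)`;
in particular its anticanonical sheaf is very ample. -/
structure IsNonsingularDelPezzo (d : ℕ) : Prop where
  isSurface : IsIrreducibleSurface P d
  spans : SpansDim P d
  nonsingular : singularLocus P = ∅
  canonical : CanonicalIsMinusOne P

end Projective

end TangentPlane

end

/-!
A hyperplane `H` is the class of an endomorphism `A` of `V` modulo scalars, and `ℙ(T)` is the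
incidence variety `y x = 0` of points `x` and lines `y` of the plane, so that `Y` has the equations
`y x = 0` and `y A x = 0`. A change of basis brings `A` to one of five Jordan normal forms modulo
scalars. If `A` has rank at least two modulo every scalar, both equations generate a bihomogeneous
prime ideal, and the degree and the span of `Y` are read off from the Hilbert function of a complete
intersection. The singular points of `Y` are then the pairs of a right and a left eigenvector for
the same eigenvalue with `y x = 0`: there are none if `A` has three distinct eigenvalues, when
`d log (x₁ / x₀) ∧ d log (x₂ / x₀)` yields `ω ≅ 𝒪(-1)`, and otherwise exactly one, at which `Y` has
a local equation in affine three-space with a nonzero quadratic leading form. If `A` has rank one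
modulo a scalar, the second equation becomes `yⱼ x₂ = 0` and splits `Y` into two cubic scrolls.
-/

noncomputable section

namespace TangentPlane

open MvPolynomial

/-! ### Complete intersections cut out by an equation linear in one variable -/

section LinearElimination

variable {σ : Type*} {k : Type*} [Field k]

theorem prime_C_mul_X_mul_X_add {a i : σ} {c : k} (hc : c ≠ 0) {g : MvPolynomial σ k}
    (hai : a ≠ i) (hi : g ∈ supported k {i}ᶜ) (hg : ¬ X a ∣ g) :
    Prime (C c * (X a * X i) + g) := by
  rw [← mul_assoc]
  have hC : IsUnit (C c : MvPolynomial σ k) := (isUnit_iff_ne_zero.2 hc).map C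
  have ha : C c * X a ∈ supported k {i}ᶜ :=
    mul_mem (Subalgebra.algebraMap_mem _ c) (X_mem_supported.2 hai)
  refine (irreducible_mul_X_add _ g i (mul_ne_zero hC.ne_zero (X_ne_zero a))
    (fun h => mem_supported.1 ha h rfl) (fun h => mem_supported.1 hi h rfl) ?_).prime
  exact (isRelPrime_mul_unit_left_left hC).2 (X_prime.irreducible.isRelPrime_iff_not_dvd.2 hg)

theorem not_dvd_of_eval_ne_zero {p f : MvPolynomial σ k} (z : σ → k) (hp : eval z p = 0)
    (hf : eval z f ≠ 0) : ¬ p ∣ f := by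
  rintro ⟨g, rfl⟩
  exact hf (by rw [map_mul, hp, zero_mul])

theorem prime_add_of_two_monomials {a b i j : σ} {c d : k} (hc : c ≠ 0) (hd : d ≠ 0)
    (hai : a ≠ i) (hbi : b ≠ i) (hji : j ≠ i) (hab : a ≠ b) (haj : a ≠ j) :
    Prime (C c * (X a * X i) + C d * (X b * X j)) := by
  classical
  refine prime_C_mul_X_mul_X_add hc hai (mul_mem (Subalgebra.algebraMap_mem _ d)
    (mul_mem (X_mem_supported.2 hbi) (X_mem_supported.2 hji)))
    (not_dvd_of_eval_ne_zero (fun t => if t = a then 0 else 1) (by simp) ?_)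
  simpa [hab.symm, haj.symm] using hd

open Classical in
/-- The endomorphism of the polynomial ring that sets one variable to zero. -/
def killVar (s : σ) : MvPolynomial σ k →ₐ[k] MvPolynomial σ k :=
  aeval (fun t => if t = s then 0 else X t)

@[simp] theorem killVar_X_self (s : σ) : killVar s (X s : MvPolynomial σ k) = 0 := by
  simp [killVar]

theorem killVar_X_of_ne {s t : σ} (h : t ≠ s) : killVar s (X t : MvPolynomial σ k) = X t := by
  simp [killVar, h]

theorem exists_eq_killVar_add (s : σ) (f : MvPolynomial σ k) :
    ∃ g, f = killVar s f + X s * g := by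
  let π := Ideal.Quotient.mkₐ k (Ideal.span {(X s : MvPolynomial σ k)})
  have hπ : π = π.comp (killVar s) := by
    ext t
    by_cases h : t = s
    · subst h
      rw [AlgHom.comp_apply, killVar_X_self, map_zero]
      exact Ideal.Quotient.eq_zero_iff_mem.2 (Ideal.mem_span_singleton_self _)
    · rw [AlgHom.comp_apply, killVar_X_of_ne h]
  obtain ⟨g, hg⟩ := Ideal.mem_span_singleton.1 (Ideal.Quotient.eq.1 congr($hπ f))
  exact ⟨g, eq_add_of_sub_eq' hg⟩

theorem eval_killVar {s : σ} {z : σ → k} (hz : z s = 0) (f : MvPolynomial σ k) :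
    eval z (killVar s f) = eval z f := by
  obtain ⟨g, hg⟩ := exists_eq_killVar_add s f
  conv_rhs => rw [hg]
  simp [hz]

theorem span_pair_X_eq_comap_killVar (s : σ) (F : MvPolynomial σ k) :
    Ideal.span {F, X s} = (Ideal.span {killVar s F}).comap (killVar s) := by
  apply le_antisymm
  · rw [Ideal.span_le]
    rintro f (rfl | rfl)
    · exact Ideal.mem_span_singleton_self _
    · simp
  · intro f hf
    obtain ⟨c, hc⟩ := Ideal.mem_span_singleton.1 (Ideal.mem_comap.1 hf)
    obtain ⟨a, ha⟩ := exists_eq_killVar_add s f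
    obtain ⟨b, hb⟩ := exists_eq_killVar_add s F
    refine Ideal.mem_span_pair.2 ⟨c, a - b * c, ?_⟩
    linear_combination c * hb - ha - hc

theorem isPrime_span_pair_X {s : σ} {F : MvPolynomial σ k} (hF : Prime (killVar s F)) :
    (Ideal.span {F, X s}).IsPrime := by
  have := (Ideal.span_singleton_prime hF.ne_zero).2 hF
  rw [span_pair_X_eq_comap_killVar]
  exact Ideal.comap_isPrime _ _

theorem mem_span_pair_of_X_mul_mem {s : σ} {F q f : MvPolynomial σ k}
    (hF : Prime (killVar s F)) (hq : ¬ killVar s F ∣ killVar s q)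
    (hf : X s * f ∈ Ideal.span {F, q}) : f ∈ Ideal.span {F, q} := by
  obtain ⟨a, b, hab⟩ := Ideal.mem_span_pair.1 hf
  have hrel : killVar s a * killVar s F + killVar s b * killVar s q = 0 := by
    rw [← map_mul, ← map_mul, ← map_add, hab, map_mul, killVar_X_self, zero_mul]
  obtain ⟨c, hc⟩ : killVar s F ∣ killVar s b :=
    (hF.dvd_or_dvd (b := killVar s q) ⟨-killVar s a, by linear_combination hrel⟩).resolve_right hq
  have ha : killVar s a = -(c * killVar s q) :=
    mul_right_cancel₀ hF.ne_zero (by linear_combination hrel - killVar s q * hc)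
  obtain ⟨a', ha'⟩ := exists_eq_killVar_add s a
  obtain ⟨b', hb'⟩ := exists_eq_killVar_add s b
  obtain ⟨F', hF'⟩ := exists_eq_killVar_add s F
  obtain ⟨q', hq'⟩ := exists_eq_killVar_add s q
  refine Ideal.mem_span_pair.2 ⟨a' + c * q', b' - c * F', mul_left_cancel₀ (X_ne_zero s) ?_⟩
  linear_combination hab - F * (ha' + ha) - q * (hb' + hc) + (c * q) * hF' - (c * F) * hq'

theorem exists_pow_mul_sub_mem_span {i : σ} {u g : MvPolynomial σ k}
    (hu : u ∈ supported k {i}ᶜ) (hg : g ∈ supported k {i}ᶜ) (f : MvPolynomial σ k) :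
    ∃ N : ℕ, ∃ f' ∈ supported k {i}ᶜ, u ^ N * f - f' ∈ Ideal.span {u * X i + g} := by
  induction f using MvPolynomial.induction_on with
  | C a => exact ⟨0, C a, Subalgebra.algebraMap_mem _ a, by simp⟩
  | add f₁ f₂ h₁ h₂ =>
    obtain ⟨N₁, f₁', hf₁, h₁⟩ := h₁
    obtain ⟨N₂, f₂', hf₂, h₂⟩ := h₂
    refine ⟨N₁ + N₂, u ^ N₂ * f₁' + u ^ N₁ * f₂', add_mem (mul_mem (pow_mem hu _) hf₁)
      (mul_mem (pow_mem hu _) hf₂), ?_⟩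
    convert add_mem (Ideal.mul_mem_left _ (u ^ N₂) h₁) (Ideal.mul_mem_left _ (u ^ N₁) h₂) using 1
    ring
  | mul_X f s h =>
    obtain ⟨N, f', hf, h⟩ := h
    by_cases hs : s = i
    · subst hs
      refine ⟨N + 1, -f' * g, mul_mem (neg_mem hf) hg, ?_⟩
      convert add_mem (Ideal.mul_mem_left _ (u * X s) h)
        (Ideal.mul_mem_left _ f' (Ideal.mem_span_singleton_self (u * X s + g))) using 1
      ring
    · refine ⟨N, f' * X s, mul_mem hf (X_mem_supported.2 hs), ?_⟩
      convert Ideal.mul_mem_right (X s) _ h using 1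
      ring

section Elimination

variable {K : Type*} [Field K] [Algebra k K]

open Classical in
/-- The homomorphism that agrees with `ι` on all variables other than `X i` and eliminates `X i`
by means of the equation `u * X i + g = 0`. -/
def elimination (ι : MvPolynomial σ k →ₐ[k] K) (i : σ) (u g : MvPolynomial σ k) :
    MvPolynomial σ k →ₐ[k] K :=
  aeval (fun s => if s = i then -ι g / ι u else ι (X s))

theorem elimination_of_mem_supported (ι : MvPolynomial σ k →ₐ[k] K) {i : σ}
    (u g : MvPolynomial σ k) {f : MvPolynomial σ k} (hf : f ∈ supported k {i}ᶜ) :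
    elimination ι i u g f = ι f := by
  suffices h : supported k {i}ᶜ ≤ AlgHom.equalizer (elimination ι i u g) ι from h hf
  rw [supported, Algebra.adjoin_le_iff]
  rintro _ ⟨s, hs, rfl⟩
  exact (aeval_X _ _).trans (if_neg hs)

theorem elimination_equation {ι : MvPolynomial σ k →ₐ[k] K} {i : σ} {u g : MvPolynomial σ k}
    (hu : u ∈ supported k {i}ᶜ) (hg : g ∈ supported k {i}ᶜ) (hιu : ι u ≠ 0) :
    elimination ι i u g (u * X i + g) = 0 := by
  have hi : elimination ι i u g (X i) = -ι g / ι u := (aeval_X _ _).trans (if_pos rfl)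
  rw [map_add, map_mul, elimination_of_mem_supported ι u g hu,
    elimination_of_mem_supported ι u g hg, hi, mul_div_cancel₀ _ hιu, neg_add_cancel]

end Elimination

/-- Away from `u = 0` the equation `u * X i + g = 0` eliminates `X i`, which leaves the domain
`k[X] / q`; that `u` is regular modulo both equations excludes a component inside `u = 0`. -/
theorem isPrime_span_pair_of_linear {i : σ} {u g q : MvPolynomial σ k}
    (hu : u ∈ supported k {i}ᶜ) (hg : g ∈ supported k {i}ᶜ) (hq : q ∈ supported k {i}ᶜ)
    (hprime : Prime q) (hqu : ¬ q ∣ u)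
    (hreg : ∀ f, u * f ∈ Ideal.span {u * X i + g, q} → f ∈ Ideal.span {u * X i + g, q}) :
    (Ideal.span {u * X i + g, q}).IsPrime := by
  have := (Ideal.span_singleton_prime hprime.ne_zero).2 hprime
  let D := MvPolynomial σ k ⧸ Ideal.span {q}
  let ι : MvPolynomial σ k →ₐ[k] FractionRing D :=
    (IsScalarTower.toAlgHom k D _).comp (Ideal.Quotient.mkₐ k _)
  have hι : ∀ f, ι f = 0 ↔ q ∣ f := fun f => by
    rw [← Ideal.mem_span_singleton, ← Ideal.Quotient.eq_zero_iff_mem]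
    exact map_eq_zero_iff _ (IsFractionRing.injective D (FractionRing D))
  let φ := elimination ι i u g
  have hφq : φ q = 0 := by
    rw [elimination_of_mem_supported ι u g hq, hι]
  have hle : Ideal.span {u * X i + g, q} ≤ RingHom.ker φ := by
    rw [Ideal.span_le]
    rintro f (rfl | rfl)
    exacts [elimination_equation hu hg (mt (hι u).1 hqu), hφq]
  have hpow : ∀ (N : ℕ) f, u ^ N * f ∈ Ideal.span {u * X i + g, q} →
      f ∈ Ideal.span {u * X i + g, q} := fun N => by
    induction N with
    | zero => intro f hf; simpa using hf
    | succ N ih => exact fun f hf => ih f (hreg _ (by rwa [← mul_assoc, ← pow_succ']))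
  suffices h : RingHom.ker φ ≤ Ideal.span {u * X i + g, q} by
    rw [hle.antisymm h]
    exact RingHom.ker_isPrime _
  intro f hf
  obtain ⟨N, f', hf', hN⟩ := exists_pow_mul_sub_mem_span hu hg f
  replace hN : u ^ N * f - f' ∈ Ideal.span {u * X i + g, q} := Ideal.span_mono (by simp) hN
  have hφf' : φ f' = 0 := by
    simpa [RingHom.mem_ker.1 hf] using RingHom.mem_ker.1 (hle hN)
  rw [elimination_of_mem_supported ι u g hf', hι] at hφf'
  have hf'J := Ideal.mem_of_dvd (Ideal.span {u * X i + g, q}) hφf' (Ideal.subset_span (by simp))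
  exact hpow N f ((Submodule.sub_mem_iff_left _ hf'J).1 hN)

end LinearElimination

/-! ### The incidence variety in `ℙ² × ℙ²` -/

/-- The bihomogeneous coordinate ring of `ℙ(V) × ℙ(V*)`: the variables `Sum.inl` are the
coordinates of a vector, the variables `Sum.inr` those of a covector. -/
abbrev BiPoly : Type := MvPolynomial (Fin 3 ⊕ Fin 3) ℂ

/-- The coordinates of the vector. -/
abbrev xv (k : Fin 3) : BiPoly := X (Sum.inl k)

/-- The coordinates of the covector. -/
abbrev yv (k : Fin 3) : BiPoly := X (Sum.inr k)

/-- The bilinear form `y M x` of a matrix `M`, as a polynomial. -/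
def bilin : Matrix (Fin 3) (Fin 3) ℂ →ₗ[ℂ] BiPoly where
  toFun M := ∑ j, ∑ k, C (M j k) * (yv j * xv k)
  map_add' M N := by simp [add_mul, Finset.sum_add_distrib]
  map_smul' c M := by simp [Finset.mul_sum, mul_assoc, MvPolynomial.smul_eq_C_mul]

theorem bilin_apply (M : Matrix (Fin 3) (Fin 3) ℂ) :
    bilin M = ∑ j, ∑ k, C (M j k) * (yv j * xv k) := rfl

/-- The equation `y x = 0` of the incidence variety, which is `ℙ(T)` for `T` the tangent bundle
of `ℙ(V)`: a functional on `Hom(p, V / p)` is a covector that vanishes on the line `p`. -/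
def incidence : BiPoly := bilin 1

theorem incidence_eq : incidence = xv 0 * yv 0 + xv 1 * yv 1 + xv 2 * yv 2 := by
  simp [incidence, bilin_apply, Fin.sum_univ_three, mul_comm]

theorem bilin_single (j k : Fin 3) : bilin (Matrix.single j k 1) = yv j * xv k := by
  simp [bilin_apply, Matrix.single_apply, ite_and, apply_ite C, ite_mul]

theorem eval_bilin (x y : Fin 3 → ℂ) (M : Matrix (Fin 3) (Fin 3) ℂ) :
    eval (Sum.elim x y) (bilin M) = y ⬝ᵥ M.mulVec x := by
  simp only [bilin_apply, map_sum, map_mul, eval_C, eval_X, Sum.elim_inl, Sum.elim_inr,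
    dotProduct, Matrix.mulVec, Finset.mul_sum]
  exact Finset.sum_congr rfl fun j _ => Finset.sum_congr rfl fun k _ => by ring

theorem eval_incidence (x y : Fin 3 → ℂ) : eval (Sum.elim x y) incidence = y ⬝ᵥ x := by
  rw [incidence, eval_bilin, Matrix.one_mulVec]

theorem prime_incidence : Prime incidence := by
  have hvars : xv 1 * yv 1 + xv 2 * yv 2 ∈ supported ℂ {Sum.inr (0 : Fin 3)}ᶜ :=
    add_mem (mul_mem (X_mem_supported.2 (by simp)) (X_mem_supported.2 (by simp)))
      (mul_mem (X_mem_supported.2 (by simp)) (X_mem_supported.2 (by simp)))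
  have hdvd : ¬ xv 0 ∣ xv 1 * yv 1 + xv 2 * yv 2 :=
    not_dvd_of_eval_ne_zero (Sum.elim ![0, 1, 0] ![0, 1, 0]) (by simp) (by simp)
  simpa [incidence_eq, add_assoc] using
    prime_C_mul_X_mul_X_add (one_ne_zero (α := ℂ)) (by simp) hvars hdvd

theorem prime_killVar_incidence (s : Fin 3 ⊕ Fin 3) : Prime (killVar s incidence) := by
  have key : ∀ i j : Fin 3, i ≠ j → Prime (xv i * yv i + xv j * yv j) := fun i j hij => by
    simpa using prime_add_of_two_monomials (k := ℂ) (a := Sum.inl i) (b := Sum.inl j)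
      (i := Sum.inr i) (j := Sum.inr j) one_ne_zero one_ne_zero (by simp) (by simp)
      (by simpa using hij.symm) (by simpa using hij) (by simp)
  rw [incidence_eq]
  rcases s with k | k <;> fin_cases k
  · simpa [killVar] using key 1 2 (by decide)
  · simpa [killVar] using key 0 2 (by decide)
  · simpa [killVar] using key 0 1 (by decide)
  · simpa [killVar] using key 1 2 (by decide)
  · simpa [killVar] using key 0 2 (by decide)
  · simpa [killVar] using key 0 1 (by decide)

theorem isPrime_span_incidence {q : BiPoly} (hq : q ∈ supported ℂ {Sum.inr 2}ᶜ) (hprime : Prime q)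
    (hqx : ¬ q ∣ xv 2) (hkill : ¬ killVar (.inl 2) incidence ∣ killVar (.inl 2) q) :
    (Ideal.span {incidence, q}).IsPrime := by
  have hF : incidence = xv 2 * yv 2 + (xv 0 * yv 0 + xv 1 * yv 1) := by
    rw [incidence_eq, add_comm]
  have hreg : ∀ f, xv 2 * f ∈ Ideal.span {incidence, q} → f ∈ Ideal.span {incidence, q} :=
    fun f => mem_span_pair_of_X_mul_mem (prime_killVar_incidence _) hkill
  rw [hF] at hreg ⊢
  refine isPrime_span_pair_of_linear (X_mem_supported.2 (by simp)) ?_ hq hprime hqx hreg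
  exact add_mem (mul_mem (X_mem_supported.2 (by simp)) (X_mem_supported.2 (by simp)))
    (mul_mem (X_mem_supported.2 (by simp)) (X_mem_supported.2 (by simp)))

theorem isPrime_span_incidence_two_terms {a b : Fin 3} (hab : a ≠ b) {μ ν : ℂ} (hμ : μ ≠ 0)
    (hν : ν ≠ 0) (hkill : ¬ killVar (.inl 2) incidence ∣
      killVar (.inl 2) (C μ * (xv a * yv 0) + C ν * (xv b * yv 1))) :
    (Ideal.span {incidence, C μ * (xv a * yv 0) + C ν * (xv b * yv 1)}).IsPrime := by
  refine isPrime_span_incidence ?_ ?_ ?_ hkill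
  · exact add_mem
      (mul_mem (Subalgebra.algebraMap_mem _ μ)
        (mul_mem (X_mem_supported.2 (by simp)) (X_mem_supported.2 (by simp))))
      (mul_mem (Subalgebra.algebraMap_mem _ ν)
        (mul_mem (X_mem_supported.2 (by simp)) (X_mem_supported.2 (by simp))))
  · exact prime_add_of_two_monomials hμ hν (by simp) (by simp) (by simp) (by simpa) (by simp)
  · exact not_dvd_of_eval_ne_zero (Sum.elim ![0, 0, 1] 0) (by simp) (by simp)

/-! ### Graded pieces of complete intersections of codimension two -/

section GradedPieces

theorem finrank_quotient_submoduleOf_add {k E : Type*} [DivisionRing k] [AddCommGroup E]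
    [Module k E] (W N : Submodule k E) [FiniteDimensional k N] :
    Module.finrank k (N ⧸ W.submoduleOf N) + Module.finrank k (W ⊓ N : Submodule k E) =
      Module.finrank k N := by
  have hmap : W ⊓ N = (W.submoduleOf N).map N.subtype := by
    rw [Submodule.submoduleOf, Submodule.map_comap_subtype, inf_comm]
  rw [← Submodule.finrank_quotient_add_finrank (W.submoduleOf N), hmap,
    Submodule.finrank_map_subtype_eq]

variable {ι k A : Type*} [AddCommMonoid ι] [DecidableEq ι] [Field k] [CommRing A] [Algebra k A]
  (𝒜 : ι → Submodule k A) [GradedAlgebra 𝒜]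

theorem isHomogeneous_span_pair {d e : ι} {F q : A} (hF : F ∈ 𝒜 d) (hq : q ∈ 𝒜 e) :
    (Ideal.span {F, q}).IsHomogeneous 𝒜 :=
  Ideal.homogeneous_span _ _ (by rintro _ (rfl | rfl) <;> exact ⟨_, ‹_›⟩)

theorem sup_inf_piece {I J : Ideal A} (hI : I.IsHomogeneous 𝒜) (hJ : J.IsHomogeneous 𝒜) (d : ι) :
    (I ⊔ J).restrictScalars k ⊓ 𝒜 d =
      I.restrictScalars k ⊓ 𝒜 d ⊔ J.restrictScalars k ⊓ 𝒜 d := by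
  refine le_antisymm ?_ (sup_le (inf_le_inf_right _ fun _ => Ideal.mem_sup_left)
    (inf_le_inf_right _ fun _ => Ideal.mem_sup_right))
  rintro f ⟨hf, hd⟩
  obtain ⟨a, ha, b, hb, rfl⟩ := Submodule.mem_sup.1 hf
  rw [← DirectSum.decompose_of_mem_same 𝒜 hd, DirectSum.decompose_add, DirectSum.add_apply,
    Submodule.coe_add]
  exact Submodule.add_mem_sup ⟨hI d ha, SetLike.coe_mem _⟩ ⟨hJ d hb, SetLike.coe_mem _⟩

theorem span_pair_inf_piece {d₁ d₂ : ι} {F q : A} (hF : F ∈ 𝒜 d₁) (hq : q ∈ 𝒜 d₂) (d : ι) :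
    (Ideal.span {F, q}).restrictScalars k ⊓ 𝒜 d =
      (Ideal.span {F}).restrictScalars k ⊓ 𝒜 d ⊔ (Ideal.span {q}).restrictScalars k ⊓ 𝒜 d := by
  rw [Ideal.span_insert, sup_inf_piece 𝒜] <;>
  exact Ideal.homogeneous_span _ _ (by rintro _ rfl; exact ⟨_, ‹_›⟩)

theorem span_singleton_inf_piece_of_not_le [PartialOrder ι] [CanonicallyOrderedAdd ι] {e d : ι}
    {F : A} (hF : F ∈ 𝒜 e) (hd : ¬ e ≤ d) :
    (Ideal.span {F}).restrictScalars k ⊓ 𝒜 d = ⊥ := by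
  rw [eq_bot_iff]
  rintro f ⟨hf, hfd⟩
  obtain ⟨a, rfl⟩ := Ideal.mem_span_singleton.1 hf
  rw [Submodule.mem_bot, ← DirectSum.decompose_of_mem_same 𝒜 hfd,
    DirectSum.coe_decompose_mul_of_left_mem_of_not_le 𝒜 hF hd]

theorem span_singleton_inf_span_singleton_of_prime {R : Type*} [CommRing R] {p q : R}
    (hp : Prime p) (hpq : ¬ p ∣ q) :
    Ideal.span {p} ⊓ Ideal.span {q} = Ideal.span {p * q} := by
  refine le_antisymm (fun f hf => ?_) (le_inf ?_ ?_)
  · simp only [Ideal.mem_inf, Ideal.mem_span_singleton] at hf ⊢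
    obtain ⟨hpf, c, rfl⟩ := hf
    rw [mul_comm p]
    exact mul_dvd_mul_left q ((hp.dvd_or_dvd hpf).resolve_left hpq)
  · exact Ideal.span_singleton_le_span_singleton.2 (Dvd.intro _ rfl)
  · exact Ideal.span_singleton_le_span_singleton.2 (Dvd.intro_left _ rfl)

-- The Koszul resolution of `A / (F, q)`, in degree `d`.
theorem finrank_piece_quotient_span_pair {d₁ d₂ d : ι} {F q : A} [FiniteDimensional k (𝒜 d)]
    (hF : F ∈ 𝒜 d₁) (hFp : Prime F) (hq : q ∈ 𝒜 d₂) (hFq : ¬ F ∣ q) :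
    Module.finrank k (𝒜 d ⧸ ((Ideal.span {F, q}).restrictScalars k).submoduleOf (𝒜 d)) +
      (Module.finrank k ((Ideal.span {F}).restrictScalars k ⊓ 𝒜 d : Submodule k A) +
        Module.finrank k ((Ideal.span {q}).restrictScalars k ⊓ 𝒜 d : Submodule k A)) =
      Module.finrank k (𝒜 d) +
        Module.finrank k ((Ideal.span {F * q}).restrictScalars k ⊓ 𝒜 d : Submodule k A) := by
  have hinf : (Ideal.span {F}).restrictScalars k ⊓ 𝒜 d ⊓
      ((Ideal.span {q}).restrictScalars k ⊓ 𝒜 d) =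
      (Ideal.span {F * q}).restrictScalars k ⊓ 𝒜 d := by
    rw [← inf_inf_distrib_right, ← span_singleton_inf_span_singleton_of_prime hFp hFq]
    rfl
  rw [← Submodule.finrank_sup_add_finrank_inf_eq, ← span_pair_inf_piece 𝒜 hF hq, hinf,
    ← add_assoc, finrank_quotient_submoduleOf_add]

variable {κ : Type*} [AddCancelCommMonoid κ] [DecidableEq κ] (ℬ : κ → Submodule k A)
  [GradedAlgebra ℬ]

theorem span_singleton_inf_piece_add {e : κ} {F : A} (hF : F ∈ ℬ e) (d : κ) :
    (Ideal.span {F}).restrictScalars k ⊓ ℬ (e + d) = (ℬ d).map (LinearMap.mulLeft k F) := by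
  apply le_antisymm
  · rintro f ⟨hf, hd⟩
    obtain ⟨a, rfl⟩ := Ideal.mem_span_singleton.1 hf
    refine ⟨DirectSum.decompose ℬ a d, SetLike.coe_mem _, ?_⟩
    rw [LinearMap.mulLeft_apply, ← DirectSum.coe_decompose_mul_add_of_left_mem ℬ hF,
      DirectSum.decompose_of_mem_same ℬ hd]
  · rintro _ ⟨a, ha, rfl⟩
    exact ⟨Ideal.mul_mem_right _ _ (Ideal.mem_span_singleton_self F), SetLike.mul_mem_graded hF ha⟩

theorem finrank_span_singleton_inf_piece_add [IsDomain A] {e : κ} {F : A}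
    (hF : F ∈ ℬ e) (hF0 : F ≠ 0) (d : κ) :
    Module.finrank k ((Ideal.span {F}).restrictScalars k ⊓ ℬ (e + d) : Submodule k A) =
      Module.finrank k (ℬ d) := by
  rw [span_singleton_inf_piece_add ℬ hF]
  exact (Submodule.equivMapOfInjective (LinearMap.mulLeft k F)
    (fun _ _ h => mul_left_cancel₀ hF0 h) (ℬ d)).finrank_eq.symm

end GradedPieces

/-! ### The bigrading -/

section Bigrading

/-- The bidegrees of the coordinates. -/
def bideg : Fin 3 ⊕ Fin 3 → ℕ × ℕ := Sum.elim (fun _ => (1, 0)) (fun _ => (0, 1))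

/-- The bihomogeneous polynomials of a given bidegree. -/
abbrev biPart (d : ℕ × ℕ) : Submodule ℂ BiPoly := weightedHomogeneousSubmodule ℂ bideg d

attribute [local instance] MvPolynomial.weightedGradedAlgebra

theorem weight_bideg (d : Fin 3 ⊕ Fin 3 →₀ ℕ) :
    Finsupp.weight bideg d = (∑ k, d (.inl k), ∑ k, d (.inr k)) := by
  rw [Finsupp.weight_apply, Finsupp.sum_fintype _ _ (by simp)]
  ext <;> simp [bideg, Prod.fst_sum, Prod.snd_sum]

theorem card_finsupp_sum_eq (n : ℕ) :
    Nat.card {d : Fin 3 →₀ ℕ // ∑ k, d k = n} = (n + 2).choose 2 := by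
  have h : (n + 2).choose 2 = (Finset.finsuppAntidiag (Finset.univ (α := Fin 3)) n).card := by
    rw [Finset.card_finsuppAntidiag_nat_eq_choose, Finset.card_univ, Fintype.card_fin,
      show 3 + n - 1 = n + 2 by omega, ← Nat.choose_symm_add]
  rw [h, ← Nat.card_eq_finsetCard]
  exact Nat.card_congr (Equiv.subtypeEquivRight fun d => by simp)

theorem biPart_eq_restrictSupport (d : ℕ × ℕ) :
    biPart d = restrictSupport ℂ {c | Finsupp.weight bideg c = d} :=
  weightedHomogeneousSubmodule_eq_finsupp_supported ℂ bideg d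

/-- The exponents of bidegree `(a, b)` are the pairs of exponents of degrees `a` and `b` in three
variables; used to compute the dimension of `biPart (a, b)`. -/
def biExponentEquiv (a b : ℕ) : {c : Fin 3 ⊕ Fin 3 →₀ ℕ | Finsupp.weight bideg c = (a, b)} ≃
    {d : Fin 3 →₀ ℕ // ∑ k, d k = a} × {d : Fin 3 →₀ ℕ // ∑ k, d k = b} :=
  (Finsupp.sumFinsuppEquivProdFinsupp.subtypeEquiv
    (q := fun p => (∑ k, p.1 k = a) ∧ (∑ k, p.2 k = b)) (by
      intro c
      simp [weight_bideg, Finsupp.sumFinsuppEquivProdFinsupp])).trans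
    (Equiv.subtypeProdEquivProd (p := fun d : Fin 3 →₀ ℕ => ∑ k, d k = a)
      (q := fun d : Fin 3 →₀ ℕ => ∑ k, d k = b))

theorem finrank_biPart (a b : ℕ) :
    Module.finrank ℂ (biPart (a, b)) = (a + 2).choose 2 * (b + 2).choose 2 := by
  rw [biPart_eq_restrictSupport, Module.finrank_eq_nat_card_basis (basisRestrictSupport ℂ _),
    Nat.card_congr (biExponentEquiv a b), Nat.card_prod, card_finsupp_sum_eq, card_finsupp_sum_eq]

instance (d : ℕ × ℕ) : FiniteDimensional ℂ (biPart d) :=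
  Module.finite_of_finrank_pos (by
    rw [finrank_biPart]
    exact Nat.mul_pos (Nat.choose_pos (by omega)) (Nat.choose_pos (by omega)))

theorem xv_mem (k : Fin 3) : xv k ∈ biPart (1, 0) := isWeightedHomogeneous_X ℂ bideg _

theorem yv_mem (k : Fin 3) : yv k ∈ biPart (0, 1) := isWeightedHomogeneous_X ℂ bideg _

theorem bilin_mem (M : Matrix (Fin 3) (Fin 3) ℂ) : bilin M ∈ biPart (1, 1) := by
  rw [bilin_apply]
  exact Submodule.sum_mem _ fun j _ => Submodule.sum_mem _ fun k _ =>
    IsWeightedHomogeneous.C_mul (IsWeightedHomogeneous.mul (yv_mem j) (xv_mem k)) _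

theorem incidence_mem : incidence ∈ biPart (1, 1) := bilin_mem 1

theorem aeval_mul_of_isWeightedHomogeneous {σ R A M : Type*} [CommSemiring R] [CommSemiring A]
    [Algebra R A] [AddCommMonoid M] {w : σ → M} {m : M} {f : MvPolynomial σ R}
    (hf : f.IsWeightedHomogeneous w m) (χ : Multiplicative M →* A) (g : σ → A) :
    aeval (fun i => χ (.ofAdd (w i)) * g i) f = χ (.ofAdd m) * aeval g f := by
  induction hf using IsWeightedHomogeneous.induction_on with
  | zero => simp
  | add p q _ _ h₁ h₂ => rw [map_add, h₁, h₂, map_add, mul_add]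
  | monomial d r hr =>
    have hχ : χ (.ofAdd m) = d.prod fun i n => χ (.ofAdd (w i)) ^ n := by
      simp only [← hr, Finsupp.weight_apply, Finsupp.sum, Finsupp.prod, ofAdd_sum, map_prod,
        ofAdd_nsmul, map_pow]
    simp only [aeval_monomial, mul_pow, Finsupp.prod_mul, hχ]
    ring

theorem aeval_scale {A : Type*} [CommRing A] [Algebra ℂ A] {m n : ℕ} {f : BiPoly}
    (hf : f ∈ biPart (m, n)) (g : Fin 3 ⊕ Fin 3 → A) (s t : A) :
    aeval (Sum.elim (fun k => s * g (.inl k)) (fun k => t * g (.inr k))) f =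
      s ^ m * t ^ n * aeval g f := by
  let χ : Multiplicative (ℕ × ℕ) →* A :=
    { toFun := fun d => s ^ d.toAdd.1 * t ^ d.toAdd.2
      map_one' := by simp
      map_mul' := fun d d' => by simp only [toAdd_mul, Prod.fst_add, Prod.snd_add, pow_add]; ring }
  refine Eq.trans ?_ (aeval_mul_of_isWeightedHomogeneous hf χ g)
  congr 1
  ext (k | k) <;> simp [χ, bideg]

theorem isHomogeneous_span_incidence {e : ℕ × ℕ} {q : BiPoly} (hq : q ∈ biPart e) :
    (Ideal.span {incidence, q}).IsHomogeneous biPart :=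
  isHomogeneous_span_pair biPart incidence_mem hq

theorem finrank_span_singleton_inf_biPart {e d d' : ℕ × ℕ} {F : BiPoly} (hF : F ∈ biPart e)
    (hF0 : F ≠ 0) (h : e + d' = d) :
    Module.finrank ℂ ((Ideal.span {F}).restrictScalars ℂ ⊓ biPart d : Submodule ℂ BiPoly) =
      Module.finrank ℂ (biPart d') :=
  h ▸ finrank_span_singleton_inf_piece_add biPart hF hF0 d'

theorem finrank_biPart_quotient {e d d₁ d₂ d₃ : ℕ × ℕ} {q : BiPoly} (hq : q ∈ biPart e)
    (hFq : ¬ incidence ∣ q) (h₁ : (1, 1) + d₁ = d) (h₂ : e + d₂ = d) (h₃ : (1, 1) + d₃ = d₂) :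
    Module.finrank ℂ (biPart d ⧸
        ((Ideal.span {incidence, q}).restrictScalars ℂ).submoduleOf (biPart d)) +
      (Module.finrank ℂ (biPart d₁) + Module.finrank ℂ (biPart d₂)) =
      Module.finrank ℂ (biPart d) + Module.finrank ℂ (biPart d₃) := by
  have hq0 : q ≠ 0 := by rintro rfl; exact hFq (dvd_zero _)
  have hmul : incidence * q ∈ biPart ((1, 1) + e) := IsWeightedHomogeneous.mul incidence_mem hq
  have h := finrank_piece_quotient_span_pair biPart (d := d) incidence_mem prime_incidence hq hFq
  rwa [finrank_span_singleton_inf_biPart incidence_mem prime_incidence.ne_zero h₁,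
    finrank_span_singleton_inf_biPart hq hq0 h₂, finrank_span_singleton_inf_biPart (d' := d₃) hmul
      (mul_ne_zero prime_incidence.ne_zero hq0) (by rw [← h₂, ← h₃]; abel)] at h

theorem finrank_biPart_one_quotient {q : BiPoly} (hq : q ∈ biPart (1, 1))
    (hFq : ¬ incidence ∣ q) :
    Module.finrank ℂ (biPart (1, 1) ⧸
      ((Ideal.span {incidence, q}).restrictScalars ℂ).submoduleOf (biPart (1, 1))) = 7 := by
  have hq0 : q ≠ 0 := by rintro rfl; exact hFq (dvd_zero _)
  have hmul : incidence * q ∈ biPart (2, 2) := IsWeightedHomogeneous.mul incidence_mem hq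
  have h := finrank_piece_quotient_span_pair biPart (d := (1, 1)) incidence_mem prime_incidence hq
    hFq
  rw [finrank_span_singleton_inf_biPart incidence_mem prime_incidence.ne_zero (add_zero _),
    finrank_span_singleton_inf_biPart hq hq0 (add_zero _),
    span_singleton_inf_piece_of_not_le biPart hmul (by decide), finrank_bot,
    show (0 : ℕ × ℕ) = (0, 0) from rfl, finrank_biPart, finrank_biPart] at h
  norm_num [Nat.choose] at h
  omega

/-! ### The homomorphism of homogeneous coordinate rings -/

section Segre

variable {ι : Type} {B : ι → Matrix (Fin 3) (Fin 3) ℂ}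

/-- The homomorphism of coordinate rings of the map `(x, y) ↦ (y Bᵢ x)ᵢ`, which embeds the
incidence variety in projective space. -/
def segre (B : ι → Matrix (Fin 3) (Fin 3) ℂ) : MvPolynomial ι ℂ →ₐ[ℂ] BiPoly :=
  aeval (fun i => bilin (B i))

/-- The matrices `B` and the identity span the space of matrices: the bilinear forms `y Bᵢ x`
restrict to a spanning set of the sections of `𝒪(1, 1)` on the incidence variety. -/
def SpansModOne (B : ι → Matrix (Fin 3) (Fin 3) ℂ) : Prop :=
  ⊤ ≤ Submodule.span ℂ (Set.range B) ⊔ Submodule.span ℂ {1}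

theorem segre_X (i : ι) : segre B (X i) = bilin (B i) := aeval_X _ i

theorem segre_C (c : ℂ) : segre B (C c) = C c := algHom_C _ c

theorem segre_mem {n : ℕ} {f : MvPolynomial ι ℂ} (hf : f.IsHomogeneous n) :
    segre B f ∈ biPart (n, n) := by
  induction hf using IsWeightedHomogeneous.induction_on with
  | zero => simp
  | add p q hp hq h1 h2 => rw [map_add]; exact Submodule.add_mem _ h1 h2
  | monomial d r hr =>
    rw [segre, aeval_monomial, Finsupp.prod]
    have h1 := IsWeightedHomogeneous.prod d.support (fun i => bilin (B i) ^ d i)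
      (fun i => d i • ((1, 1) : ℕ × ℕ)) (w := bideg)
      fun i _ => IsWeightedHomogeneous.pow (bilin_mem (B i)) (d i)
    have h2 : ∑ i ∈ d.support, d i • ((1, 1) : ℕ × ℕ) = (n, n) := by
      rw [← Finset.sum_smul, ← hr, Finsupp.weight_apply, Finsupp.sum]
      simp
    exact (h2 ▸ h1).C_mul r

variable (B) in
/-- The image of a vector and a covector under the map given by the bilinear forms `y B x`, in
homogeneous coordinates. -/
def segrePoint (x y : Fin 3 → ℂ) : ι → ℂ := fun i => y ⬝ᵥ (B i).mulVec x

theorem eval_segre (x y : Fin 3 → ℂ) (f : MvPolynomial ι ℂ) :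
    eval (Sum.elim x y) (segre B f) = eval (segrePoint B x y) f := by
  have h : (aeval (Sum.elim x y)).comp (segre B) = aeval (R := ℂ) (segrePoint B x y) := by
    ext i
    simp only [AlgHom.comp_apply, segre_X, aeval_X, segrePoint, ← eval_bilin]
    rfl
  exact congr($h f)

theorem exists_linear (hB : SpansModOne B) (M : Matrix (Fin 3) (Fin 3) ℂ) :
    ∃ l : MvPolynomial ι ℂ, l.IsHomogeneous 1 ∧ bilin M - segre B l ∈ Ideal.span {incidence} := by
  have hspan : Submodule.span ℂ (Set.range B) ≤
      ((homogeneousSubmodule ι ℂ 1).map (segre B).toLinearMap).comap bilin := by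
    rw [Submodule.span_le]
    rintro _ ⟨i, rfl⟩
    exact ⟨X i, isHomogeneous_X ℂ i, segre_X i⟩
  obtain ⟨N, hN, _, hr, rfl⟩ := Submodule.mem_sup.1 (hB (Submodule.mem_top (x := M)))
  obtain ⟨r, rfl⟩ := Submodule.mem_span_singleton.1 hr
  obtain ⟨l, hl, hlN⟩ := hspan hN
  refine ⟨l, hl, ?_⟩
  rw [map_add, map_smul, ← hlN, ← incidence, smul_eq_C_mul]
  simpa using Ideal.mul_mem_left _ (C r) (Ideal.mem_span_singleton_self incidence)

theorem exists_eq_add_single_add_single {n : ℕ} {d : Fin 3 ⊕ Fin 3 →₀ ℕ}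
    (hd : Finsupp.weight bideg d = (n + 1, n + 1)) :
    ∃ d' j k, d = d' + (Finsupp.single (.inr j) 1 + Finsupp.single (.inl k) 1) ∧
      Finsupp.weight bideg d' = (n, n) := by
  rw [weight_bideg, Prod.mk.injEq] at hd
  obtain ⟨k, -, hk⟩ := Finset.exists_ne_zero_of_sum_ne_zero (hd.1.trans_ne n.succ_ne_zero)
  obtain ⟨j, -, hj⟩ := Finset.exists_ne_zero_of_sum_ne_zero (hd.2.trans_ne n.succ_ne_zero)
  have h : d - Finsupp.single (.inl k) 1 - Finsupp.single (.inr j) 1 +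
      (Finsupp.single (.inr j) 1 + Finsupp.single (.inl k) 1) = d := by
    rw [← add_assoc, Finsupp.sub_add_single_one_cancel (by simpa using hj),
      Finsupp.sub_add_single_one_cancel hk]
  refine ⟨_, j, k, h.symm, ?_⟩
  rw [← h] at hd
  simpa [weight_bideg, Finset.sum_add_distrib, Finsupp.single_apply] using hd

theorem exists_segre_monomial (hB : SpansModOne B) (n : ℕ) (d : Fin 3 ⊕ Fin 3 →₀ ℕ)
    (hd : Finsupp.weight bideg d = (n, n)) : ∃ f : MvPolynomial ι ℂ, f.IsHomogeneous n ∧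
      monomial d 1 - segre B f ∈ Ideal.span {incidence} := by
  induction n generalizing d with
  | zero =>
    have h0 : d = 0 := by
      simp only [weight_bideg, Prod.mk.injEq, Finset.sum_eq_zero_iff, Finset.mem_univ,
        true_imp_iff] at hd
      ext (i | i)
      exacts [hd.1 i, hd.2 i]
    exact ⟨1, isHomogeneous_one _ _, by simp [h0]⟩
  | succ n ih =>
    obtain ⟨d', j, k, rfl, hd'⟩ := exists_eq_add_single_add_single hd
    obtain ⟨f, hf, hf'⟩ := ih d' hd'
    obtain ⟨l, hl, hl'⟩ := exists_linear hB (Matrix.single j k 1)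
    rw [bilin_single] at hl'
    have hmul : monomial (d' + (Finsupp.single (.inr j) 1 + Finsupp.single (.inl k) 1)) (1 : ℂ) =
        monomial d' 1 * (yv j * xv k) := by
      simp [X, monomial_mul]
    refine ⟨f * l, hf.mul hl, ?_⟩
    rw [hmul, map_mul]
    convert Ideal.add_mem _ (Ideal.mul_mem_right (yv j * xv k) _ hf')
      (Ideal.mul_mem_left _ (segre B f) hl') using 1
    ring

theorem exists_segre (hB : SpansModOne B) {n : ℕ} {g : BiPoly} (hg : g ∈ biPart (n, n)) :
    ∃ f : MvPolynomial ι ℂ, f.IsHomogeneous n ∧ g - segre B f ∈ Ideal.span {incidence} := by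
  rw [mem_weightedHomogeneousSubmodule] at hg
  induction hg using IsWeightedHomogeneous.induction_on with
  | zero => exact ⟨0, isHomogeneous_zero _ _ _, by simp⟩
  | add p q _ _ h1 h2 =>
    obtain ⟨f, hf, hf'⟩ := h1
    obtain ⟨g, hg, hg'⟩ := h2
    refine ⟨f + g, hf.add hg, ?_⟩
    rw [map_add, add_sub_add_comm]
    exact Ideal.add_mem _ hf' hg'
  | monomial d r hr =>
    obtain ⟨f, hf, hf'⟩ := exists_segre_monomial hB n d hr
    refine ⟨C r * f, hf.C_mul r, ?_⟩
    have := Ideal.mul_mem_left _ (C r) hf'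
    rwa [mul_sub, C_mul_monomial, mul_one, ← segre_C (B := B), ← map_mul] at this

theorem hilbertFunction_comap (hB : SpansModOne B) {J : Ideal BiPoly} (hJ : incidence ∈ J)
    (n : ℕ) : hilbertFunction (J.comap (segre B)) n =
      Module.finrank ℂ (biPart (n, n) ⧸ (J.restrictScalars ℂ).submoduleOf (biPart (n, n))) := by
  let T : homogeneousSubmodule ι ℂ n →ₗ[ℂ] biPart (n, n) :=
    LinearMap.codRestrict _ ((segre B).toLinearMap ∘ₗ Submodule.subtype _)
      fun f => segre_mem ((mem_homogeneousSubmodule n _).1 f.2)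
  let U := ((J.restrictScalars ℂ).submoduleOf (biPart (n, n))).mkQ ∘ₗ T
  have hU : Function.Surjective U := by
    intro z
    obtain ⟨g, rfl⟩ := Submodule.mkQ_surjective _ z
    obtain ⟨f, hf, hf'⟩ := exists_segre hB g.2
    refine ⟨⟨f, hf⟩, (Submodule.Quotient.eq _).2 ?_⟩
    change segre B f - g ∈ J
    rw [← neg_sub, J.neg_mem_iff]
    exact (Ideal.span_singleton_le_iff_mem J).2 hJ hf'
  have hker : LinearMap.ker U = ((J.comap (segre B)).restrictScalars ℂ).submoduleOf
      (homogeneousSubmodule ι ℂ n) := by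
    ext f
    exact LinearMap.mem_ker.trans (Submodule.Quotient.mk_eq_zero _)
  rw [hilbertFunction, ← hker]
  exact (U.quotKerEquivOfSurjective hU).finrank_eq

theorem segre_homogeneousComponent (n : ℕ) (f : MvPolynomial ι ℂ) :
    segre B (homogeneousComponent n f) =
      weightedHomogeneousComponent bideg (n, n) (segre B f) := by
  have h : ∀ i, weightedHomogeneousComponent bideg (n, n) (segre B (homogeneousComponent i f)) =
      if n = i then segre B (homogeneousComponent n f) else 0 := by
    intro i
    rw [weightedHomogeneousComponent_of_mem (segre_mem (homogeneousComponent_isHomogeneous i f))]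
    by_cases hi : n = i
    · simp [hi]
    · simp [hi]
  conv_rhs => rw [← sum_homogeneousComponent f, map_sum, map_sum,
    Finset.sum_congr rfl fun i _ => h i, Finset.sum_ite_eq]
  split_ifs with hn
  · rfl
  · rw [homogeneousComponent_eq_zero _ _ (by simpa using hn), map_zero]

theorem homogeneousComponent_mem_comap {J : Ideal BiPoly} (hJ : J.IsHomogeneous biPart)
    {f : MvPolynomial ι ℂ} (hf : f ∈ J.comap (segre B)) (n : ℕ) :
    homogeneousComponent n f ∈ J.comap (segre B) := by
  rw [Ideal.mem_comap, segre_homogeneousComponent]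
  exact weightedHomogeneousComponent_mem_of_mem _ _ hJ hf _

theorem exists_sub_mul_mem_span_incidence (hB : SpansModOne B) {q : BiPoly}
    (hq : q ∈ biPart (1, 1)) {n : ℕ} {p : BiPoly} (hp : p ∈ biPart (n, n))
    (hpJ : p ∈ Ideal.span {incidence, q}) :
    ∃ g : MvPolynomial ι ℂ, p - segre B g * q ∈ Ideal.span {incidence} := by
  have hmem : p ∈ (Ideal.span {incidence, q}).restrictScalars ℂ ⊓ biPart (n, n) := ⟨hpJ, hp⟩
  rw [span_pair_inf_piece biPart incidence_mem hq] at hmem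
  obtain ⟨a, ha, b, hb, rfl⟩ := Submodule.mem_sup.1 hmem
  obtain ⟨g, hg⟩ : ∃ g, b - segre B g * q ∈ Ideal.span {incidence} := by
    cases n with
    | zero =>
      rw [span_singleton_inf_piece_of_not_le biPart hq (by decide), Submodule.mem_bot] at hb
      exact ⟨0, by simp [hb]⟩
    | succ m =>
      rw [show (m + 1, m + 1) = (1, 1) + (m, m) by simp [add_comm],
        span_singleton_inf_piece_add biPart hq] at hb
      obtain ⟨c, hc, rfl⟩ := hb
      obtain ⟨g, -, hg⟩ := exists_segre hB hc
      refine ⟨g, ?_⟩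
      rw [LinearMap.mulLeft_apply, mul_comm, ← sub_mul]
      exact Ideal.mul_mem_right _ _ hg
  exact ⟨g, by rw [add_sub_assoc]; exact Ideal.add_mem _ ha.1 hg⟩

theorem comap_segre_sup (hB : SpansModOne B) {q : BiPoly} (hq : q ∈ biPart (1, 1))
    {h : MvPolynomial ι ℂ} {α β : ℂ} (hα : α ≠ 0)
    (hh : segre B h = C α * q + C β * incidence) :
    (Ideal.span {incidence}).comap (segre B) ⊔ Ideal.span {h} =
      (Ideal.span {incidence, q}).comap (segre B) := by
  have hF : Ideal.span {incidence} ≤ Ideal.span {incidence, q} := Ideal.span_mono (by simp)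
  apply le_antisymm
  · refine sup_le (Ideal.comap_mono hF) ?_
    rw [Ideal.span_singleton_le_iff_mem, Ideal.mem_comap, hh]
    exact Ideal.add_mem _ (Ideal.mul_mem_left _ _ (Ideal.subset_span (by simp)))
      (Ideal.mul_mem_left _ _ (Ideal.subset_span (by simp)))
  intro f hf
  rw [← sum_homogeneousComponent f]
  refine Ideal.sum_mem _ fun n _ => ?_
  set f' := homogeneousComponent n f
  obtain ⟨g, hg⟩ := exists_sub_mul_mem_span_incidence hB hq
    (segre_mem (homogeneousComponent_isHomogeneous n f))
    (homogeneousComponent_mem_comap (isHomogeneous_span_incidence hq) hf n)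
  have hlift : f' - C α⁻¹ * g * h ∈ (Ideal.span {incidence}).comap (segre B) := by
    have hC : (C α⁻¹ * C α : BiPoly) = 1 := by rw [← map_mul, inv_mul_cancel₀ hα, map_one]
    have hsegre : segre B (f' - C α⁻¹ * g * h) =
        segre B f' - segre B g * q - C α⁻¹ * C β * segre B g * incidence := by
      rw [map_sub, map_mul, map_mul, segre_C, hh]
      linear_combination (- segre B g * q) * hC
    rw [Ideal.mem_comap, hsegre]
    exact Ideal.sub_mem _ hg (Ideal.mul_mem_left _ _ (Ideal.mem_span_singleton_self _))
  rw [← sub_add_cancel f' (C α⁻¹ * g * h)]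
  exact Ideal.add_mem _ (Ideal.mem_sup_left hlift)
    (Ideal.mem_sup_right (Ideal.mul_mem_left _ _ (Ideal.mem_span_singleton_self h)))

theorem le_saturation (I : Ideal (MvPolynomial ι ℂ)) : I ≤ saturation I :=
  fun f hf i => ⟨0, by simpa using hf⟩

theorem saturation_le {I P : Ideal (MvPolynomial ι ℂ)} (hP : P.IsPrime) (hI : I ≤ P)
    {i : ι} (hi : X i ∉ P) : saturation I ≤ P := by
  intro f hf
  obtain ⟨k, hk⟩ := hf i
  exact (hP.mem_or_mem (hI hk)).resolve_left fun h => hi (hP.mem_of_pow_mem k h)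

/-- The nonzero vector `x` and the nonzero covector `y` represent a point of `ℙ² × ℙ²` at which
all polynomials of the ideal `J` vanish. -/
structure IsZeroOf (J : Ideal BiPoly) (x y : Fin 3 → ℂ) : Prop where
  vec_ne_zero : x ≠ 0
  covec_ne_zero : y ≠ 0
  eval_eq_zero : ∀ f ∈ J, eval (Sum.elim x y) f = 0

theorem isZeroOf_span_pair {F q : BiPoly} {x y : Fin 3 → ℂ} (hx : x ≠ 0) (hy : y ≠ 0)
    (h₁ : eval (Sum.elim x y) F = 0) (h₂ : eval (Sum.elim x y) q = 0) :
    IsZeroOf (Ideal.span {F, q}) x y := by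
  refine ⟨hx, hy, fun f hf => ?_⟩
  obtain ⟨a, b, rfl⟩ := Ideal.mem_span_pair.1 hf
  simp [h₁, h₂]

theorem IsZeroOf.dotProduct_eq_zero {J : Ideal BiPoly} (hJ : incidence ∈ J) {x y : Fin 3 → ℂ}
    (h : IsZeroOf J x y) : y ⬝ᵥ x = 0 := by
  rw [← eval_incidence]
  exact h.eval_eq_zero _ hJ

theorem segrePoint_ne_zero (hB : SpansModOne B) {x y : Fin 3 → ℂ} (hx : x ≠ 0)
    (hy : y ≠ 0) (hxy : y ⬝ᵥ x = 0) : segrePoint B x y ≠ 0 := by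
  intro h
  let E : Matrix (Fin 3) (Fin 3) ℂ →ₗ[ℂ] ℂ := (aeval (Sum.elim x y)).toLinearMap ∘ₗ bilin
  have hE : ∀ M, E M = y ⬝ᵥ M.mulVec x := eval_bilin x y
  have hle : ⊤ ≤ LinearMap.ker E := hB.trans <| sup_le
    (Submodule.span_le.2 (by rintro _ ⟨i, rfl⟩; exact (hE _).trans (congr_fun h i)))
    (by simpa [Submodule.span_singleton_le_iff_mem, hE])
  obtain ⟨k, hk⟩ := Function.ne_iff.1 hx
  obtain ⟨j, hj⟩ := Function.ne_iff.1 hy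
  have hjk : E (Matrix.single j k 1) = 0 := hle Submodule.mem_top
  rw [hE, ← eval_bilin, bilin_single, map_mul, eval_X, eval_X] at hjk
  exact mul_ne_zero hj hk hjk

theorem exists_X_notMem (hB : SpansModOne B) {J : Ideal BiPoly} (hJ : incidence ∈ J)
    {x y : Fin 3 → ℂ} (h : IsZeroOf J x y) : ∃ i, X i ∉ J.comap (segre B) := by
  obtain ⟨i, hi⟩ := Function.ne_iff.1 (segrePoint_ne_zero hB h.vec_ne_zero h.covec_ne_zero
    (h.dotProduct_eq_zero hJ))
  refine ⟨i, fun hX => hi ?_⟩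
  have := h.eval_eq_zero _ hX
  rwa [eval_segre, eval_X] at this

/-! ### Degrees -/

theorem hasGrowth_two {H : ℕ → ℕ} {e : ℕ} (he : e ≠ 0) {b c : ℚ}
    (h : ∀ᶠ n : ℕ in Filter.atTop, (H n : ℚ) = e / 2 * n ^ 2 + b * n + c) : HasGrowth H 2 e := by
  have he' : (e : ℚ) / 2 ≠ 0 := by positivity
  refine ⟨Polynomial.C (e / 2 : ℚ) * Polynomial.X ^ 2 + Polynomial.C b * Polynomial.X +
    Polynomial.C c, ?_, Polynomial.natDegree_quadratic he', ?_⟩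
  · simpa using h
  · rw [Polynomial.leadingCoeff_quadratic he']
    norm_num

theorem not_incidence_dvd_X (s : Fin 3 ⊕ Fin 3) : ¬ incidence ∣ (X s : BiPoly) := by
  refine not_dvd_of_eval_ne_zero (Pi.single s 1) ?_ (by simp)
  rcases s with k | k <;> simp [incidence_eq, Pi.single_apply]

theorem hasGrowth_six (hB : SpansModOne B) {q : BiPoly} (hq : q ∈ biPart (1, 1))
    (hFq : ¬ incidence ∣ q) :
    HasGrowth (hilbertFunction ((Ideal.span {incidence, q}).comap (segre B))) 2 6 := by
  refine hasGrowth_two (b := 3) (c := 1) (by norm_num) ?_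
  filter_upwards [Filter.eventually_ge_atTop 2] with n hn
  obtain ⟨n, rfl⟩ := Nat.exists_eq_add_of_le' hn
  have hdim := finrank_biPart_quotient (d := (n + 2, n + 2)) (d₁ := (n + 1, n + 1))
    (d₂ := (n + 1, n + 1)) (d₃ := (n, n)) hq hFq (by ext <;> simp <;> omega)
    (by ext <;> simp <;> omega) (by ext <;> simp <;> omega)
  rw [← hilbertFunction_comap hB (Ideal.subset_span (by simp))] at hdim
  simp only [finrank_biPart] at hdim
  have hdimℚ := congr(($hdim : ℚ))
  push_cast [Nat.cast_choose_two] at hdimℚ ⊢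
  linear_combination hdimℚ

theorem hasGrowth_three (hB : SpansModOne B) (s : Fin 3 ⊕ Fin 3) :
    HasGrowth (hilbertFunction ((Ideal.span {incidence, (X s : BiPoly)}).comap (segre B))) 2 3 := by
  refine hasGrowth_two (b := 5 / 2) (c := 1) (by norm_num) ?_
  filter_upwards [Filter.eventually_ge_atTop 2] with n hn
  obtain ⟨n, rfl⟩ := Nat.exists_eq_add_of_le' hn
  rw [hilbertFunction_comap hB (Ideal.subset_span (by simp))]
  have hdim : ∃ d₂ d₃ : ℕ × ℕ, (d₂ = (n + 1, n + 2) ∧ d₃ = (n, n + 1) ∨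
      d₂ = (n + 2, n + 1) ∧ d₃ = (n + 1, n)) ∧ bideg s + d₂ = (n + 2, n + 2) ∧
      (1, 1) + d₃ = d₂ := by
    rcases s with k | k
    · exact ⟨_, _, .inl ⟨rfl, rfl⟩, by simp [bideg]; omega, by simp; omega⟩
    · exact ⟨_, _, .inr ⟨rfl, rfl⟩, by simp [bideg]; omega, by simp; omega⟩
  obtain ⟨d₂, d₃, hd, h₂, h₃⟩ := hdim
  have hdim := finrank_biPart_quotient (d₁ := (n + 1, n + 1)) (isWeightedHomogeneous_X ℂ bideg s)
    (not_incidence_dvd_X s) (by ext <;> simp <;> omega) h₂ h₃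
  rcases hd with ⟨rfl, rfl⟩ | ⟨rfl, rfl⟩ <;>
  · simp only [finrank_biPart] at hdim
    have hdimℚ := congr(($hdim : ℚ))
    push_cast [Nat.cast_choose_two] at hdimℚ ⊢
    linear_combination hdimℚ

theorem isIrreducibleSurface_six (hB : SpansModOne B) {q : BiPoly} (hq : q ∈ biPart (1, 1))
    (hFq : ¬ incidence ∣ q) (hJ : (Ideal.span {incidence, q}).IsPrime) :
    IsIrreducibleSurface ((Ideal.span {incidence, q}).comap (segre B)) 6 :=
  ⟨hJ.comap _,
    fun _ hf n => homogeneousComponent_mem_comap (isHomogeneous_span_incidence hq) hf n,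
    hasGrowth_six hB hq hFq⟩

theorem spansDim_six (hB : SpansModOne B) {q : BiPoly} (hq : q ∈ biPart (1, 1))
    (hFq : ¬ incidence ∣ q) :
    SpansDim ((Ideal.span {incidence, q}).comap (segre B)) 6 := by
  rw [SpansDim, hilbertFunction_comap hB (Ideal.subset_span (by simp))]
  exact finrank_biPart_one_quotient hq hFq

theorem isIrreducibleSurface_three (hB : SpansModOne B) (s : Fin 3 ⊕ Fin 3) :
    IsIrreducibleSurface ((Ideal.span {incidence, (X s : BiPoly)}).comap (segre B)) 3 := by
  have := isPrime_span_pair_X (prime_killVar_incidence s)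
  exact ⟨Ideal.comap_isPrime _ _, fun _ hf n => homogeneousComponent_mem_comap
    (isHomogeneous_span_incidence (isWeightedHomogeneous_X ℂ bideg s)) hf n, hasGrowth_three hB s⟩

end Segre

end Bigrading

/-! ### Normal forms of endomorphisms modulo scalars -/

section NormalForm

open Module LinearMap

variable {K W : Type*} [Field K] [AddCommGroup W] [Module K W]

theorem linearIndependent_triple {u v w : W}
    (h : ∀ a b c : K, a • u + b • v + c • w = 0 → a = 0 ∧ b = 0 ∧ c = 0) :
    LinearIndependent K ![u, v, w] := by
  rw [Fintype.linearIndependent_iff]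
  intro g hg
  rw [Fin.sum_univ_three] at hg
  obtain ⟨h₀, h₁, h₂⟩ := h _ _ _ hg
  intro i
  fin_cases i <;> assumption

theorem exists_basis_toMatrix_eq (hW : finrank K W = 3) {u v w : W}
    (h : LinearIndependent K ![u, v, w]) {A : End K W} {N : Matrix (Fin 3) (Fin 3) K}
    (hu : A u = N 0 0 • u + N 1 0 • v + N 2 0 • w) (hv : A v = N 0 1 • u + N 1 1 • v + N 2 1 • w)
    (hw : A w = N 0 2 • u + N 1 2 • v + N 2 2 • w) :
    ∃ e : Basis (Fin 3) K W, toMatrix e e A = N := by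
  set e := basisOfLinearIndependentOfCardEqFinrank h (by simp [hW])
  have hcoe : ⇑e = ![u, v, w] := coe_basisOfLinearIndependentOfCardEqFinrank h _
  refine ⟨e, ?_⟩
  rw [← LinearEquiv.eq_symm_apply, toMatrix_symm]
  refine e.ext fun k => ?_
  rw [Matrix.toLin_self, hcoe, Fin.sum_univ_three]
  fin_cases k
  · exact hu
  · exact hv
  · exact hw

/-- The Jordan normal forms of the nonscalar endomorphisms of a three-dimensional space, up to
adding a scalar. For every Jordan type the scalar is chosen so that the matrix is as sparse as
possible; in particular the last two forms are those of rank one. -/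
inductive IsNormalForm : Matrix (Fin 3) (Fin 3) K → Prop
  | diagonal (l m : K) (hl : l ≠ 0) (hm : m ≠ 0) (hlm : l ≠ m) :
      IsNormalForm !![l, 0, 0; 0, m, 0; 0, 0, 0]
  | twoBlocks (l : K) (hl : l ≠ 0) : IsNormalForm !![l, 0, 0; 0, 0, 1; 0, 0, 0]
  | oneBlock : IsNormalForm !![0, 1, 0; 0, 0, 1; 0, 0, 0]
  | rankOneDiagonal (l : K) (hl : l ≠ 0) : IsNormalForm !![0, 0, 0; 0, 0, 0; 0, 0, l]
  | rankOneNilpotent : IsNormalForm !![0, 0, 1; 0, 0, 0; 0, 0, 0]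

theorem exists_eq_smulRight_of_finrank_range_le_one {W' : Type*} [AddCommGroup W'] [Module K W']
    {M : W →ₗ[K] W'} (h : finrank K (range M) ≤ 1) [FiniteDimensional K (range M)] :
    ∃ (φ : Dual K W) (u : W'), M = φ.smulRight u := by
  obtain ⟨u, hu⟩ := finrank_le_one_iff.1 h
  rcases eq_or_ne u 0 with rfl | hu₀
  · refine ⟨0, 0, LinearMap.ext fun x => ?_⟩
    obtain ⟨c, hc⟩ := hu ⟨M x, mem_range_self _ _⟩
    simpa using congr(Subtype.val $hc).symm
  · have hmem (x) : M.rangeRestrict x ∈ Submodule.span K {u} :=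
      Submodule.mem_span_singleton.2 (hu _)
    refine ⟨(LinearEquiv.coord K _ u hu₀).toLinearMap ∘ₗ codRestrict _ M.rangeRestrict hmem, u,
      LinearMap.ext fun x => ?_⟩
    exact congr(Subtype.val $(LinearEquiv.coord_apply_smul K _ u hu₀ ⟨_, hmem x⟩)).symm

theorem exists_isNormalForm_smulRight_of_apply_eq_zero (hW : finrank K W = 3) {φ : Dual K W}
    {u : W} (hφ : φ ≠ 0) (hu : u ≠ 0) (hφu : φ u = 0) :
    ∃ e : Basis (Fin 3) K W, IsNormalForm (toMatrix e e (φ.smulRight u)) := by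
  have := FiniteDimensional.of_finrank_pos (K := K) (V := W) (by omega)
  obtain ⟨w, hw, hwu⟩ : ∃ w ∈ ker φ, w ∉ Submodule.span K {u} := by
    by_contra! hle
    have := Submodule.finrank_mono (show ker φ ≤ Submodule.span K {u} from hle)
    have := Dual.finrank_ker_add_one_of_ne_zero hφ
    have := finrank_span_singleton (K := K) hu
    omega
  obtain ⟨z, hz⟩ := LinearMap.surjective hφ 1
  have hli : LinearIndependent K ![u, w, z] := by
    refine linearIndependent_triple fun a b c habc => ?_
    obtain rfl : c = 0 := by simpa [hφu, mem_ker.1 hw, hz] using congr(φ $habc)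
    rw [zero_smul, add_zero] at habc
    obtain ⟨rfl, rfl⟩ := LinearIndependent.pair_iff.1
      ((LinearIndependent.pair_iff' hu).2 fun a ha => hwu (Submodule.mem_span_singleton.2 ⟨a, ha⟩))
      a b habc
    exact ⟨rfl, rfl, rfl⟩
  obtain ⟨e, he⟩ := exists_basis_toMatrix_eq hW hli (A := φ.smulRight u)
    (N := !![0, 0, 1; 0, 0, 0; 0, 0, 0]) (by simp [hφu]) (by simp [mem_ker.1 hw]) (by simp [hz])
  exact ⟨e, he ▸ .rankOneNilpotent⟩

theorem exists_isNormalForm_smulRight_of_apply_ne_zero (hW : finrank K W = 3) {φ : Dual K W}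
    {u : W} (hφu : φ u ≠ 0) :
    ∃ e : Basis (Fin 3) K W, IsNormalForm (toMatrix e e (φ.smulRight u)) := by
  have := FiniteDimensional.of_finrank_pos (K := K) (V := W) (by omega)
  have hker : finrank K (ker φ) = 2 := by
    have := Dual.finrank_ker_add_one_of_ne_zero (f := φ) (by rintro rfl; exact hφu rfl)
    omega
  let v := finBasisOfFinrankEq K (ker φ) hker
  have hv (k) : φ (v k : W) = 0 := (v k).2
  have hli : LinearIndependent K ![(v 0 : W), (v 1 : W), u] := by
    refine linearIndependent_triple fun a b c habc => ?_
    obtain rfl : c = 0 := by simpa [hφu, hv] using congr(φ $habc)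
    have h := Fintype.linearIndependent_iff.1 v.linearIndependent ![a, b] (by
      rw [Fin.sum_univ_two]
      ext1
      simpa using habc)
    exact ⟨h 0, h 1, rfl⟩
  obtain ⟨e, he⟩ := exists_basis_toMatrix_eq hW hli (A := φ.smulRight u)
    (N := !![0, 0, 0; 0, 0, 0; 0, 0, φ u]) (by simp [hv]) (by simp [hv]) (by simp)
  exact ⟨e, he ▸ .rankOneDiagonal _ hφu⟩

theorem exists_isNormalForm_of_finrank_range_le_one (hW : finrank K W = 3) {M : End K W}
    (hM : M ≠ 0) (h : finrank K (range M) ≤ 1) :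
    ∃ e : Basis (Fin 3) K W, IsNormalForm (toMatrix e e M) := by
  have := FiniteDimensional.of_finrank_pos (K := K) (V := W) (by omega)
  obtain ⟨φ, u, rfl⟩ := exists_eq_smulRight_of_finrank_range_le_one h
  by_cases hφu : φ u = 0
  · refine exists_isNormalForm_smulRight_of_apply_eq_zero hW ?_ ?_ hφu <;>
    · rintro rfl
      exact hM (by ext; simp)
  · exact exists_isNormalForm_smulRight_of_apply_ne_zero hW hφu

theorem mul_ne_zero_of_finrank_lt [FiniteDimensional K W] {M M' : End K W}
    (h : finrank K W < finrank K (range M) + finrank K (range M')) : M * M' ≠ 0 := by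
  intro h₀
  have hle : range M' ≤ ker M := by
    rintro _ ⟨x, rfl⟩
    exact congr($h₀ x)
  have := Submodule.finrank_mono hle
  have := finrank_range_add_finrank_ker M
  omega

theorem exists_isNormalForm_of_cube_eq_zero (hW : finrank K W = 3) {M : End K W} {z : W}
    (h₀ : M (M (M z)) = 0) (hz : M (M z) ≠ 0) :
    ∃ e : Basis (Fin 3) K W, IsNormalForm (toMatrix e e M) := by
  have hli : LinearIndependent K ![M (M z), M z, z] := by
    refine linearIndependent_triple fun a b c habc => ?_
    obtain rfl : c = 0 := by simpa [h₀, hz] using congr(M (M $habc))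
    obtain rfl : b = 0 := by simpa [h₀, hz] using congr(M $habc)
    simpa [hz] using habc
  obtain ⟨e, he⟩ := exists_basis_toMatrix_eq hW hli (A := M)
    (N := !![0, 1, 0; 0, 0, 1; 0, 0, 0]) (by simp [h₀]) (by simp) (by simp)
  exact ⟨e, he ▸ .oneBlock⟩

theorem exists_isNormalForm_of_hasEigenvector (hW : finrank K W = 3) {M : End K W} {d : K}
    (hd : d ≠ 0) {u w : W} (hu : M.HasEigenvector d u) (h₀ : M (M w) = 0) (hw : M w ≠ 0) :
    ∃ e : Basis (Fin 3) K W, IsNormalForm (toMatrix e e M) := by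
  have hMu : M u = d • u := hu.apply_eq_smul
  have hli : LinearIndependent K ![u, M w, w] := by
    refine linearIndependent_triple fun a b c habc => ?_
    obtain rfl : a = 0 := by simpa [h₀, hMu, hd, hu.2] using congr(M (M $habc))
    obtain rfl : c = 0 := by simpa [h₀, hw] using congr(M $habc)
    simpa [hw] using habc
  obtain ⟨e, he⟩ := exists_basis_toMatrix_eq hW hli (A := M)
    (N := !![d, 0, 0; 0, 0, 1; 0, 0, 0]) (by simp [hMu]) (by simp [h₀]) (by simp)
  exact ⟨e, he ▸ .twoBlocks d hd⟩

theorem exists_isNormalForm_of_double_eigenvalue (hW : finrank K W = 3) {M : End K W}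
    (hrank : ∀ r : K, 2 ≤ finrank K (range (M - r • 1))) {d : K} (hd : M.HasEigenvalue d)
    (hM : M * (M * (M - d • 1)) = 0) :
    ∃ e : Basis (Fin 3) K W, IsNormalForm (toMatrix e e M) := by
  have := FiniteDimensional.of_finrank_pos (K := K) (V := W) (by omega)
  obtain ⟨z, hz⟩ : ∃ z, M ((M - d • 1) z) ≠ 0 := by
    by_contra! h
    have h₀ := hrank 0
    rw [zero_smul, sub_zero] at h₀
    have hd := hrank d
    exact mul_ne_zero_of_finrank_lt (by omega) (LinearMap.ext h : M * (M - d • 1) = 0)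
  have h₀ : M (M ((M - d • 1) z)) = 0 := congr($hM z)
  by_cases hd₀ : d = 0
  · subst hd₀
    rw [zero_smul, sub_zero] at hz h₀
    exact exists_isNormalForm_of_cube_eq_zero hW h₀ hz
  · obtain ⟨u, hu⟩ := hd.exists_hasEigenvector
    exact exists_isNormalForm_of_hasEigenvector hW hd₀ hu h₀ hz

theorem hasEigenvector_sub_smul {A : End K W} {c : K} {u : W} (h : A.HasEigenvector c u) (r : K) :
    (A - r • 1).HasEigenvector (c - r) u :=
  ⟨End.mem_eigenspace_iff.2 (by simp [h.apply_eq_smul, sub_smul]), h.2⟩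

theorem exists_isNormalForm_of_distinct_eigenvalues (hW : finrank K W = 3) {A : End K W}
    {a b c : K} (ha : A.HasEigenvalue a) (hb : A.HasEigenvalue b) (hc : A.HasEigenvalue c)
    (hab : a ≠ b) (hac : a ≠ c) (hbc : b ≠ c) :
    ∃ e : Basis (Fin 3) K W, IsNormalForm (toMatrix e e (A - c • 1)) := by
  obtain ⟨u, hu⟩ := ha.exists_hasEigenvector
  obtain ⟨v, hv⟩ := hb.exists_hasEigenvector
  obtain ⟨w, hw⟩ := hc.exists_hasEigenvector
  have hli : LinearIndependent K ![u, v, w] := by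
    refine End.eigenvectors_linearIndependent' A ![a, b, c] ?_ _ (by
      simp [Fin.forall_fin_succ, hu, hv, hw])
    intro i j hij
    fin_cases i <;> fin_cases j <;> simp_all
  obtain ⟨e, he⟩ := exists_basis_toMatrix_eq hW hli (A := A - c • 1)
    (N := !![a - c, 0, 0; 0, b - c, 0; 0, 0, 0])
    (by simp [hu.apply_eq_smul, sub_smul]) (by simp [hv.apply_eq_smul, sub_smul])
    (by simp [hw.apply_eq_smul])
  exact ⟨e, he ▸ .diagonal _ _ (sub_ne_zero.2 hac) (sub_ne_zero.2 hbc) (sub_left_injective.ne hab)⟩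

theorem exists_eigenvalues [IsAlgClosed K] (hW : finrank K W = 3) (A : End K W) :
    ∃ a b c : K, A.HasEigenvalue a ∧ A.HasEigenvalue b ∧ A.HasEigenvalue c ∧
      (A - a • 1) * ((A - b • 1) * (A - c • 1)) = 0 := by
  have := FiniteDimensional.of_finrank_pos (K := K) (V := W) (by omega)
  have hsplit := IsAlgClosed.splits A.charpoly
  have hmonic := A.charpoly_monic
  obtain ⟨a, b, c, habc⟩ : ∃ a b c, A.charpoly.roots = {a, b, c} := by
    rw [← Multiset.card_eq_three, ← hsplit.natDegree_eq_card_roots, A.charpoly_natDegree, hW]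
  have hroot (t) (ht : t ∈ ({a, b, c} : Multiset K)) : A.HasEigenvalue t := by
    rw [← habc, Polynomial.mem_roots hmonic.ne_zero] at ht
    exact (End.hasEigenvalue_iff_isRoot_charpoly A t).2 ht
  refine ⟨a, b, c, hroot a (by simp), hroot b (by simp), hroot c (by simp), ?_⟩
  have h := A.aeval_self_charpoly
  rw [hsplit.eq_prod_roots_of_monic hmonic, habc] at h
  simpa [Algebra.algebraMap_eq_smul_one] using h

theorem exists_isNormalForm_sub_smul [IsAlgClosed K] (hW : finrank K W = 3) {A : End K W}
    (hA : ∀ r : K, A ≠ r • 1) :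
    ∃ (r : K) (e : Basis (Fin 3) K W), IsNormalForm (toMatrix e e (A - r • 1)) := by
  by_cases! hrank : ∃ r : K, finrank K (range (A - r • 1)) ≤ 1
  · obtain ⟨r, hr⟩ := hrank
    exact ⟨r, exists_isNormalForm_of_finrank_range_le_one hW (sub_ne_zero.2 (hA r)) hr⟩
  obtain ⟨a, b, c, ha, hb, hc, hCH⟩ := exists_eigenvalues hW A
  have hcomm (r s : K) : Commute (A - r • 1) (A - s • 1) := by
    simp only [← Algebra.algebraMap_eq_smul_one]
    exact ((Commute.refl A).sub_right (Algebra.commutes _ _).symm).sub_left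
      (Algebra.commutes _ _)
  have hdouble (r t : K) (ht : A.HasEigenvalue t)
      (h : (A - r • 1) * ((A - r • 1) * (A - t • 1)) = 0) :
      ∃ e : Basis (Fin 3) K W, IsNormalForm (toMatrix e e (A - r • 1)) := by
    obtain ⟨u, hu⟩ := ht.exists_hasEigenvector
    refine exists_isNormalForm_of_double_eigenvalue hW (fun s => ?_)
      (End.hasEigenvalue_of_hasEigenvector (hasEigenvector_sub_smul hu r)) ?_
    · rw [sub_sub, ← add_smul]
      exact hrank _
    · rwa [sub_sub, ← add_smul, add_sub_cancel]
  by_cases hab : a = b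
  · subst hab
    exact ⟨a, hdouble a c hc hCH⟩
  by_cases hac : a = c
  · subst hac
    exact ⟨a, hdouble a b hb (by rwa [(hcomm a b).eq])⟩
  by_cases hbc : b = c
  · subst hbc
    refine ⟨b, hdouble b a ha ?_⟩
    rwa [(hcomm b a).eq, ← mul_assoc, (hcomm b a).eq, mul_assoc]
  exact ⟨c, exists_isNormalForm_of_distinct_eigenvalues hW ha hb hc hab hac hbc⟩

end NormalForm

/-! ### The equations of the embedded projectivized tangent bundle -/

section Equations

/-- A representative of a section, as an endomorphism of `V`. -/
def liftSection (s : Sections) : Module.End ℂ V := (Submodule.Quotient.mk_surjective _ s).choose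

theorem mkQ_liftSection (s : Sections) :
    (Submodule.span ℂ {(1 : Module.End ℂ V)}).mkQ (liftSection s) = s :=
  (Submodule.Quotient.mk_surjective _ s).choose_spec

theorem evalSection_apply (p : ℙ ℂ V) (s : Sections) :
    evalSection p s = evalEnd p (liftSection s) := by
  conv_lhs => rw [← mkQ_liftSection s]
  rfl

theorem evalEnd_eq_of_apply_rep_eq {p : ℙ ℂ V} {A A' : Module.End ℂ V}
    (h : A p.rep = A' p.rep) : evalEnd p A = evalEnd p A' := by
  ext ⟨w, hw⟩
  rw [Projectivization.submodule_eq] at hw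
  obtain ⟨c, rfl⟩ := Submodule.mem_span_singleton.1 hw
  simp [evalEnd, h]

theorem evalEnd_one (p : ℙ ℂ V) : evalEnd p 1 = 0 := by
  ext x
  simp [evalEnd]

theorem exists_dual_evalEnd {v : V} (hv : v ≠ 0) {φ : Module.Dual ℂ V} (hφ : φ v = 0) :
    ∃ q : Module.Dual ℂ (TangentAt (Projectivization.mk ℂ v hv)),
      ∀ A, q (evalEnd _ A) = φ (A v) := by
  have hle : (Projectivization.mk ℂ v hv).submodule ≤ LinearMap.ker φ := by
    rwa [Projectivization.submodule_mk, Submodule.span_singleton_le_iff_mem]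
  have hmem : v ∈ (Projectivization.mk ℂ v hv).submodule := by
    rw [Projectivization.submodule_mk]
    exact Submodule.mem_span_singleton_self v
  exact ⟨Submodule.liftQ _ φ hle ∘ₗ LinearMap.applyₗ ⟨v, hmem⟩, fun A => rfl⟩

theorem exists_dual_apply_rep {p : ℙ ℂ V} (q : Module.Dual ℂ (TangentAt p)) :
    ∃ φ : Module.Dual ℂ V, φ p.rep = 0 ∧ ∀ A, q (evalEnd p A) = φ (A p.rep) := by
  obtain ⟨χ, hχ⟩ := Module.Projective.exists_dual_eq_one ℂ p.rep_nonzero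
  refine ⟨q ∘ₗ evalEnd p ∘ₗ LinearMap.smulRightₗ χ, ?_, fun A => ?_⟩
  · suffices q (evalEnd p (χ.smulRight p.rep)) = 0 from this
    rw [evalEnd_eq_of_apply_rep_eq (A' := 1) (by simp [hχ]), evalEnd_one, map_zero]
  · exact congr_arg q (evalEnd_eq_of_apply_rep_eq (by simp [hχ]))

theorem apply_apply_eq_dotProduct_toMatrix_mulVec (e : Module.Basis (Fin 3) ℂ V)
    (φ : Module.Dual ℂ V) (A : Module.End ℂ V) (v : V) :
    φ (A v) = (φ ∘ e) ⬝ᵥ (LinearMap.toMatrix e e A).mulVec (e.repr v) := by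
  rw [LinearMap.toMatrix_mulVec_repr]
  conv_lhs => rw [← e.sum_repr (A v), map_sum]
  simp [dotProduct, mul_comm]

variable {ι : Type} (b : Module.Basis ι ℂ Sections) (e : Module.Basis (Fin 3) ℂ V)

/-- The matrices of representatives of the sections `b` in a basis `e`. -/
def sectionMatrix (i : ι) : Matrix (Fin 3) (Fin 3) ℂ :=
  LinearMap.toMatrix e e (liftSection (b i))

theorem spansModOne_sectionMatrix : SpansModOne (sectionMatrix b e) := by
  have hspan : Submodule.span ℂ (Set.range fun i => liftSection (b i)) ⊔ Submodule.span ℂ {1} =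
      ⊤ := by
    rw [sup_comm, ← Submodule.comap_map_mkQ, Submodule.map_span, ← Set.range_comp]
    simp only [Function.comp_def, mkQ_liftSection, b.span_eq, Submodule.comap_top]
  have hmap := congr_arg (Submodule.map (LinearMap.toMatrix e e).toLinearMap) hspan
  rw [Submodule.map_sup, Submodule.map_span, Submodule.map_span, ← Set.range_comp,
    Set.image_singleton, Submodule.map_top, LinearEquiv.range] at hmap
  simp only [LinearEquiv.coe_coe, LinearMap.toMatrix_one] at hmap
  exact hmap.ge

theorem naturalEmbedding_mk [Finite ι] (p : ℙ ℂ V) {q : Module.Dual ℂ (TangentAt p)}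
    (hq : q ≠ 0) : ∃ hv, naturalEmbedding b ⟨p, Projectivization.mk ℂ q hq⟩ =
      Projectivization.mk ℂ (fun i => q (evalEnd p (liftSection (b i)))) hv := by
  have h : ((b.constr ℂ (M' := ℂ)).symm.toLinearMap ∘ₗ (evalSection p).dualMap) q =
      fun i => q (evalEnd p (liftSection (b i))) := by
    ext i
    simp [Module.Basis.constr, evalSection_apply]
  have hv : (fun i => q (evalEnd p (liftSection (b i)))) ≠ 0 := by
    rw [← h, LinearMap.comp_apply]
    exact (LinearEquiv.map_ne_zero_iff _).2 <| (map_ne_zero_iff _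
      (LinearMap.dualMap_injective_of_surjective (evalSection_surjective p))).2 hq
  refine ⟨hv, ?_⟩
  simp only [naturalEmbedding, Projectivization.map_mk, h]

theorem mk_mem_range_naturalEmbedding_iff [Finite ι] {v : ι → ℂ} (hv : v ≠ 0) :
    Projectivization.mk ℂ v hv ∈ Set.range (naturalEmbedding b) ↔ ∃ x y : Fin 3 → ℂ, x ≠ 0 ∧
      y ≠ 0 ∧ y ⬝ᵥ x = 0 ∧ v = segrePoint (sectionMatrix b e) x y := by
  constructor
  · rintro ⟨⟨p, q⟩, hpq⟩
    induction q using Projectivization.ind with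
    | h q hq =>
    obtain ⟨hv', hmk⟩ := naturalEmbedding_mk b p hq
    rw [hmk, eq_comm, Projectivization.mk_eq_mk_iff'] at hpq
    obtain ⟨c, rfl⟩ := hpq
    obtain ⟨φ, hφ, hA⟩ := exists_dual_apply_rep q
    have hcoord (i) : c * q (evalEnd p (liftSection (b i))) =
        (c • (φ ∘ e)) ⬝ᵥ (sectionMatrix b e i).mulVec (e.repr p.rep) := by
      rw [hA, apply_apply_eq_dotProduct_toMatrix_mulVec e, smul_dotProduct]
      rfl
    refine ⟨e.repr p.rep, c • (φ ∘ e), ?_, ?_, ?_, funext hcoord⟩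
    · simpa using p.rep_nonzero
    · intro h
      exact hv (funext fun i => (hcoord i).trans (by simp [h]))
    · have := apply_apply_eq_dotProduct_toMatrix_mulVec e φ 1 p.rep
      rw [LinearMap.toMatrix_one, Matrix.one_mulVec, Module.End.one_apply, hφ] at this
      rw [smul_dotProduct, ← this, smul_zero]
  · rintro ⟨x, y, hx, -, hxy, rfl⟩
    have hA (A) := apply_apply_eq_dotProduct_toMatrix_mulVec e (e.constr ℂ y) A
      (e.equivFun.symm x)
    have hye : e.constr ℂ y ∘ e = y := funext (e.constr_basis ℂ y)
    have hxe : ⇑(e.repr (e.equivFun.symm x)) = x := e.equivFun.apply_symm_apply x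
    simp only [hye, hxe] at hA
    obtain ⟨q, hq⟩ := exists_dual_evalEnd (v := e.equivFun.symm x) 
      ((LinearEquiv.map_ne_zero_iff _).2 hx)
      (φ := e.constr ℂ y) (by simpa [hxy] using hA 1)
    simp only [hA] at hq
    have hq₀ : q ≠ 0 := by
      rintro rfl
      exact hv (funext fun i => (hq _).symm)
    obtain ⟨_, hmk⟩ := naturalEmbedding_mk b _ hq₀
    exact ⟨_, hmk.trans (by simp only [hq]; rfl)⟩

theorem mem_iff_forall_isZeroOf {J : Ideal BiPoly} (hJ : J.IsPrime) {j k : Fin 3}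
    (hjk : xv j * yv k ∉ J) {f : BiPoly} :
    f ∈ J ↔ ∀ x y, IsZeroOf J x y → eval (Sum.elim x y) f = 0 := by
  refine ⟨fun hf x y h => h.eval_eq_zero f hf, fun h => ?_⟩
  suffices xv j * yv k * f ∈ J from (hJ.mem_or_mem this).resolve_left hjk
  rw [← MvPolynomial.IsPrime.vanishingIdeal_zeroLocus (K := ℂ) J, mem_vanishingIdeal_iff]
  intro v hv
  obtain ⟨x, y, rfl⟩ : ∃ x y, v = Sum.elim x y := ⟨v ∘ .inl, v ∘ .inr, by simp⟩
  suffices x j ≠ 0 → y k ≠ 0 → eval (Sum.elim x y) f = 0 by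
    simp only [map_mul, aeval_X, Sum.elim_inl, Sum.elim_inr, aeval_eq_eval, mul_eq_zero]
    tauto
  intro hx hy
  exact h x y ⟨fun h => hx (by simp [h]), fun h => hy (by simp [h]), hv⟩

theorem vanishingIdeal_range [Finite ι] : vanishingIdeal (Set.range (naturalEmbedding b)) =
    (Ideal.span {incidence}).comap (segre (sectionMatrix b e)) := by
  ext f
  have hprime := (Ideal.span_singleton_prime prime_incidence.ne_zero).2 prime_incidence
  have hX (s) : (X s : BiPoly) ∉ Ideal.span {incidence} := by
    rw [Ideal.mem_span_singleton]
    exact not_incidence_dvd_X s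
  have hzero (x y : Fin 3 → ℂ) : IsZeroOf (Ideal.span {incidence}) x y ↔
      x ≠ 0 ∧ y ≠ 0 ∧ y ⬝ᵥ x = 0 := by
    refine ⟨fun h => ⟨h.vec_ne_zero, h.covec_ne_zero,
      h.dotProduct_eq_zero (Ideal.mem_span_singleton_self _)⟩, fun ⟨hx, hy, hxy⟩ => ?_⟩
    rw [← Ideal.span_pair_eq_span_left_iff_dvd.2 (dvd_refl _)]
    rw [← eval_incidence] at hxy
    exact isZeroOf_span_pair hx hy hxy hxy
  rw [Ideal.mem_comap, mem_iff_forall_isZeroOf hprime (j := 0) (k := 0)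
    fun h => (hprime.mem_or_mem h).elim (hX _) (hX _)]
  simp only [hzero, eval_segre]
  constructor
  · rintro hf x y ⟨hx, hy, hxy⟩
    have hv := segrePoint_ne_zero (spansModOne_sectionMatrix b e) hx hy hxy
    exact hf _ hv ((mk_mem_range_naturalEmbedding_iff b e hv).2 ⟨x, y, hx, hy, hxy, rfl⟩)
  · intro hf v hv hmem
    obtain ⟨x, y, hx, hy, hxy, rfl⟩ := (mk_mem_range_naturalEmbedding_iff b e hv).1 hmem
    exact hf x y ⟨hx, hy, hxy⟩

theorem exists_endomorphism [Finite ι] {h : MvPolynomial ι ℂ} (h_linear : h.IsHomogeneous 1)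
    (h_ne : h ≠ 0) : ∃ A : Module.End ℂ V, (∀ r : ℂ, A ≠ r • 1) ∧
      ∀ e : Module.Basis (Fin 3) ℂ V,
        segre (sectionMatrix b e) h = bilin (LinearMap.toMatrix e e A) := by
  have := Fintype.ofFinite ι
  obtain ⟨c, rfl⟩ : ∃ c : ι → ℂ, ∑ i, c i • X i = h := by
    rwa [← Submodule.mem_span_range_iff_exists_fun, ← homogeneousSubmodule_one_eq_span_X]
  refine ⟨∑ i, c i • liftSection (b i), fun r hr => h_ne ?_, fun e => ?_⟩
  · have hsum : ∑ i, c i • b i = 0 := by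
      have hr' := congr_arg (Submodule.span ℂ {(1 : Module.End ℂ V)}).mkQ hr
      have h₁ : (Submodule.span ℂ {(1 : Module.End ℂ V)}).mkQ 1 = 0 := by simp
      simpa only [map_sum, map_smul, mkQ_liftSection, h₁, smul_zero] using hr'
    simp [Fintype.linearIndependent_iff.1 b.linearIndependent c hsum]
  · simp only [map_sum, map_smul, segre_X, sectionMatrix]

end Equations

/-! ### Local rings of projective varieties as localizations of affine coordinate rings -/

section Chart

variable {ι : Type}

/-- The form of degree `n` that is obtained from the polynomial `f` of degree at most `n` by
multiplying its homogeneous components with powers of the linear form `l`. -/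
def homogenize (l f : MvPolynomial ι ℂ) (n : ℕ) : MvPolynomial ι ℂ :=
  ∑ d ∈ Finset.range (f.totalDegree + 1), homogeneousComponent d f * l ^ (n - d)

theorem isHomogeneous_homogenize {l f : MvPolynomial ι ℂ} {n : ℕ} (hl : l.IsHomogeneous 1)
    (hn : f.totalDegree ≤ n) : (homogenize l f n).IsHomogeneous n := by
  refine IsHomogeneous.sum _ _ _ fun d hd => ?_
  have h := (homogeneousComponent_isHomogeneous d f).mul (hl.pow (n - d))
  rw [Finset.mem_range] at hd
  rwa [show d + 1 * (n - d) = n by omega] at h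

theorem map_homogenize {A : Type*} [CommRing A] [Algebra ℂ A] {g : MvPolynomial ι ℂ →ₐ[ℂ] A}
    {l : MvPolynomial ι ℂ} (hg : g l = 1) (f : MvPolynomial ι ℂ) (n : ℕ) :
    g (homogenize l f n) = g f := by
  conv_rhs => rw [← sum_homogeneousComponent f]
  simp [homogenize, hg]

theorem aeval_const_mul {A : Type*} [CommRing A] [Algebra ℂ A] {n : ℕ} {f : MvPolynomial ι ℂ}
    (hf : f.IsHomogeneous n) (s : A) (g : ι → A) :
    aeval (fun i => s * g i) f = s ^ n * aeval g f := by
  simpa using aeval_mul_of_isWeightedHomogeneous hf (powersHom A s) g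

theorem mem_vanishingIdeal_mk {v : ι → ℂ} (hv : v ≠ 0) {f : MvPolynomial ι ℂ} {n : ℕ}
    (hf : f.IsHomogeneous n) :
    f ∈ vanishingIdeal {Projectivization.mk ℂ v hv} ↔ eval v f = 0 := by
  refine ⟨fun h => h v hv rfl, fun h w hw hwv => ?_⟩
  obtain ⟨c, rfl⟩ := (Projectivization.mk_eq_mk_iff' _ _ _ _ _).1 hwv
  have hc : eval (c • v) f = c ^ n * eval v f := aeval_const_mul hf c v
  rw [hc, h, mul_zero]

variable (P : Ideal (MvPolynomial ι ℂ))

/-- The map to the field of fractions of the homogeneous coordinate ring, as a homomorphism. -/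
def toConeFieldHom : MvPolynomial ι ℂ →ₐ[ℂ] ConeField P :=
  (IsScalarTower.toAlgHom ℂ (MvPolynomial ι ℂ ⧸ P) (ConeField P)).comp (Ideal.Quotient.mkₐ ℂ P)

theorem toConeFieldHom_apply (f : MvPolynomial ι ℂ) : toConeFieldHom P f = toConeField P f := rfl

variable [P.IsPrime]

theorem toConeField_eq_zero_iff {f : MvPolynomial ι ℂ} : toConeField P f = 0 ↔ f ∈ P := by
  rw [toConeField, FaithfulSMul.algebraMap_eq_zero_iff, Ideal.Quotient.eq_zero_iff_mem]

theorem incl_injective : Function.Injective (FunctionField.incl P) :=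
  (FunctionField.incl P).toRingHom.injective

theorem exists_isFraction {n : ℕ} {f g : MvPolynomial ι ℂ} (hf : f.IsHomogeneous n)
    (hg : g.IsHomogeneous n) (hgP : g ∉ P) : ∃ x : FunctionField P, IsFraction P x f g := by
  have h : toConeField P f / toConeField P g ∈ functionSubfield P :=
    IntermediateField.subset_adjoin _ _ ⟨n, f, g, hf, hg, hgP, rfl⟩
  exact ⟨(⟨_, h⟩ : functionSubfield P), ⟨n, hf, hg⟩, rfl⟩

/-- The homomorphism `φ` from the homogeneous coordinate ring of projective space is the
dehomogenization with respect to the linear form `l`, onto the affine coordinate ring of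
the complement of the hyperplane `l = 0` in the projective variety of `P`. -/
structure IsChart (l : MvPolynomial ι ℂ) {R : Type} [CommRing R] [Algebra ℂ R]
    (φ : MvPolynomial ι ℂ →ₐ[ℂ] R) : Prop where
  isHomogeneous : l.IsHomogeneous 1
  surjective : Function.Surjective φ
  map_eq_one : φ l = 1
  map_eq_zero_iff {n : ℕ} {f : MvPolynomial ι ℂ} (hf : f.IsHomogeneous n) : φ f = 0 ↔ f ∈ P

variable {P}
variable {l : MvPolynomial ι ℂ} {R : Type} [CommRing R] [Algebra ℂ R]
  {φ : MvPolynomial ι ℂ →ₐ[ℂ] R}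

theorem IsChart.notMem (h : IsChart P l φ) : l ∉ P := by
  intro hl
  have h₁ : φ 1 = 0 := by rw [map_one, ← h.map_eq_one, h.map_eq_zero_iff h.isHomogeneous]; exact hl
  exact (inferInstance : P.IsPrime).one_notMem ((h.map_eq_zero_iff (isHomogeneous_one _ _)).1 h₁)

/-- The dehomogenization with respect to the linear form `l`, with values in the function field. -/
def dehom (hl : l.IsHomogeneous 1) (hlP : l ∉ P) : MvPolynomial ι ℂ →ₐ[ℂ] FunctionField P :=
  aeval fun i => (exists_isFraction P (isHomogeneous_X ℂ i) hl hlP).choose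

theorem incl_dehom (hl : l.IsHomogeneous 1) (hlP : l ∉ P) {n : ℕ} {f : MvPolynomial ι ℂ}
    (hf : f.IsHomogeneous n) :
    FunctionField.incl P (dehom hl hlP f) = toConeField P f / toConeField P l ^ n := by
  have hX (i) := (exists_isFraction P (isHomogeneous_X ℂ i) hl hlP).choose_spec.2
  have h : (FunctionField.incl P).comp (dehom hl hlP) =
      aeval (fun i => (toConeField P l)⁻¹ * toConeField P (X i)) := by
    ext i
    simp [dehom, hX, div_eq_inv_mul]
  have hcone : aeval (fun i => toConeField P (X i)) = toConeFieldHom P := by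
    ext i
    simp [toConeFieldHom_apply]
  rw [← AlgHom.comp_apply, h, aeval_const_mul hf, hcone, toConeFieldHom_apply, inv_pow,
    div_eq_inv_mul]

theorem dehom_eq_zero_iff (hl : l.IsHomogeneous 1) (hlP : l ∉ P) {n : ℕ} {f : MvPolynomial ι ℂ}
    (hf : f.IsHomogeneous n) : dehom hl hlP f = 0 ↔ f ∈ P := by
  rw [← map_eq_zero_iff _ (incl_injective P), incl_dehom hl hlP hf, div_eq_zero_iff,
    toConeField_eq_zero_iff]
  simp [toConeField_eq_zero_iff, hlP]

theorem dehom_self (hl : l.IsHomogeneous 1) (hlP : l ∉ P) : dehom hl hlP l = 1 := by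
  apply incl_injective P
  rw [incl_dehom hl hlP hl, map_one, pow_one, div_self (mt (toConeField_eq_zero_iff P).1 hlP)]

theorem IsChart.map_eq_zero_iff_dehom_eq_zero (h : IsChart P l φ) (f : MvPolynomial ι ℂ) :
    φ f = 0 ↔ dehom h.isHomogeneous h.notMem f = 0 := by
  have hf := isHomogeneous_homogenize h.isHomogeneous (le_refl f.totalDegree)
  rw [← map_homogenize h.map_eq_one f f.totalDegree, ← map_homogenize (dehom_self _ _) f
    f.totalDegree, h.map_eq_zero_iff hf, dehom_eq_zero_iff _ _ hf]

theorem IsChart.exists_embedding (h : IsChart P l φ) :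
    ∃ ψ : R →ₐ[ℂ] FunctionField P, Function.Injective ψ ∧
      ∀ f, ψ (φ f) = dehom h.isHomogeneous h.notMem f := by
  have hker : RingHom.ker φ ≤ RingHom.ker (dehom h.isHomogeneous h.notMem) :=
    fun f => (h.map_eq_zero_iff_dehom_eq_zero f).1
  have hψ := AlgHom.liftOfSurjective_apply φ h.surjective _ hker
  refine ⟨AlgHom.liftOfSurjective φ h.surjective _ hker, ?_, hψ⟩
  rw [injective_iff_map_eq_zero]
  intro a ha
  obtain ⟨f, rfl⟩ := h.surjective a
  rw [hψ] at ha
  exact (h.map_eq_zero_iff_dehom_eq_zero f).2 ha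

variable {v : ι → ℂ} {ev : R →ₐ[ℂ] ℂ}

theorem IsChart.exists_mul_eq_of_mem_localRing (h : IsChart P l φ)
    (hev : ∀ f, ev (φ f) = eval v f) (hv : v ≠ 0) {ψ : R →ₐ[ℂ] FunctionField P}
    (hψ : ∀ f, ψ (φ f) = dehom h.isHomogeneous h.notMem f) {x : FunctionField P}
    (hx : x ∈ localRing P (Projectivization.mk ℂ v hv)) : ∃ a s : R, ev s ≠ 0 ∧ x * ψ s = ψ a := by
  induction hx using Algebra.adjoin_induction with
  | mem x hx =>
    obtain ⟨f, g, hg, ⟨n, hf, hg'⟩, hx⟩ := hx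
    rw [mem_vanishingIdeal_mk hv hg'] at hg
    refine ⟨φ f, φ g, by rwa [hev], incl_injective P ?_⟩
    have hgP : toConeField P g ≠ 0 := by
      rw [Ne, toConeField_eq_zero_iff, ← h.map_eq_zero_iff hg']
      intro h₀
      rw [← hev, h₀, map_zero] at hg
      exact hg rfl
    rw [hψ, hψ, map_mul, incl_dehom _ _ hf, incl_dehom _ _ hg', hx]
    field_simp
  | algebraMap r => exact ⟨algebraMap ℂ R r, 1, by simp, by simp⟩
  | add x y _ _ hx hy =>
    obtain ⟨a, s, hs, hx⟩ := hx
    obtain ⟨b, t, ht, hy⟩ := hy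
    refine ⟨a * t + b * s, s * t, by rw [map_mul]; exact mul_ne_zero hs ht, ?_⟩
    rw [map_mul, map_add, map_mul, map_mul, ← hx, ← hy]
    ring
  | mul x y _ _ hx hy =>
    obtain ⟨a, s, hs, hx⟩ := hx
    obtain ⟨b, t, ht, hy⟩ := hy
    refine ⟨a * b, s * t, by rw [map_mul]; exact mul_ne_zero hs ht, ?_⟩
    rw [map_mul, map_mul, ← hx, ← hy]
    ring

theorem IsChart.mem_localRing_of_mul_eq (h : IsChart P l φ) (hev : ∀ f, ev (φ f) = eval v f)
    (hv : v ≠ 0) {ψ : R →ₐ[ℂ] FunctionField P} (hinj : Function.Injective ψ)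
    (hψ : ∀ f, ψ (φ f) = dehom h.isHomogeneous h.notMem f) {x : FunctionField P} {a s : R}
    (hs : ev s ≠ 0) (hx : x * ψ s = ψ a) : x ∈ localRing P (Projectivization.mk ℂ v hv) := by
  obtain ⟨f, rfl⟩ := h.surjective a
  obtain ⟨g, rfl⟩ := h.surjective s
  set n := max f.totalDegree g.totalDegree
  have hF := isHomogeneous_homogenize h.isHomogeneous (le_max_left f.totalDegree g.totalDegree)
  have hG := isHomogeneous_homogenize h.isHomogeneous (le_max_right f.totalDegree g.totalDegree)
  have hvl : aeval v l = (1 : ℂ) := (hev l).symm.trans (by rw [h.map_eq_one, map_one])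
  have hGv : eval v (homogenize l g n) ≠ 0 :=
    (map_homogenize (g := aeval v) hvl g n).trans_ne (by rwa [hev] at hs)
  have hGP : toConeField P (homogenize l g n) ≠ 0 := by
    rw [Ne, toConeField_eq_zero_iff, ← dehom_eq_zero_iff h.isHomogeneous h.notMem hG,
      map_homogenize (dehom_self _ _), ← hψ, _root_.map_eq_zero_iff _ hinj]
    intro h₀
    exact hs (by rw [h₀, map_zero])
  have hl : toConeField P l ≠ 0 := mt (toConeField_eq_zero_iff P).1 h.notMem
  refine Algebra.subset_adjoin ⟨homogenize l f n, homogenize l g n,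
    by rwa [mem_vanishingIdeal_mk hv hG], ⟨_, hF, hG⟩, ?_⟩
  have hx' := congr_arg (FunctionField.incl P) hx
  rw [hψ, hψ, ← map_homogenize (dehom_self h.isHomogeneous h.notMem) f n,
    ← map_homogenize (dehom_self h.isHomogeneous h.notMem) g n, map_mul, incl_dehom _ _ hF,
    incl_dehom _ _ hG] at hx'
  field_simp at hx' ⊢
  exact hx'

theorem IsChart.exists_isLocalization (h : IsChart P l φ) (hev : ∀ f, ev (φ f) = eval v f)
    (hv : v ≠ 0) : ∃ ρ : R →ₐ[ℂ] localRing P (Projectivization.mk ℂ v hv),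
      letI := ρ.toRingHom.toAlgebra
      haveI := RingHom.ker_isPrime ev
      IsLocalization.AtPrime (localRing P (Projectivization.mk ℂ v hv)) (RingHom.ker ev) := by
  obtain ⟨ψ, hinj, hψ⟩ := h.exists_embedding
  have hmem {x : FunctionField P} {a s : R} (hs : ev s ≠ 0) (hx : x * ψ s = ψ a) :=
    h.mem_localRing_of_mul_eq hev hv hinj hψ hs hx
  let ρ : R →ₐ[ℂ] localRing P (Projectivization.mk ℂ v hv) :=
    ψ.codRestrict _ fun a => hmem (a := a) (s := 1) (by simp) (by simp)
  refine ⟨ρ, ?_⟩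
  let := ρ.toRingHom.toAlgebra
  have := RingHom.ker_isPrime ev
  refine (isLocalization_iff _ _).2 ⟨?_, ?_, ?_⟩
  · rintro ⟨s, hs : ev s ≠ 0⟩
    have hψs : ψ s ≠ 0 := by
      rw [Ne, _root_.map_eq_zero_iff _ hinj]
      rintro rfl
      exact hs (map_zero ev)
    refine IsUnit.of_mul_eq_one (b := ⟨(ψ s)⁻¹, hmem (a := 1) hs ?_⟩) (Subtype.ext ?_)
    · rw [inv_mul_cancel₀ hψs, map_one]
    · exact mul_inv_cancel₀ hψs
  · rintro ⟨z, hz⟩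
    obtain ⟨a, s, hs, hx⟩ := h.exists_mul_eq_of_mem_localRing hev hv hψ hz
    exact ⟨⟨a, ⟨s, hs⟩⟩, Subtype.ext hx⟩
  · intro a b hab
    exact ⟨1, by rw [hinj (congr_arg Subtype.val hab : ψ a = ψ b)]⟩

omit [P.IsPrime] in
theorem IsChart.mk_mem_points (h : IsChart P l φ)
    (hP : ∀ f ∈ P, ∀ n, homogeneousComponent n f ∈ P) (hev : ∀ f, ev (φ f) = eval v f)
    (hv : v ≠ 0) : Projectivization.mk ℂ v hv ∈ points P := by
  intro f hf
  rw [← sum_homogeneousComponent f]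
  refine Ideal.sum_mem _ fun n _ => ?_
  have hn := homogeneousComponent_isHomogeneous n f
  rw [mem_vanishingIdeal_mk hv hn, ← hev, (h.map_eq_zero_iff hn).2 (hP f hf n), map_zero]

end Chart

/-! ### Dimension and the Jacobian criterion -/

section Jacobian

section Points

variable {σ K : Type*} [CommRing K]

/-- The affine linear polynomial `∑ cₜ (Xₜ - e Xₜ)` with the coefficient vector `c` that vanishes at
the point `e` of affine space. -/
def linearAt [Fintype σ] (e : MvPolynomial σ K →ₐ[K] K) : (σ → K) →ₗ[K] MvPolynomial σ K :=
  Fintype.linearCombination K fun t => X t - C (e (X t))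

theorem sub_C_mem_ker (e : MvPolynomial σ K →ₐ[K] K) (f : MvPolynomial σ K) :
    f - C (e f) ∈ RingHom.ker e := by
  simp [RingHom.mem_ker, algHom_C]

theorem exists_algEquiv_comp_eq (e₁ e₂ : MvPolynomial σ K →ₐ[K] K) :
    ∃ τ : MvPolynomial σ K ≃ₐ[K] MvPolynomial σ K, ∀ f, e₂ (τ f) = e₁ f := by
  let c (s : σ) : K := e₁ (X s) - e₂ (X s)
  let τ : MvPolynomial σ K ≃ₐ[K] MvPolynomial σ K :=
    AlgEquiv.ofAlgHom (aeval fun s => X s + C (c s)) (aeval fun s => X s - C (c s))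
      (by ext s; simp [algHom_C]) (by ext s; simp [algHom_C])
  have h : e₂.comp τ.toAlgHom = e₁ := by
    ext s
    simp [τ, c, algHom_C]
  exact ⟨τ, fun f => congr($h f)⟩

theorem ker_eq_span_X_sub_C (e : MvPolynomial σ K →ₐ[K] K) :
    RingHom.ker e = Ideal.span (Set.range fun t => X t - C (e (X t))) := by
  refine le_antisymm (fun f hf => ?_) (Ideal.span_le.2 ?_)
  · set I := Ideal.span (Set.range fun t => X t - C (e (X t)))
    have h : Ideal.Quotient.mkₐ K I = (Algebra.ofId K _).comp e := by
      ext t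
      rw [AlgHom.comp_apply, Ideal.Quotient.mkₐ_eq_mk, Algebra.ofId_apply,
        ← Ideal.Quotient.mk_algebraMap, Ideal.Quotient.eq]
      exact Ideal.subset_span ⟨t, rfl⟩
    rw [← Ideal.Quotient.eq_zero_iff_mem, ← Ideal.Quotient.mkₐ_eq_mk K, h, AlgHom.comp_apply,
      (RingHom.mem_ker).1 hf, map_zero]
  · rintro _ ⟨t, rfl⟩
    exact sub_C_mem_ker e (X t)

variable [Fintype σ]

theorem linearAt_single [DecidableEq σ] (e : MvPolynomial σ K →ₐ[K] K) (t : σ) :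
    linearAt e (Pi.single t 1) = X t - C (e (X t)) := by
  simp [linearAt]

theorem linearAt_mem_ker (e : MvPolynomial σ K →ₐ[K] K) (c : σ → K) :
    linearAt e c ∈ RingHom.ker e := by
  rw [linearAt, Fintype.linearCombination_apply]
  exact sum_mem fun t _ => Submodule.smul_of_tower_mem _ _ (sub_C_mem_ker e (X t))

theorem ker_eq_span_range_linearAt (e : MvPolynomial σ K →ₐ[K] K) :
    RingHom.ker e = Ideal.span (Set.range (linearAt e)) := by
  classical
  refine le_antisymm ?_ (Ideal.span_le.2 ?_)
  · rw [ker_eq_span_X_sub_C]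
    refine Ideal.span_mono ?_
    rintro _ ⟨t, rfl⟩
    exact ⟨Pi.single t 1, linearAt_single e t⟩
  · rintro _ ⟨c, rfl⟩
    exact linearAt_mem_ker e c

theorem sub_linearAt_mem_ker_sq (e : MvPolynomial σ K →ₐ[K] K) (f : MvPolynomial σ K) :
    f - C (e f) - linearAt e (fun t => e (pderiv t f)) ∈ RingHom.ker e ^ 2 := by
  classical
  induction f using MvPolynomial.induction_on with
  | C a =>
    have h : (fun t => e (pderiv t (C a : MvPolynomial σ K))) = 0 := by
      funext t
      rw [pderiv_C, map_zero, Pi.zero_apply]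
    rw [h, map_zero, algHom_C]
    simp
  | add p q hp hq =>
    have h : (fun t => e (pderiv t (p + q))) =
        (fun t => e (pderiv t p)) + fun t => e (pderiv t q) := by
      funext t
      simp
    convert add_mem hp hq using 1
    rw [h]
    simp only [map_add]
    ring
  | mul_X p s hp =>
    -- `pX - p(e)X(e) = X (p - p(e)) + p(e) (X - X(e))`
    have h : (fun t => e (pderiv t (p * X s))) =
        e (X s) • (fun t => e (pderiv t p)) + e p • Pi.single s 1 := by
      funext t
      rw [Derivation.leibniz, pderiv_X]
      by_cases hts : t = s
      · subst hts
        simp [add_comm]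
      · simp [hts]
    have h₂ := Ideal.mul_mem_mul (sub_C_mem_ker e (X s))
      (linearAt_mem_ker e fun t => e (pderiv t p))
    rw [← pow_two] at h₂
    convert add_mem (Ideal.mul_mem_left _ (X s) hp) h₂ using 1
    rw [h, map_add, map_smul, map_smul, linearAt_single, smul_eq_C_mul, smul_eq_C_mul, map_mul,
      map_mul]
    ring

end Points

instance isPrime_ker {S : Type*} [CommRing S] [Algebra ℂ S] (ev : S →ₐ[ℂ] ℂ) :
    (RingHom.ker ev).IsPrime := RingHom.ker_isPrime ev

variable {σ : Type} [Finite σ]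

theorem height_ker (e : MvPolynomial σ ℂ →ₐ[ℂ] ℂ) : (RingHom.ker e).height = Nat.card σ := by
  have hdim : ringKrullDim (MvPolynomial σ ℂ) = Nat.card σ := by
    rw [MvPolynomial.ringKrullDim_of_isNoetherianRing, ringKrullDim_eq_zero_of_field, zero_add]
  have : FiniteRingKrullDim (MvPolynomial σ ℂ) := by
    rw [finiteRingKrullDim_iff_ne_bot_and_top, hdim]
    exact ⟨WithBot.coe_ne_bot, fun h => ENat.natCast_ne_top (Nat.card σ) (WithBot.coe_injective h)⟩
  obtain ⟨p, hp, hh⟩ := Ideal.exists_isMaximal_height (R := MvPolynomial σ ℂ)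
  obtain ⟨v, rfl⟩ := isMaximal_iff_eq_vanishingIdeal_singleton.1 hp
  obtain ⟨τ, hτ⟩ := exists_algEquiv_comp_eq e (aeval v)
  have h : RingHom.ker e = Ideal.comap τ.toRingEquiv (MvPolynomial.vanishingIdeal ℂ {v}) := by
    ext f
    rw [Ideal.mem_comap, MvPolynomial.mem_vanishingIdeal_singleton_iff, RingHom.mem_ker, ← hτ]
    rfl
  rw [hdim] at hh
  rw [h, RingEquiv.height_comap]
  exact_mod_cast hh

variable {S : Type} [CommRing S] [Algebra ℂ S] {ψ : MvPolynomial σ ℂ →ₐ[ℂ] S}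

theorem card_le_height_ker_add (hψ : Function.Surjective ψ) {s : Set (MvPolynomial σ ℂ)}
    (hs : RingHom.ker ψ = Ideal.span s) (ev : S →ₐ[ℂ] ℂ) :
    (Nat.card σ : ℕ∞) ≤ (RingHom.ker ev).height + s.encard := by
  have hle : Ideal.span s ≤ RingHom.ker (ev.comp ψ) := by
    rw [← hs]
    exact fun f hf => by rw [RingHom.mem_ker, AlgHom.comp_apply, (RingHom.mem_ker).1 hf, map_zero]
  rw [← height_ker (ev.comp ψ)]
  refine (Ideal.height_le_height_add_encard_of_subset s (Ideal.span_le.1 hle)).trans_eq ?_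
  congr 1
  let e : (MvPolynomial σ ℂ ⧸ Ideal.span s) ≃+* S :=
    (Ideal.quotEquivOfEq hs.symm).trans (RingHom.quotientKerEquivOfSurjective hψ)
  rw [← RingEquiv.height_comap e (RingHom.ker ev)]
  congr 1
  apply Ideal.comap_injective_of_surjective _ Ideal.Quotient.mk_surjective
  rw [Ideal.comap_map_mk hle]
  ext f
  rfl

theorem spanFinrank_maximalIdeal_le_finrank_quotient {K E R : Type*} [Field K] [AddCommGroup E]
    [Module K E] [FiniteDimensional K E] [CommRing R] [Algebra K R] [IsLocalRing R]
    [IsNoetherianRing R] (T : E →ₗ[K] R)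
    (hT : IsLocalRing.maximalIdeal R = Ideal.span (Set.range T)) {W : Submodule K E}
    (hW : ∀ c ∈ W, T c ∈ IsLocalRing.maximalIdeal R ^ 2) :
    (IsLocalRing.maximalIdeal R).spanFinrank ≤ Module.finrank K (E ⧸ W) := by
  let b := Module.finBasis K (E ⧸ W)
  choose u hu using fun i => W.mkQ_surjective (b i)
  let t (i) : R := T (u i)
  have hT' (c : E) : T c ∈ Ideal.span (Set.range t) ⊔ IsLocalRing.maximalIdeal R ^ 2 := by
    have hc : c - ∑ i, b.repr (W.mkQ c) i • u i ∈ W := by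
      rw [← Submodule.Quotient.mk_eq_zero, ← Submodule.mkQ_apply, map_sub, map_sum]
      simp only [map_smul, hu]
      rw [b.sum_repr, sub_self]
    rw [← add_sub_cancel (∑ i, b.repr (W.mkQ c) i • u i) c, map_add, map_sum]
    refine Submodule.add_mem_sup (sum_mem fun i _ => ?_) (hW _ hc)
    rw [map_smul]
    exact Submodule.smul_of_tower_mem _ _ (Ideal.subset_span ⟨i, rfl⟩)
  have hspan : IsLocalRing.maximalIdeal R = Ideal.span (Set.range t) := by
    apply le_antisymm
    · refine Submodule.le_of_le_smul_of_le_jacobson_bot (IsNoetherian.noetherian _)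
        (IsLocalRing.maximalIdeal_le_jacobson _) ?_
      rw [smul_eq_mul, ← pow_two]
      conv_lhs => rw [hT]
      rw [Ideal.span_le]
      rintro _ ⟨c, rfl⟩
      exact hT' c
    · rw [hT]
      refine Ideal.span_mono ?_
      rintro _ ⟨i, rfl⟩
      exact ⟨u i, rfl⟩
  rw [hspan]
  refine (Submodule.spanFinrank_span_le_ncard_of_finite (Set.finite_range t)).trans ?_
  rw [← Nat.card_coe_set_eq]
  exact (Finite.card_range_le t).trans (by simp)

variable {R : Type} [CommRing R] [Algebra S R]

theorem spanFinrank_maximalIdeal_add_le_card [IsLocalRing R] [IsNoetherianRing R]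
    (hψ : Function.Surjective ψ) {k : ℕ} {s : Fin k → MvPolynomial σ ℂ}
    (hs : ∀ i, ψ (s i) = 0) (ev : S →ₐ[ℂ] ℂ) [IsLocalization.AtPrime R (RingHom.ker ev)]
    (hind : LinearIndependent ℂ fun i t => ev (ψ (pderiv t (s i)))) :
    (IsLocalRing.maximalIdeal R).spanFinrank + k ≤ Nat.card σ := by
  have := Fintype.ofFinite σ
  let W : Submodule ℂ (σ → ℂ) := Submodule.span ℂ (Set.range fun i t => ev (ψ (pderiv t (s i))))
  let := Algebra.compHom R (algebraMap ℂ S)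
  have : IsScalarTower ℂ S R := IsScalarTower.of_algebraMap_eq fun _ => rfl
  let Φ : MvPolynomial σ ℂ →ₐ[ℂ] R := (IsScalarTower.toAlgHom ℂ S R).comp ψ
  let e : MvPolynomial σ ℂ →ₐ[ℂ] ℂ := ev.comp ψ
  have hmax : IsLocalRing.maximalIdeal R = (RingHom.ker e).map Φ := by
    have he : RingHom.ker e = (RingHom.ker ev).comap ψ := rfl
    rw [← IsLocalization.AtPrime.map_eq_maximalIdeal (RingHom.ker ev) R, he,
      ← Ideal.map_mapₐ, Ideal.map_comap_of_surjective ψ hψ]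
    rfl
  have hT : IsLocalRing.maximalIdeal R =
      Ideal.span (Set.range (Φ.toLinearMap ∘ₗ linearAt e)) := by
    rw [hmax, ker_eq_span_range_linearAt, Ideal.map_span, ← Set.range_comp]
    rfl
  have hW : W ≤ ((IsLocalRing.maximalIdeal R ^ 2).restrictScalars ℂ).comap
      (Φ.toLinearMap ∘ₗ linearAt e) := by
    refine Submodule.span_le.2 ?_
    rintro _ ⟨i, rfl⟩
    have h := Ideal.mem_map_of_mem Φ (sub_linearAt_mem_ker_sq e (s i))
    have hes : e (s i) = 0 := by rw [AlgHom.comp_apply, hs, map_zero]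
    have hΦs : Φ (s i) = 0 := by rw [AlgHom.comp_apply, hs, map_zero]
    rwa [Ideal.map_pow, ← hmax, hes, map_zero, sub_zero, map_sub, hΦs, zero_sub, neg_mem_iff] at h
  have hle := spanFinrank_maximalIdeal_le_finrank_quotient _ hT fun c hc => hW hc
  have hk : Module.finrank ℂ W = k := by rw [finrank_span_eq_card hind, Fintype.card_fin]
  have hdim := W.finrank_quotient_add_finrank
  rw [hk, Module.finrank_fintype_fun_eq_card, ← Nat.card_eq_fintype_card] at hdim
  lia

theorem isRegularLocalRing_of_linearIndependent (hψ : Function.Surjective ψ) {k : ℕ}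
    {s : Fin k → MvPolynomial σ ℂ} (hs : RingHom.ker ψ = Ideal.span (Set.range s))
    (ev : S →ₐ[ℂ] ℂ) [IsLocalization.AtPrime R (RingHom.ker ev)]
    (hind : LinearIndependent ℂ fun i t => ev (ψ (pderiv t (s i)))) : IsRegularLocalRing R := by
  have : IsLocalRing R := IsLocalization.AtPrime.isLocalRing R (RingHom.ker ev)
  have : IsNoetherianRing R := IsLocalization.isNoetherianRing (RingHom.ker ev).primeCompl R
    (isNoetherianRing_of_surjective _ _ ψ.toRingHom hψ)
  apply IsRegularLocalRing.of_spanFinrank_maximalIdeal_le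
  have hzero (i) : ψ (s i) = 0 := by
    rw [← RingHom.mem_ker, hs]
    exact Ideal.subset_span ⟨i, rfl⟩
  have hk : (Set.range s).encard ≤ k := by
    rw [← Set.image_univ]
    exact (Set.encard_image_le _ _).trans (by simp)
  have hle : ((IsLocalRing.maximalIdeal R).spanFinrank : ℕ∞) + k ≤
      (RingHom.ker ev).height + k :=
    calc ((IsLocalRing.maximalIdeal R).spanFinrank : ℕ∞) + k ≤ Nat.card σ := by
          exact_mod_cast spanFinrank_maximalIdeal_add_le_card hψ hzero ev hind
      _ ≤ (RingHom.ker ev).height + (Set.range s).encard := card_le_height_ker_add hψ hs ev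
      _ ≤ (RingHom.ker ev).height + k := by gcongr
  rw [IsLocalization.AtPrime.ringKrullDim_eq_height (RingHom.ker ev) R]
  exact_mod_cast (ENat.add_le_add_iff_right (ENat.natCast_ne_top k)).1 hle

end Jacobian

/-! ### Multiplicities of hypersurfaces -/

section Multiplicity

section Truncation

variable {σ K : Type*} [Field K]

/-- The truncation of a polynomial in degree `k`, as the family of its coefficients of degree less
than `k`. -/
def truncation (σ K : Type*) [Field K] (k : ℕ) :
    MvPolynomial σ K →ₗ[K] ({d : σ →₀ ℕ // d.degree < k} → K) :=
  LinearMap.pi fun d => lcoeff K d.1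

theorem finite_degree_lt (σ : Type*) [Finite σ] (k : ℕ) : {d : σ →₀ ℕ | d.degree < k}.Finite :=
  (Finsupp.finite_of_degree_le k).subset fun d (hd : d.degree < k) => hd.le

instance [Finite σ] (k : ℕ) : Finite {d : σ →₀ ℕ // d.degree < k} :=
  (finite_degree_lt σ k).to_subtype

theorem truncation_surjective [Finite σ] (k : ℕ) : Function.Surjective (truncation σ K k) := by
  classical
  have := Fintype.ofFinite {d : σ →₀ ℕ // d.degree < k}
  intro c
  refine ⟨∑ d, monomial d.1 (c d), ?_⟩
  ext e
  simp only [truncation, LinearMap.pi_apply, lcoeff_apply, coeff_sum, coeff_monomial]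
  rw [Finset.sum_eq_single e (fun d _ hd => if_neg fun h => hd (Subtype.ext h)) (by simp)]
  simp

theorem ker_truncation (k : ℕ) :
    LinearMap.ker (truncation σ K k) = (idealOfVars σ K ^ k).restrictScalars K := by
  ext f
  rw [Submodule.restrictScalars_mem, mem_pow_idealOfVars_iff', LinearMap.mem_ker]
  exact ⟨fun h d hd => congr_fun h ⟨d, hd⟩, fun h => funext fun d => h d.1 d.2⟩

/-- The polynomials modulo a power of the ideal of the variables, as families of coefficients. -/
def quotientIdealOfVarsPowEquiv [Finite σ] (k : ℕ) :
    (MvPolynomial σ K ⧸ idealOfVars σ K ^ k) ≃ₗ[K] ({d : σ →₀ ℕ // d.degree < k} → K) :=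
  (Submodule.Quotient.restrictScalarsEquiv K (idealOfVars σ K ^ k)).symm.trans
    ((Submodule.quotEquivOfEq _ _ (ker_truncation k).symm).trans
      ((truncation σ K k).quotKerEquivOfSurjective (truncation_surjective k)))

instance [Finite σ] (k : ℕ) : FiniteDimensional K (MvPolynomial σ K ⧸ idealOfVars σ K ^ k) :=
  Module.Finite.equiv (quotientIdealOfVarsPowEquiv k).symm

theorem finrank_quotient_idealOfVars_pow [Finite σ] (k : ℕ) :
    Module.finrank K (MvPolynomial σ K ⧸ idealOfVars σ K ^ k) =
      Nat.card {d : σ →₀ ℕ // d.degree < k} := by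
  have := Fintype.ofFinite {d : σ →₀ ℕ // d.degree < k}
  rw [(quotientIdealOfVarsPowEquiv k).finrank_eq, Module.finrank_fintype_fun_eq_card,
    Nat.card_eq_fintype_card]

theorem mem_pow_idealOfVars_iff_le_order (k : ℕ) (f : MvPolynomial σ K) :
    f ∈ idealOfVars σ K ^ k ↔ (k : ℕ∞) ≤ (f : MvPowerSeries σ K).order := by
  rw [mem_pow_idealOfVars_iff']
  refine ⟨fun h => MvPowerSeries.nat_le_order fun d hd => ?_, fun h d hd => ?_⟩
  · rw [coeff_coe]
    exact h d hd
  · rw [← coeff_coe]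
    exact MvPowerSeries.coeff_of_lt_order (lt_of_lt_of_le (by exact_mod_cast hd) h)

-- The subtraction is truncated: for `k ≤ m` both sides hold.
theorem mul_mem_pow_idealOfVars_iff {G : MvPolynomial σ K} {m : ℕ}
    (hG : (G : MvPowerSeries σ K).order = m) (k : ℕ) (f : MvPolynomial σ K) :
    G * f ∈ idealOfVars σ K ^ k ↔ f ∈ idealOfVars σ K ^ (k - m) := by
  rw [mem_pow_idealOfVars_iff_le_order, mem_pow_idealOfVars_iff_le_order, coe_mul,
    MvPowerSeries.order_mul, hG, ENat.natCast_sub, tsub_le_iff_left]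

end Truncation

theorem card_degree_lt (k : ℕ) :
    Nat.card {d : Fin 3 →₀ ℕ // d.degree < k} = (k + 2).choose 3 := by
  induction k with
  | zero => simp
  | succ k ih =>
    have h : {d : Fin 3 →₀ ℕ | d.degree < k + 1} = {d | d.degree < k} ∪ {d | ∑ i, d i = k} := by
      ext d
      simp [← Finsupp.degree_eq_sum, le_iff_lt_or_eq]
    have hfin : {d : Fin 3 →₀ ℕ | ∑ i, d i = k}.Finite :=
      (Finsupp.finite_of_degree_le k).subset fun d hd => ((Finsupp.degree_eq_sum d).trans hd).le
    rw [← Set.coe_ofPred, Nat.card_coe_set_eq, h, Set.ncard_union_eq ?_ (finite_degree_lt _ k) hfin,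
      ← Nat.card_coe_set_eq, ← Nat.card_coe_set_eq, Set.coe_ofPred, Set.coe_ofPred, ih,
      card_finsupp_sum_eq, Nat.choose_succ_succ (k + 2) 2, add_comm]
    refine Set.disjoint_left.2 fun d (hd : d.degree < k) (hd' : ∑ i, d i = k) => hd.ne ?_
    rw [Finsupp.degree_eq_sum, hd']

section Hypersurface

variable {σ : Type} {G : MvPolynomial σ ℂ} {m : ℕ} {S : Type} [CommRing S] [Algebra ℂ S]
  {ψ : MvPolynomial σ ℂ →ₐ[ℂ] S} {ev : S →ₐ[ℂ] ℂ}

theorem ker_eq_map_idealOfVars (hψ : Function.Surjective ψ) (hev : ∀ i, ev (ψ (X i)) = 0) :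
    RingHom.ker ev = (idealOfVars σ ℂ).map ψ := by
  have hker : idealOfVars σ ℂ = (RingHom.ker ev).comap ψ := by
    change _ = RingHom.ker (ev.comp ψ)
    simp [ker_eq_span_X_sub_C, hev, idealOfVars]
  rw [hker, Ideal.map_comap_of_surjective ψ hψ]

theorem map_mem_ker_pow_iff (hψ : Function.Surjective ψ) (hker : RingHom.ker ψ = Ideal.span {G})
    (hev : ∀ i, ev (ψ (X i)) = 0) (k : ℕ) (f : MvPolynomial σ ℂ) :
    ψ f ∈ RingHom.ker ev ^ k ↔ ∃ g, f - G * g ∈ idealOfVars σ ℂ ^ k := by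
  rw [ker_eq_map_idealOfVars hψ hev, ← Ideal.map_pow, ← Ideal.mem_comap,
    Ideal.comap_map_of_surjective' _ hψ, hker]
  constructor
  · intro h
    obtain ⟨a, ha, b, hb, rfl⟩ := Submodule.mem_sup.1 h
    obtain ⟨g, rfl⟩ := Ideal.mem_span_singleton'.1 hb
    exact ⟨g, by rwa [mul_comm, add_sub_cancel_right]⟩
  · rintro ⟨g, hg⟩
    rw [← sub_add_cancel f (G * g)]
    exact Submodule.add_mem_sup hg (Ideal.mul_mem_right _ _ (Ideal.mem_span_singleton_self G))

/-- The projection of the truncated polynomials to the truncations of the coordinate ring `S` at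
the point `ev`. -/
def truncationMap (hψ : Function.Surjective ψ) (hev : ∀ i, ev (ψ (X i)) = 0) (k : ℕ) :
    (MvPolynomial σ ℂ ⧸ idealOfVars σ ℂ ^ k) →ₐ[ℂ] (S ⧸ RingHom.ker ev ^ k) :=
  Ideal.quotientMapₐ _ ψ (by
    rw [← Ideal.map_le_iff_le_comap, Ideal.map_pow, ker_eq_map_idealOfVars hψ hev])

theorem truncationMap_mk (hψ : Function.Surjective ψ) (hev : ∀ i, ev (ψ (X i)) = 0) (k : ℕ)
    (f : MvPolynomial σ ℂ) : truncationMap hψ hev k (Ideal.Quotient.mk _ f) =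
      Ideal.Quotient.mk _ (ψ f) := rfl

theorem truncationMap_surjective (hψ : Function.Surjective ψ) (hev : ∀ i, ev (ψ (X i)) = 0)
    (k : ℕ) : Function.Surjective (truncationMap hψ hev k) := by
  intro y
  obtain ⟨b, rfl⟩ := Ideal.Quotient.mk_surjective y
  obtain ⟨f, rfl⟩ := hψ b
  exact ⟨Ideal.Quotient.mk _ f, rfl⟩

/-- Multiplication with a polynomial `G` of order `m`, on truncated polynomials. -/
def truncatedMul (hG : (G : MvPowerSeries σ ℂ).order = m) (k : ℕ) :
    (MvPolynomial σ ℂ ⧸ idealOfVars σ ℂ ^ (k - m)) →ₗ[ℂ]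
      (MvPolynomial σ ℂ ⧸ idealOfVars σ ℂ ^ k) :=
  (Submodule.mapQ (idealOfVars σ ℂ ^ (k - m)) (idealOfVars σ ℂ ^ k)
    (LinearMap.mulLeft (MvPolynomial σ ℂ) G)
    (fun f => (mul_mem_pow_idealOfVars_iff hG k f).2)).restrictScalars ℂ

theorem truncatedMul_mk (hG : (G : MvPowerSeries σ ℂ).order = m) (k : ℕ) (f : MvPolynomial σ ℂ) :
    truncatedMul hG k (Ideal.Quotient.mk _ f) = Ideal.Quotient.mk _ (G * f) := rfl

theorem truncatedMul_injective (hG : (G : MvPowerSeries σ ℂ).order = m) (k : ℕ) :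
    Function.Injective (truncatedMul hG k) := by
  rw [injective_iff_map_eq_zero]
  intro x hx
  obtain ⟨f, rfl⟩ := Ideal.Quotient.mk_surjective x
  rw [truncatedMul_mk, Ideal.Quotient.eq_zero_iff_mem, mul_mem_pow_idealOfVars_iff hG] at hx
  rwa [Ideal.Quotient.eq_zero_iff_mem]

theorem range_truncatedMul (hG : (G : MvPowerSeries σ ℂ).order = m) (hψ : Function.Surjective ψ)
    (hker : RingHom.ker ψ = Ideal.span {G}) (hev : ∀ i, ev (ψ (X i)) = 0) (k : ℕ) :
    LinearMap.range (truncatedMul hG k) = LinearMap.ker (truncationMap hψ hev k).toLinearMap := by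
  ext x
  obtain ⟨f, rfl⟩ := Ideal.Quotient.mk_surjective x
  rw [LinearMap.mem_ker, AlgHom.toLinearMap_apply, truncationMap_mk, Ideal.Quotient.eq_zero_iff_mem,
    map_mem_ker_pow_iff hψ hker hev, LinearMap.mem_range]
  constructor
  · rintro ⟨y, hy⟩
    obtain ⟨g, rfl⟩ := Ideal.Quotient.mk_surjective y
    rw [truncatedMul_mk, eq_comm, Ideal.Quotient.eq] at hy
    exact ⟨g, hy⟩
  · rintro ⟨g, hg⟩
    exact ⟨Ideal.Quotient.mk _ g, by rwa [truncatedMul_mk, eq_comm, Ideal.Quotient.eq]⟩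

variable [Finite σ]

theorem finite_quotient_ker_pow (hψ : Function.Surjective ψ) (hev : ∀ i, ev (ψ (X i)) = 0)
    (k : ℕ) : FiniteDimensional ℂ (S ⧸ RingHom.ker ev ^ k) :=
  Module.Finite.of_surjective (truncationMap hψ hev k).toLinearMap
    (truncationMap_surjective hψ hev k)

theorem finrank_quotient_ker_pow_add (hG : (G : MvPowerSeries σ ℂ).order = m)
    (hψ : Function.Surjective ψ) (hker : RingHom.ker ψ = Ideal.span {G})
    (hev : ∀ i, ev (ψ (X i)) = 0) (k : ℕ) :
    Module.finrank ℂ (S ⧸ RingHom.ker ev ^ k) + Nat.card {d : σ →₀ ℕ // d.degree < k - m} =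
      Nat.card {d : σ →₀ ℕ // d.degree < k} := by
  have h := LinearMap.finrank_range_add_finrank_ker (truncationMap hψ hev k).toLinearMap
  rwa [LinearMap.range_eq_top.2 (truncationMap_surjective hψ hev k), finrank_top,
    ← range_truncatedMul hG hψ hker hev,
    LinearMap.finrank_range_of_inj (truncatedMul_injective hG k),
    finrank_quotient_idealOfVars_pow, finrank_quotient_idealOfVars_pow] at h

theorem height_ker_add_one (ev : S →ₐ[ℂ] ℂ) (hG : G ≠ 0) (hψ : Function.Surjective ψ)
    (hker : RingHom.ker ψ = Ideal.span {G}) : (RingHom.ker ev).height + 1 = Nat.card σ := by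
  have hGψ : ψ G = 0 := by
    rw [← RingHom.mem_ker, hker]
    exact Ideal.mem_span_singleton_self G
  refine le_antisymm ?_ (by simpa using card_le_height_ker_add hψ hker ev)
  have hdim := ringKrullDim_succ_le_of_surjective ψ.toRingHom hψ
    (mem_nonZeroDivisors_of_ne_zero hG) hGψ
  rw [MvPolynomial.ringKrullDim_of_isNoetherianRing, ringKrullDim_eq_zero_of_field,
    zero_add] at hdim
  have hle := (add_le_add_left
    (Ideal.height_le_ringKrullDim_of_ne_top (isPrime_ker ev).ne_top) 1).trans hdim
  exact_mod_cast hle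

end Hypersurface

section LocalRing

variable {S : Type} [CommRing S] [Algebra ℂ S] (ev : S →ₐ[ℂ] ℂ)
variable {R : Type} [CommRing R] [Algebra S R] [Algebra ℂ R] [IsScalarTower ℂ S R]
  [IsLocalization.AtPrime R (RingHom.ker ev)] [IsLocalRing R]

include ev in
theorem exists_sub_algebraMap_mem_maximalIdeal (x : R) :
    ∃ c : ℂ, x - algebraMap ℂ R c ∈ IsLocalRing.maximalIdeal R := by
  obtain ⟨b, s, rfl⟩ := IsLocalization.exists_mk'_eq (RingHom.ker ev).primeCompl x
  have hs : ev s ≠ 0 := s.2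
  refine ⟨ev b / ev s, ?_⟩
  have h : IsLocalization.mk' R b s - algebraMap ℂ R (ev b / ev s) =
      IsLocalization.mk' R (b - algebraMap ℂ S (ev b / ev s) * s) s := by
    rw [IsScalarTower.algebraMap_apply ℂ S R, eq_comm, IsLocalization.mk'_eq_iff_eq_mul, sub_mul,
      IsLocalization.mk'_spec, map_sub, map_mul]
  rw [h, IsLocalization.AtPrime.mk'_mem_maximal_iff R (RingHom.ker ev)]
  simp [RingHom.mem_ker, hs]

include ev in
theorem length_eq_finrank (M : Type) [AddCommGroup M] [Module R M] [Module ℂ M]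
    [IsScalarTower ℂ R M] [FiniteDimensional ℂ M] : Module.length R M = Module.finrank ℂ M := by
  have hlocal : IsLocalHom (algebraMap ℂ R) := inferInstance
  have h := IsLocalRing.length_restrictScalars ℂ R M
  have hsurj : Function.Surjective
      (algebraMap (IsLocalRing.ResidueField ℂ) (IsLocalRing.ResidueField R)) := by
    intro y
    obtain ⟨x, rfl⟩ := IsLocalRing.residue_surjective y
    obtain ⟨c, hc⟩ := exists_sub_algebraMap_mem_maximalIdeal ev x
    refine ⟨IsLocalRing.residue ℂ c, ?_⟩
    rwa [← sub_eq_zero, IsLocalRing.ResidueField.algebraMap_residue, ← map_sub,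
      IsLocalRing.residue_eq_zero_iff, ← neg_sub, neg_mem_iff]
  rw [Module.length_eq_of_surjective (M := IsLocalRing.ResidueField R) hsurj,
    Module.length_eq_one (IsLocalRing.ResidueField R) (IsLocalRing.ResidueField R), mul_one] at h
  rw [← h, Module.length_eq_finrank]

include ev in
theorem finrank_quotient_maximalIdeal_sq_le {s : Set R} (hs : s.Finite)
    (hspan : IsLocalRing.maximalIdeal R = Ideal.span s) :
    Module.finrank ℂ (R ⧸ IsLocalRing.maximalIdeal R ^ 2) ≤ s.ncard + 1 := by
  let π := Ideal.Quotient.mkₐ ℂ (IsLocalRing.maximalIdeal R ^ 2)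
  have hπ {x : R} (hx : x ∈ IsLocalRing.maximalIdeal R) : π x ∈ Submodule.span ℂ (π '' s) := by
    rw [hspan] at hx
    induction hx using Submodule.span_induction with
    | mem x hx => exact Submodule.subset_span ⟨x, hx, rfl⟩
    | zero => rw [map_zero]; exact zero_mem _
    | add x y _ _ hx hy => rw [map_add]; exact add_mem hx hy
    | smul r x hxs hx =>
      obtain ⟨c, hc⟩ := exists_sub_algebraMap_mem_maximalIdeal ev r
      have h : π (r • x) = c • π x := by
        rw [← map_smul π c x, smul_eq_mul, Ideal.Quotient.mkₐ_eq_mk, Ideal.Quotient.eq,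
          Algebra.smul_def, ← sub_mul, pow_two]
        exact Ideal.mul_mem_mul hc (by rwa [hspan])
      rw [h]
      exact Submodule.smul_mem _ c hx
  have htop : Submodule.span ℂ (insert 1 (π '' s)) = ⊤ := by
    refine eq_top_iff.2 fun y _ => ?_
    obtain ⟨x, rfl⟩ := Ideal.Quotient.mkₐ_surjective ℂ _ y
    obtain ⟨c, hc⟩ := exists_sub_algebraMap_mem_maximalIdeal ev x
    have h := hπ hc
    rw [map_sub, AlgHom.commutes, Algebra.algebraMap_eq_smul_one] at h
    exact Submodule.mem_span_insert.2 ⟨c, _, h, (add_sub_cancel _ _).symm⟩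
  rw [← finrank_top, ← htop]
  have hfin := (hs.image π).insert 1
  have := hfin.fintype
  refine (finrank_span_le_card _).trans ?_
  rw [← Set.ncard_eq_toFinset_card']
  exact (Set.ncard_insert_le _ _).trans (by gcongr; exact Set.ncard_image_le hs)

/-- The truncations of a local ring are those of the affine coordinate ring. -/
def quotientPowLocalEquiv (k : ℕ) :
    (S ⧸ RingHom.ker ev ^ k) ≃ₐ[ℂ] R ⧸ IsLocalRing.maximalIdeal R ^ k :=
  have : (RingHom.ker ev).IsMaximal :=
    RingHom.ker_isMaximal_of_surjective ev fun c => ⟨algebraMap ℂ S c, by simp⟩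
  (IsLocalization.AtPrime.equivQuotMaximalIdealPow (RingHom.ker ev) R k).restrictScalars ℂ

end LocalRing

section SurfaceInSpace

theorem cast_add_two_choose_three (k : ℕ) :
    ((k + 2).choose 3 : ℚ) = (k + 2) * (k + 1) * k / 6 := by
  induction k with
  | zero => simp
  | succ k ih =>
    rw [show k + 1 + 2 = k + 2 + 1 by ring, Nat.choose_succ_succ, Nat.cast_add, ih,
      Nat.cast_choose_two]
    push_cast
    ring

variable {G : MvPolynomial (Fin 3) ℂ} {m : ℕ} {S : Type} [CommRing S] [Algebra ℂ S]
  {ψ : MvPolynomial (Fin 3) ℂ →ₐ[ℂ] S} {ev : S →ₐ[ℂ] ℂ}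
variable {R : Type} [CommRing R] [Algebra S R]

theorem ringKrullDim_eq_two (ev : S →ₐ[ℂ] ℂ) [IsLocalization.AtPrime R (RingHom.ker ev)]
    (hG : G ≠ 0) (hψ : Function.Surjective ψ) (hker : RingHom.ker ψ = Ideal.span {G}) :
    ringKrullDim R = 2 := by
  have h := height_ker_add_one ev hG hψ hker
  rw [Nat.card_eq_fintype_card, Fintype.card_fin] at h
  have h₂ : (RingHom.ker ev).height = 2 := le_antisymm
    ((ENat.add_le_add_iff_right (ENat.natCast_ne_top 1)).1 h.le)
    ((ENat.add_le_add_iff_right (ENat.natCast_ne_top 1)).1 h.ge)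
  rw [IsLocalization.AtPrime.ringKrullDim_eq_height (RingHom.ker ev) R, h₂]
  rfl

variable [IsLocalization.AtPrime R (RingHom.ker ev)] [Algebra ℂ R] [IsScalarTower ℂ S R]

theorem finrank_quotient_maximalIdeal_pow_add [IsLocalRing R]
    (hG : (G : MvPowerSeries (Fin 3) ℂ).order = m) (hψ : Function.Surjective ψ)
    (hker : RingHom.ker ψ = Ideal.span {G}) (hev : ∀ i, ev (ψ (X i)) = 0) (k : ℕ) :
    Module.finrank ℂ (R ⧸ IsLocalRing.maximalIdeal R ^ k) + (k - m + 2).choose 3 =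
      (k + 2).choose 3 := by
  rw [← (quotientPowLocalEquiv ev k).toLinearEquiv.finrank_eq, ← card_degree_lt, ← card_degree_lt,
    finrank_quotient_ker_pow_add hG hψ hker hev]

theorem ne_zero_of_order_eq (hG : (G : MvPowerSeries (Fin 3) ℂ).order = m) : G ≠ 0 := by
  rintro rfl
  rw [coe_zero, MvPowerSeries.order_zero] at hG
  exact ENat.natCast_ne_top m hG.symm

theorem hasMultiplicity_of_order_eq (hm : m ≠ 0) (hG : (G : MvPowerSeries (Fin 3) ℂ).order = m)
    (hψ : Function.Surjective ψ) (hker : RingHom.ker ψ = Ideal.span {G})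
    (hev : ∀ i, ev (ψ (X i)) = 0) : HasMultiplicity R 2 m := by
  have hlocal : IsLocalRing R := IsLocalization.AtPrime.isLocalRing R (RingHom.ker ev)
  have hm' : (m / 2 : ℚ) ≠ 0 := by positivity
  refine ⟨hlocal, ringKrullDim_eq_two ev (ne_zero_of_order_eq hG) hψ hker,
    .C (m / 2 : ℚ) * .X ^ 2 + .C (2 * m - m ^ 2 / 2 : ℚ) * .X +
      .C (2 * m - m ^ 2 + (m ^ 3 - m) / 6 : ℚ), ?_, Polynomial.natDegree_quadratic hm', ?_⟩
  · filter_upwards [Filter.eventually_ge_atTop m] with n hn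
    have := finite_quotient_ker_pow hψ hev (n + 1)
    have := Module.Finite.equiv (quotientPowLocalEquiv (R := R) ev (n + 1)).toLinearEquiv
    have h := congr_arg (Nat.cast (R := ℚ))
      (finrank_quotient_maximalIdeal_pow_add (R := R) hG hψ hker hev (n + 1))
    rw [length_eq_finrank ev, ENat.toNat_natCast]
    rw [Nat.cast_add, cast_add_two_choose_three, cast_add_two_choose_three,
      Nat.cast_sub (by lia)] at h
    simp only [Polynomial.eval_add, Polynomial.eval_mul, Polynomial.eval_C, Polynomial.eval_pow,
      Polynomial.eval_X]
    push_cast at h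
    linear_combination h
  · rw [Polynomial.leadingCoeff_quadratic hm']
    norm_num

theorem not_isRegularLocalRing_of_two_le_order (hm : 2 ≤ m)
    (hG : (G : MvPowerSeries (Fin 3) ℂ).order = m) (hψ : Function.Surjective ψ)
    (hker : RingHom.ker ψ = Ideal.span {G}) (hev : ∀ i, ev (ψ (X i)) = 0) :
    ¬ IsRegularLocalRing R := by
  intro hreg
  have hfg : Submodule.FG (IsLocalRing.maximalIdeal R) := IsNoetherian.noetherian _
  have hrank := hreg.spanFinrank_maximalIdeal
  rw [ringKrullDim_eq_two ev (ne_zero_of_order_eq hG) hψ hker, ← hfg.generators_ncard] at hrank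
  have hcard : (IsLocalRing.maximalIdeal R).generators.ncard = 2 := by exact_mod_cast hrank
  have hle := finrank_quotient_maximalIdeal_sq_le ev hfg.finite_generators
    (Submodule.span_generators (IsLocalRing.maximalIdeal R)).symm
  have h := finrank_quotient_maximalIdeal_pow_add (R := R) hG hψ hker hev 2
  rw [Nat.sub_eq_zero_of_le hm] at h
  have h₄ : (2 + 2).choose 3 = 4 := rfl
  have h₀ : (0 + 2).choose 3 = 0 := rfl
  lia

end SurfaceInSpace

end Multiplicity

/-! ### Affine charts of sections of the flag variety -/

/-- The generators of the ideal of a section of the flag variety in the affine space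
`xᵢ = 1`, `yⱼ = 1`. -/
def chartEquations (q : BiPoly) (i j : Fin 3) : Fin 4 → BiPoly :=
  ![incidence, q, xv i - 1, yv j - 1]

/-- The ideal of a section of the flag variety in the affine space `xᵢ = 1`, `yⱼ = 1`. -/
def chartIdeal (q : BiPoly) (i j : Fin 3) : Ideal BiPoly :=
  Ideal.span (Set.range (chartEquations q i j))

theorem chartEquations_mem (q : BiPoly) (i j : Fin 3) (a : Fin 4) :
    chartEquations q i j a ∈ chartIdeal q i j := Ideal.subset_span ⟨a, rfl⟩

theorem chartIdeal_le {q : BiPoly} {i j : Fin 3} {I : Ideal BiPoly} (hinc : incidence ∈ I)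
    (hq : q ∈ I) (hx : xv i - 1 ∈ I) (hy : yv j - 1 ∈ I) : chartIdeal q i j ≤ I := by
  rw [chartIdeal, Ideal.span_le]
  rintro _ ⟨a, rfl⟩
  fin_cases a
  exacts [hinc, hq, hx, hy]

theorem incidence_mem_span (q : BiPoly) : incidence ∈ Ideal.span {incidence, q} :=
  Ideal.subset_span (Set.mem_insert _ _)

theorem mem_span_incidence (q : BiPoly) : q ∈ Ideal.span {incidence, q} :=
  Ideal.subset_span (Set.mem_insert_of_mem _ rfl)

theorem span_incidence_le (q : BiPoly) :
    Ideal.span {incidence} ≤ Ideal.span {incidence, q} := Ideal.span_mono (by simp)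

theorem span_le_chartIdeal (q : BiPoly) (i j : Fin 3) :
    Ideal.span {incidence, q} ≤ chartIdeal q i j := by
  rw [Ideal.span_le, Set.pair_subset_iff]
  exact ⟨chartEquations_mem q i j 0, chartEquations_mem q i j 1⟩

-- Rescaling the values of `τ` to `xᵢ = 1`, `yⱼ = 1` changes those of biforms by a nonzero factor.
theorem map_eq_zero_of_mem_chartIdeal {K : Type*} [Field K] [Algebra ℂ K] (τ : BiPoly →ₐ[ℂ] K)
    {q : BiPoly} (hq : q ∈ biPart (1, 1)) (hτinc : τ incidence = 0) (hτq : τ q = 0) {i j : Fin 3}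
    (hi : τ (xv i) ≠ 0) (hj : τ (yv j) ≠ 0) {m n : ℕ} {g : BiPoly} (hg : g ∈ biPart (m, n))
    (hmem : g ∈ chartIdeal q i j) : τ g = 0 := by
  let θ : BiPoly →ₐ[ℂ] K := aeval (Sum.elim (fun k => (τ (xv i))⁻¹ * τ (xv k))
    (fun k => (τ (yv j))⁻¹ * τ (yv k)))
  have hθ {m n : ℕ} {f : BiPoly} (hf : f ∈ biPart (m, n)) :
      θ f = (τ (xv i))⁻¹ ^ m * (τ (yv j))⁻¹ ^ n * τ f := by
    have h := aeval_scale hf (fun s => τ (X s)) (τ (xv i))⁻¹ (τ (yv j))⁻¹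
    rwa [show aeval (fun s => τ (X s)) = τ from algHom_ext fun s => aeval_X _ s] at h
  have hker : chartIdeal q i j ≤ RingHom.ker θ := by
    refine chartIdeal_le ?_ ?_ ?_ ?_ <;> rw [RingHom.mem_ker]
    · rw [hθ incidence_mem, hτinc, mul_zero]
    · rw [hθ hq, hτq, mul_zero]
    · rw [map_sub, hθ (xv_mem i), map_one]
      simp [hi]
    · rw [map_sub, hθ (yv_mem j), map_one]
      simp [hj]
  have h := hker hmem
  rw [RingHom.mem_ker, hθ hg] at h
  exact (mul_eq_zero.1 h).resolve_left
    (mul_ne_zero (pow_ne_zero _ (inv_ne_zero hi)) (pow_ne_zero _ (inv_ne_zero hj)))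

theorem mem_of_mem_chartIdeal {q : BiPoly} (hq : q ∈ biPart (1, 1))
    [(Ideal.span {incidence, q}).IsPrime] {i j : Fin 3}
    (hi : xv i ∉ Ideal.span {incidence, q}) (hj : yv j ∉ Ideal.span {incidence, q})
    {m n : ℕ} {g : BiPoly} (hg : g ∈ biPart (m, n)) (hmem : g ∈ chartIdeal q i j) :
    g ∈ Ideal.span {incidence, q} := by
  have hτ {f : BiPoly} : toConeFieldHom (Ideal.span {incidence, q}) f = 0 ↔
      f ∈ Ideal.span {incidence, q} := toConeField_eq_zero_iff _
  exact hτ.1 (map_eq_zero_of_mem_chartIdeal _ hq (hτ.2 (incidence_mem_span q))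
    (hτ.2 (mem_span_incidence q)) (mt hτ.1 hi) (mt hτ.1 hj) hg hmem)

section FlagSection

variable {ι : Type} {B : ι → Matrix (Fin 3) (Fin 3) ℂ}

section Chart

variable {q : BiPoly} {i j : Fin 3} {A : Type} [CommRing A] [Algebra ℂ A] {ψ : BiPoly →ₐ[ℂ] A}

theorem map_xv_eq_one (hker : RingHom.ker ψ = chartIdeal q i j) : ψ (xv i) = 1 := by
  have h := chartEquations_mem q i j 2
  rw [← hker, RingHom.mem_ker, show chartEquations q i j 2 = xv i - 1 from rfl] at h
  rwa [← sub_eq_zero, ← map_one ψ, ← map_sub]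

theorem map_yv_eq_one (hker : RingHom.ker ψ = chartIdeal q i j) : ψ (yv j) = 1 := by
  have h := chartEquations_mem q i j 3
  rw [← hker, RingHom.mem_ker, show chartEquations q i j 3 = yv j - 1 from rfl] at h
  rwa [← sub_eq_zero, ← map_one ψ, ← map_sub]

theorem exists_linear_map_segre_eq (hB : SpansModOne B)
    (hker : RingHom.ker ψ = chartIdeal q i j) (a b : Fin 3) :
    ∃ l : MvPolynomial ι ℂ, l.IsHomogeneous 1 ∧ ψ (segre B l) = ψ (yv a) * ψ (xv b) := by
  obtain ⟨l, hl, hl'⟩ := exists_linear hB (Matrix.single a b 1)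
  have h : bilin (Matrix.single a b 1) - segre B l ∈ RingHom.ker ψ := by
    rw [hker]
    exact span_le_chartIdeal q i j (span_incidence_le q hl')
  rw [bilin_single, RingHom.mem_ker, map_sub, map_mul, sub_eq_zero] at h
  exact ⟨l, hl, h.symm⟩

theorem map_comp_segre_surjective (hB : SpansModOne B)
    (hker : RingHom.ker ψ = chartIdeal q i j) (hψ : Function.Surjective ψ) :
    Function.Surjective (ψ.comp (segre B)) := by
  intro a
  obtain ⟨f, rfl⟩ := hψ a
  change ψ f ∈ (ψ.comp (segre B)).range
  induction f using MvPolynomial.induction_on with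
  | C c => exact ⟨C c, by simp [algHom_C]⟩
  | add f g hf hg => rw [map_add]; exact add_mem hf hg
  | mul_X f s hf =>
    rw [map_mul]
    refine mul_mem hf ?_
    rcases s with k | k
    · obtain ⟨l, -, h⟩ := exists_linear_map_segre_eq hB hker j k
      exact ⟨l, by rwa [map_yv_eq_one hker, one_mul] at h⟩
    · obtain ⟨l, -, h⟩ := exists_linear_map_segre_eq hB hker k i
      exact ⟨l, by rwa [map_xv_eq_one hker, mul_one] at h⟩

theorem exists_isChart (hB : SpansModOne B) (hq : q ∈ biPart (1, 1))
    [(Ideal.span {incidence, q}).IsPrime] (hi : xv i ∉ Ideal.span {incidence, q})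
    (hj : yv j ∉ Ideal.span {incidence, q}) (hψ : Function.Surjective ψ)
    (hker : RingHom.ker ψ = chartIdeal q i j) :
    ∃ l, IsChart ((Ideal.span {incidence, q}).comap (segre B)) l (ψ.comp (segre B)) := by
  obtain ⟨l, hl, hψl⟩ := exists_linear_map_segre_eq hB hker j i
  refine ⟨l, hl, map_comp_segre_surjective hB hker hψ, ?_, fun {n f} hf => ?_⟩
  · rw [AlgHom.comp_apply, hψl, map_xv_eq_one hker, map_yv_eq_one hker, one_mul]
  · rw [AlgHom.comp_apply, Ideal.mem_comap, ← RingHom.mem_ker, hker]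
    exact ⟨mem_of_mem_chartIdeal hq hi hj (segre_mem hf), fun h => span_le_chartIdeal q i j h⟩

end Chart

/-! ### Points of sections of the flag variety -/

theorem IsZeroOf.segrePoint_ne_zero (hB : SpansModOne B) {q : BiPoly} {x y : Fin 3 → ℂ}
    (h : IsZeroOf (Ideal.span {incidence, q}) x y) : segrePoint B x y ≠ 0 :=
  TangentPlane.segrePoint_ne_zero hB h.vec_ne_zero h.covec_ne_zero
    (h.dotProduct_eq_zero (incidence_mem_span q))

/-- The point of projective space given by a vector and a covector on a section of the flag
variety. -/
abbrev IsZeroOf.point (hB : SpansModOne B) {q : BiPoly} {x y : Fin 3 → ℂ}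
    (h : IsZeroOf (Ideal.span {incidence, q}) x y) : ℙ ℂ (ι → ℂ) :=
  Projectivization.mk ℂ (segrePoint B x y) (h.segrePoint_ne_zero hB)

theorem IsZeroOf.xv_notMem {J : Ideal BiPoly} {x y : Fin 3 → ℂ} (h : IsZeroOf J x y) {i : Fin 3}
    (hi : x i ≠ 0) : xv i ∉ J := fun hJ => hi (by simpa using h.eval_eq_zero _ hJ)

theorem IsZeroOf.yv_notMem {J : Ideal BiPoly} {x y : Fin 3 → ℂ} (h : IsZeroOf J x y) {j : Fin 3}
    (hj : y j ≠ 0) : yv j ∉ J := fun hJ => hj (by simpa using h.eval_eq_zero _ hJ)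

theorem exists_eq_mul_dotProduct_mulVec {n K : Type*} [Fintype n] [DecidableEq n] [Field K]
    {E : Matrix n n K →ₗ[K] K} (hE : E ≠ 0)
    (hrank : ∀ a b c d, E (Matrix.single a b 1) * E (Matrix.single c d 1) =
      E (Matrix.single a d 1) * E (Matrix.single c b 1)) :
    ∃ (x y : n → K) (c : K), (∃ i, x i = 1) ∧ (∃ j, y j = 1) ∧ c ≠ 0 ∧
      ∀ M, E M = c * (y ⬝ᵥ M.mulVec x) := by
  have hsum (M) : E M = ∑ a, ∑ b, M a b * E (Matrix.single a b 1) := by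
    conv_lhs => rw [Matrix.matrix_eq_sum_single M]
    simp only [map_sum]
    refine Finset.sum_congr rfl fun a _ => Finset.sum_congr rfl fun b _ => ?_
    rw [← smul_eq_mul, ← map_smul, Matrix.smul_single, smul_eq_mul, mul_one]
  obtain ⟨a, b, hab⟩ : ∃ a b, E (Matrix.single a b 1) ≠ 0 := by
    by_contra! h
    exact hE (LinearMap.ext fun M => by simp [hsum M, h])
  refine ⟨fun k => E (Matrix.single a k 1) / E (Matrix.single a b 1),
    fun k => E (Matrix.single k b 1) / E (Matrix.single a b 1), _, ⟨b, div_self hab⟩,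
    ⟨a, div_self hab⟩, hab, fun M => ?_⟩
  simp only [hsum M, dotProduct, Matrix.mulVec, Finset.mul_sum]
  refine Finset.sum_congr rfl fun c _ => Finset.sum_congr rfl fun d _ => ?_
  field_simp
  linear_combination M c d * hrank a b c d

theorem exists_linearMap_eq_eval (hB : SpansModOne B) {J : Ideal BiPoly} (hJ : incidence ∈ J)
    {w : ι → ℂ} (hw : ∀ f, segre B f ∈ J → eval w f = 0) :
    ∃ E : Matrix (Fin 3) (Fin 3) ℂ →ₗ[ℂ] ℂ,
      ∀ M l, bilin M - segre B l ∈ J → E M = eval w l := by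
  choose L _ hL using fun a b => exists_linear hB (Matrix.single a b 1)
  refine ⟨∑ a, ∑ b, (eval w (L a b)) • Matrix.entryLinearMap ℂ ℂ a b, fun M l hl => ?_⟩
  have hmem : segre B (l - ∑ a, ∑ b, C (M a b) * L a b) ∈ J := by
    have hle : Ideal.span {incidence} ≤ J := by rwa [Ideal.span_singleton_le_iff_mem]
    have hsum : ∑ a, ∑ b, C (M a b) * (bilin (Matrix.single a b 1) - segre B (L a b)) ∈ J :=
      sum_mem fun a _ => sum_mem fun b _ => Ideal.mul_mem_left _ _ (hle (hL a b))
    have hM : bilin M = ∑ a, ∑ b, C (M a b) * bilin (Matrix.single a b 1) := by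
      simp only [bilin_single]
      exact bilin_apply M
    convert sub_mem hsum hl using 1
    simp only [hM, map_sub, map_sum, map_mul, segre_C, mul_sub, Finset.sum_sub_distrib]
    ring
  rw [← sub_eq_zero, ← neg_eq_zero, neg_sub, ← hw _ hmem]
  simp [mul_comm]

theorem exists_isZeroOf_of_mem_points (hB : SpansModOne B) {N : Matrix (Fin 3) (Fin 3) ℂ}
    {p : ℙ ℂ (ι → ℂ)} (hp : p ∈ points ((Ideal.span {incidence, bilin N}).comap (segre B))) :
    ∃ x y, ∃ h : IsZeroOf (Ideal.span {incidence, bilin N}) x y, (∃ i, x i = 1) ∧ (∃ j, y j = 1) ∧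
      p = h.point hB := by
  induction p using Projectivization.ind with | h w hw => ?_
  have hw₀ (f) (hf : segre B f ∈ Ideal.span {incidence, bilin N}) : eval w f = 0 := hp hf w hw rfl
  obtain ⟨E, hE⟩ := exists_linearMap_eq_eval hB (incidence_mem_span _) hw₀
  have hEB (i) : E (B i) = w i := by rw [hE (B i) (X i) (by simp [segre_X]), eval_X]
  have hE₀ (M) (hM : bilin M ∈ Ideal.span {incidence, bilin N}) : E M = 0 := by
    rw [hE M 0 (by simpa using hM), map_zero]
  have hrank (a b c d) : E (Matrix.single a b 1) * E (Matrix.single c d 1) =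
      E (Matrix.single a d 1) * E (Matrix.single c b 1) := by
    choose L _ hL using fun a b => exists_linear hB (Matrix.single a b 1)
    have hL₂ (a b) := span_incidence_le (bilin N) (hL a b)
    rw [hE _ _ (hL₂ a b), hE _ _ (hL₂ c d), hE _ _ (hL₂ a d), hE _ _ (hL₂ c b), ← map_mul,
      ← map_mul, ← sub_eq_zero, ← map_sub]
    refine hw₀ _ (Ideal.Quotient.eq_zero_iff_mem.1 ?_)
    have hmk (a b) := (Ideal.Quotient.eq.2 (hL₂ a b)).symm
    simp only [map_sub, map_mul, hmk, bilin_single]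
    ring
  have hE_ne : E ≠ 0 := by
    rintro rfl
    exact hw (funext fun i => (hEB i).symm)
  obtain ⟨x, y, c, ⟨i, hi⟩, ⟨j, hj⟩, hc, hxy⟩ := exists_eq_mul_dotProduct_mulVec hE_ne hrank
  have hzero (M) (hM : bilin M ∈ Ideal.span {incidence, bilin N}) :
      eval (Sum.elim x y) (bilin M) = 0 := by
    rw [eval_bilin]
    exact (mul_eq_zero.1 ((hxy M).symm.trans (hE₀ M hM))).resolve_left hc
  refine ⟨x, y, isZeroOf_span_pair (fun h => by simp [h] at hi) (fun h => by simp [h] at hj)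
    (hzero 1 (incidence_mem_span _)) (hzero N (mem_span_incidence _)), ⟨i, hi⟩, ⟨j, hj⟩, ?_⟩
  refine (Projectivization.mk_eq_mk_iff' ..).2 ⟨c, funext fun i => ?_⟩
  rw [← hEB, hxy]
  rfl

/-! ### Singular points of sections of the flag variety -/

theorem eval_pderiv_inl_bilin (M : Matrix (Fin 3) (Fin 3) ℂ) (x y : Fin 3 → ℂ) (k : Fin 3) :
    eval (Sum.elim x y) (pderiv (.inl k) (bilin M)) = M.vecMul y k := by
  simp [bilin_apply, xv, yv, pderiv_X, Pi.single_apply, Matrix.vecMul, dotProduct, mul_comm]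

theorem eval_pderiv_inr_bilin (M : Matrix (Fin 3) (Fin 3) ℂ) (x y : Fin 3 → ℂ) (k : Fin 3) :
    eval (Sum.elim x y) (pderiv (.inr k) (bilin M)) = M.mulVec x k := by
  simp [bilin_apply, xv, yv, pderiv_X, Pi.single_apply, Matrix.mulVec, dotProduct, mul_comm]

-- The relation between the gradients, paired with `x` and `y`, leaves one between `x`, `N x` and
-- between `y`, `y N`.
theorem linearIndependent_gradient {N : Matrix (Fin 3) (Fin 3) ℂ} {x y : Fin 3 → ℂ}
    (hxy : y ⬝ᵥ x = 0) (hN : y ⬝ᵥ N.mulVec x = 0) {i j : Fin 3} (hi : x i = 1) (hj : y j = 1)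
    (hne : ∀ r : ℂ, ¬ (N.mulVec x = r • x ∧ N.vecMul y = r • y)) :
    LinearIndependent ℂ fun a t =>
      eval (Sum.elim x y) (pderiv t (chartEquations (bilin N) i j a)) := by
  rw [Fintype.linearIndependent_iff]
  intro c hc
  have hl : c 0 • y + c 1 • N.vecMul y + c 2 • Pi.single i 1 = 0 := by
    ext k
    have h := congr_fun hc (.inl k)
    simpa [Fin.sum_univ_four, chartEquations, incidence, eval_pderiv_inl_bilin, xv, yv, pderiv_X,
      Pi.single_apply, apply_ite, eq_comm] using h
  have hr : c 0 • x + c 1 • N.mulVec x + c 3 • Pi.single j 1 = 0 := by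
    ext k
    have h := congr_fun hc (.inr k)
    simpa [Fin.sum_univ_four, chartEquations, incidence, eval_pderiv_inr_bilin, xv, yv, pderiv_X,
      Pi.single_apply, apply_ite, eq_comm] using h
  have h₂ : c 2 = 0 := by
    simpa [add_dotProduct, hxy, ← Matrix.dotProduct_mulVec, hN, hi] using congr($hl ⬝ᵥ x)
  have h₃ : c 3 = 0 := by
    simpa [dotProduct_add, hxy, hN, hj] using congr(y ⬝ᵥ $hr)
  rw [h₂, zero_smul, add_zero] at hl
  rw [h₃, zero_smul, add_zero] at hr
  have h₁ : c 1 = 0 := by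
    by_contra h₁
    have hsolve {u v : Fin 3 → ℂ} (h : c 0 • u + c 1 • v = 0) : v = (-(c 0 / c 1)) • u := by
      rw [← inv_smul_smul₀ h₁ v, eq_neg_of_add_eq_zero_right h, smul_neg, smul_smul, neg_smul,
        div_eq_inv_mul]
    exact hne _ ⟨hsolve hr, hsolve hl⟩
  have h₀ : c 0 = 0 := by simpa [hi, h₁] using congr_fun hr i
  intro a
  fin_cases a
  exacts [h₀, h₁, h₂, h₃]

section Singular

variable {N : Matrix (Fin 3) (Fin 3) ℂ} {x y : Fin 3 → ℂ} {i j : Fin 3}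

theorem IsZeroOf.chartIdeal_le_ker {q : BiPoly} (h : IsZeroOf (Ideal.span {incidence, q}) x y)
    (hi : x i = 1) (hj : y j = 1) :
    chartIdeal q i j ≤ RingHom.ker (aeval (R := ℂ) (Sum.elim x y)) :=
  chartIdeal_le (h.eval_eq_zero _ (incidence_mem_span q)) (h.eval_eq_zero _ (mem_span_incidence q))
    (by simp [hi]) (by simp [hj])

theorem IsZeroOf.isRegularLocalRing (hB : SpansModOne B)
    [(Ideal.span {incidence, bilin N}).IsPrime]
    (h : IsZeroOf (Ideal.span {incidence, bilin N}) x y) (hi : x i = 1) (hj : y j = 1)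
    (hne : ∀ r : ℂ, ¬ (N.mulVec x = r • x ∧ N.vecMul y = r • y)) :
    IsRegularLocalRing (localRing ((Ideal.span {incidence, bilin N}).comap (segre B))
      (h.point hB)) := by
  let ψ := Ideal.Quotient.mkₐ ℂ (chartIdeal (bilin N) i j)
  have hψ : Function.Surjective ψ := Ideal.Quotient.mkₐ_surjective ℂ _
  have hker : RingHom.ker ψ = chartIdeal (bilin N) i j := Ideal.Quotient.mkₐ_ker ℂ _
  let ev : (BiPoly ⧸ chartIdeal (bilin N) i j) →ₐ[ℂ] ℂ :=
    Ideal.Quotient.liftₐ _ (aeval (Sum.elim x y)) (h.chartIdeal_le_ker hi hj)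
  obtain ⟨l, hchart⟩ := exists_isChart hB (bilin_mem N) (h.xv_notMem (hi ▸ one_ne_zero))
    (h.yv_notMem (hj ▸ one_ne_zero)) hψ hker
  obtain ⟨ρ, hρ⟩ := hchart.exists_isLocalization (ev := ev) (eval_segre x y)
    (h.segrePoint_ne_zero hB)
  let := ρ.toRingHom.toAlgebra
  have hN := h.eval_eq_zero _ (mem_span_incidence _)
  rw [eval_bilin] at hN
  exact isRegularLocalRing_of_linearIndependent hψ hker ev (linearIndependent_gradient
    (h.dotProduct_eq_zero (incidence_mem_span _)) hN hi hj hne)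

theorem exists_eigenvectors_of_mem_singularLocus (hB : SpansModOne B)
    [(Ideal.span {incidence, bilin N}).IsPrime] {p : ℙ ℂ (ι → ℂ)}
    (hp : p ∈ singularLocus ((Ideal.span {incidence, bilin N}).comap (segre B))) :
    ∃ x y, ∃ h : IsZeroOf (Ideal.span {incidence, bilin N}) x y,
      (∃ r : ℂ, N.mulVec x = r • x ∧ N.vecMul y = r • y) ∧ p = h.point hB := by
  obtain ⟨x, y, h, ⟨i, hi⟩, ⟨j, hj⟩, rfl⟩ := exists_isZeroOf_of_mem_points hB hp.1
  refine ⟨x, y, h, ?_, rfl⟩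
  by_contra! hne
  exact hp.2 (h.isRegularLocalRing hB hi hj fun r hr => hne r hr.1 hr.2)

theorem IsZeroOf.mem_singularLocus_and_hasMultiplicityAt (hB : SpansModOne B)
    [(Ideal.span {incidence, bilin N}).IsPrime]
    (h : IsZeroOf (Ideal.span {incidence, bilin N}) x y) (hi : x i ≠ 0) (hj : y j ≠ 0)
    {G : MvPolynomial (Fin 3) ℂ} {m : ℕ} (hm : 2 ≤ m)
    (hG : (G : MvPowerSeries (Fin 3) ℂ).order = m) {A : Type} [CommRing A] [Algebra ℂ A]
    {π : MvPolynomial (Fin 3) ℂ →ₐ[ℂ] A} (hπ : Function.Surjective π)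
    (hπker : RingHom.ker π = Ideal.span {G}) {ev : A →ₐ[ℂ] ℂ} (hevX : ∀ k, ev (π (X k)) = 0)
    {ψ : BiPoly →ₐ[ℂ] A} (hψ : Function.Surjective ψ)
    (hker : RingHom.ker ψ = chartIdeal (bilin N) i j)
    (hev : ∀ f, ev (ψ f) = eval (Sum.elim x y) f) :
    h.point hB ∈ singularLocus ((Ideal.span {incidence, bilin N}).comap (segre B)) ∧
      HasMultiplicityAt ((Ideal.span {incidence, bilin N}).comap (segre B)) (h.point hB) m := by
  obtain ⟨l, hchart⟩ := exists_isChart hB (bilin_mem N) (h.xv_notMem hi) (h.yv_notMem hj) hψ hker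
  have hev' (f) : ev (ψ.comp (segre B) f) = eval (segrePoint B x y) f :=
    (hev _).trans (eval_segre x y f)
  obtain ⟨ρ, hρ⟩ := hchart.exists_isLocalization hev' (h.segrePoint_ne_zero hB)
  let := ρ.toRingHom.toAlgebra
  have : IsScalarTower ℂ A
      (localRing ((Ideal.span {incidence, bilin N}).comap (segre B)) (h.point hB)) :=
    IsScalarTower.of_algebraMap_eq fun c => (ρ.commutes c).symm
  exact ⟨⟨hchart.mk_mem_points (fun f hf n => homogeneousComponent_mem_comap
      (isHomogeneous_span_incidence (bilin_mem N)) hf n) hev' _,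
    not_isRegularLocalRing_of_two_le_order hm hG hπ hπker hevX⟩,
    hasMultiplicity_of_order_eq (by lia) hG hπ hπker hevX⟩

theorem IsZeroOf.mem_singularLocus_and_hasMultiplicityAt_of_comap_eq (hB : SpansModOne B)
    [(Ideal.span {incidence, bilin N}).IsPrime]
    (h : IsZeroOf (Ideal.span {incidence, bilin N}) x y) (hi : x i = 1) (hj : y j = 1)
    {G : MvPolynomial (Fin 3) ℂ} {m : ℕ} (hm : 2 ≤ m)
    (hG : (G : MvPowerSeries (Fin 3) ℂ).order = m) {θ : BiPoly →ₐ[ℂ] MvPolynomial (Fin 3) ℂ}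
    (hθ : Function.Surjective θ) (hθG : (Ideal.span {G}).comap θ = chartIdeal (bilin N) i j)
    (hθ₀ : ∀ s, eval 0 (θ (X s)) = Sum.elim x y s) :
    h.point hB ∈ singularLocus ((Ideal.span {incidence, bilin N}).comap (segre B)) ∧
      HasMultiplicityAt ((Ideal.span {incidence, bilin N}).comap (segre B)) (h.point hB) m := by
  let π := Ideal.Quotient.mkₐ ℂ (Ideal.span {G})
  have hπ : Function.Surjective π := Ideal.Quotient.mkₐ_surjective ℂ _
  have hπker : RingHom.ker π = Ideal.span {G} := Ideal.Quotient.mkₐ_ker ℂ _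
  have hker : RingHom.ker (π.comp θ) = chartIdeal (bilin N) i j := by
    rw [← hθG]
    exact congr_arg (Ideal.comap θ) hπker
  have hθeval (f : BiPoly) : aeval (R := ℂ) (0 : Fin 3 → ℂ) (θ f) = eval (Sum.elim x y) f := by
    have h' : (aeval (R := ℂ) (0 : Fin 3 → ℂ)).comp θ = aeval (Sum.elim x y) :=
      algHom_ext fun s => (hθ₀ s).trans (aeval_X _ s).symm
    exact congr($h' f)
  have hG₀ (f) (hf : f ∈ Ideal.span {G}) : aeval (R := ℂ) (0 : Fin 3 → ℂ) f = 0 := by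
    obtain ⟨g, rfl⟩ := hθ f
    rw [hθeval]
    exact h.chartIdeal_le_ker hi hj (hθG ▸ hf)
  exact h.mem_singularLocus_and_hasMultiplicityAt hB (hi ▸ one_ne_zero) (hj ▸ one_ne_zero) hm hG hπ
    hπker (ev := Ideal.Quotient.liftₐ _ (aeval (R := ℂ) (0 : Fin 3 → ℂ)) hG₀)
    (fun k => aeval_X _ k) (hπ.comp hθ) hker hθeval

end Singular

end FlagSection

section Local

theorem order_eq_of_coeff_ne_zero {σ K : Type*} [Field K] {G : MvPolynomial σ K} {m : ℕ}
    (hmem : G ∈ idealOfVars σ K ^ m) {d : σ →₀ ℕ} (hd : d.degree = m) (hcoeff : coeff d G ≠ 0) :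
    (G : MvPowerSeries σ K).order = m := by
  refine le_antisymm ?_ ((mem_pow_idealOfVars_iff_le_order m G).1 hmem)
  rw [← hd]
  exact MvPowerSeries.order_le (by rwa [coeff_coe])

theorem X_mul_X_mem_sq_idealOfVars {σ R : Type*} [CommSemiring R] (a b : σ) :
    (X a * X b : MvPolynomial σ R) ∈ idealOfVars σ R ^ 2 := by
  rw [pow_two]
  exact Ideal.mul_mem_mul (Ideal.subset_span ⟨a, rfl⟩) (Ideal.subset_span ⟨b, rfl⟩)

theorem comap_span_singleton_eq {σ τ R : Type*} [CommRing R] {I : Ideal (MvPolynomial σ R)}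
    {G : MvPolynomial τ R} {θ : MvPolynomial σ R →ₐ[R] MvPolynomial τ R}
    {ζ : MvPolynomial τ R →ₐ[R] MvPolynomial σ R} (hI : I ≤ (Ideal.span {G}).comap θ)
    (hζθ : ∀ s, ζ (θ (X s)) - X s ∈ I) (hG : ζ G ∈ I) : (Ideal.span {G}).comap θ = I := by
  refine le_antisymm (fun f hf => ?_) hI
  obtain ⟨g, hg⟩ := Ideal.mem_span_singleton.1 hf
  have hcomp : (Ideal.Quotient.mkₐ R I).comp (ζ.comp θ) = Ideal.Quotient.mkₐ R I :=
    algHom_ext fun s => Ideal.Quotient.eq.2 (hζθ s)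
  have hf' : ζ (θ f) - f ∈ I := Ideal.Quotient.eq.1 congr($hcomp f)
  have hθ : ζ (θ f) ∈ I := by
    rw [hg, map_mul]
    exact Ideal.mul_mem_right _ _ hG
  exact (Submodule.sub_mem_iff_right _ hθ).1 hf'

theorem surjective_of_apply_apply_X {σ τ R : Type*} [CommSemiring R]
    {θ : MvPolynomial σ R →ₐ[R] MvPolynomial τ R} {ζ : MvPolynomial τ R →ₐ[R] MvPolynomial σ R}
    (h : ∀ k, θ (ζ (X k)) = X k) : Function.Surjective θ := by
  have hid : θ.comp ζ = AlgHom.id R _ := algHom_ext h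
  exact fun g => ⟨ζ g, congr($hid g)⟩

end Local

/-! ### Sections with a double point -/

section DoublePoint

variable {ι : Type} {B : ι → Matrix (Fin 3) (Fin 3) ℂ}

theorem bilin_twoBlocks (l : ℂ) :
    bilin !![l, 0, 0; 0, 0, 1; 0, 0, 0] = C l * (xv 0 * yv 0) + xv 2 * yv 1 := by
  simp [bilin_apply, Fin.sum_univ_three]
  ring

theorem bilin_oneBlock :
    bilin !![0, 1, 0; 0, 0, 1; 0, 0, 0] = xv 1 * yv 0 + xv 2 * yv 1 := by
  simp [bilin_apply, Fin.sum_univ_three]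
  ring

theorem isZeroOf_twoBlocks (l : ℂ) :
    IsZeroOf (Ideal.span {incidence, bilin !![l, 0, 0; 0, 0, 1; 0, 0, 0]})
      ![0, 1, 0] ![0, 0, 1] :=
  isZeroOf_span_pair (fun h => by simpa using congr_fun h 1) (fun h => by simpa using congr_fun h 2)
    (by simp [incidence_eq]) (by simp [bilin_twoBlocks])

theorem isZeroOf_oneBlock :
    IsZeroOf (Ideal.span {incidence, bilin !![0, 1, 0; 0, 0, 1; 0, 0, 0]})
      ![1, 0, 0] ![0, 0, 1] :=
  isZeroOf_span_pair (fun h => by simpa using congr_fun h 0) (fun h => by simpa using congr_fun h 2)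
    (by simp [incidence_eq]) (by simp [bilin_oneBlock])

/-- The local equation of the section `twoBlocks` at its double point, in the coordinates
`x₀`, `y₀`, `x₂` of the chart `x₁ = 1`, `y₂ = 1`; there `y₁ = -x₂ - x₀ y₀`. -/
def twoBlocksEquation (l : ℂ) : MvPolynomial (Fin 3) ℂ :=
  C l * (X 0 * X 1) - X 2 * X 2 - X 0 * X 1 * X 2

/-- The local equation of the section `oneBlock` at its double point, in the coordinates
`x₁`, `y₁`, `y₀` of the chart `x₀ = 1`, `y₂ = 1`; there `x₂ = -y₀ - x₁ y₁`. -/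
def oneBlockEquation : MvPolynomial (Fin 3) ℂ :=
  X 0 * X 2 - X 2 * X 1 - X 0 * X 1 * X 1

theorem order_twoBlocksEquation {l : ℂ} (hl : l ≠ 0) :
    (twoBlocksEquation l : MvPowerSeries (Fin 3) ℂ).order = (2 : ℕ) := by
  refine order_eq_of_coeff_ne_zero (d := Finsupp.single 0 1 + Finsupp.single 1 1) ?_ (by simp) ?_
  · exact sub_mem (sub_mem (Ideal.mul_mem_left _ _ (X_mul_X_mem_sq_idealOfVars 0 1))
      (X_mul_X_mem_sq_idealOfVars 2 2)) (Ideal.mul_mem_right _ _ (X_mul_X_mem_sq_idealOfVars 0 1))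
  · simpa [twoBlocksEquation, X, monomial_mul, coeff_C_mul, coeff_monomial, Finsupp.ext_iff,
      Fin.forall_fin_succ] using hl

theorem order_oneBlockEquation :
    (oneBlockEquation : MvPowerSeries (Fin 3) ℂ).order = (2 : ℕ) := by
  refine order_eq_of_coeff_ne_zero (d := Finsupp.single 0 1 + Finsupp.single 2 1) ?_ (by simp) ?_
  · exact sub_mem (sub_mem (X_mul_X_mem_sq_idealOfVars 0 2) (X_mul_X_mem_sq_idealOfVars 2 1))
      (Ideal.mul_mem_right _ _ (X_mul_X_mem_sq_idealOfVars 0 1))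
  · simp [oneBlockEquation, X, monomial_mul, coeff_monomial, Finsupp.ext_iff,
      Fin.forall_fin_succ]

theorem comap_span_twoBlocksEquation (l : ℂ) :
    (Ideal.span {twoBlocksEquation l}).comap
        (aeval (R := ℂ) (Sum.elim ![X 0, 1, X 2] ![X 1, -X 2 - X 0 * X 1, 1])) =
      chartIdeal (bilin !![l, 0, 0; 0, 0, 1; 0, 0, 0]) 1 2 := by
  set q := bilin !![l, 0, 0; 0, 0, 1; 0, 0, 0] with hq
  have hx : xv 1 - 1 ∈ chartIdeal q 1 2 := chartEquations_mem q 1 2 2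
  have hy : yv 2 - 1 ∈ chartIdeal q 1 2 := chartEquations_mem q 1 2 3
  have hy₁ : yv 1 + xv 2 + xv 0 * yv 0 ∈ chartIdeal q 1 2 := by
    convert sub_mem (sub_mem (chartEquations_mem q 1 2 0) (Ideal.mul_mem_left _ (yv 1) hx))
      (Ideal.mul_mem_left _ (xv 2) hy) using 1
    simp only [chartEquations, incidence_eq, Matrix.cons_val_zero]
    ring
  refine comap_span_singleton_eq (ζ := aeval ![xv 0, yv 0, xv 2])
    (chartIdeal_le ?_ ?_ (by simp) (by simp)) ?_ ?_
  · simp [incidence_eq]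
  · rw [Ideal.mem_comap, Ideal.mem_span_singleton, hq, bilin_twoBlocks]
    refine dvd_of_eq ?_
    simp [twoBlocksEquation, algHom_C]
    ring
  · rintro (s | s) <;> fin_cases s
    · simp
    · simpa using neg_mem hx
    · simp
    · simp
    · convert neg_mem hy₁ using 1
      simp
      ring
    · simpa using neg_mem hy
  · convert sub_mem (chartEquations_mem q 1 2 1) (Ideal.mul_mem_left _ (xv 2) hy₁) using 1
    simp [chartEquations, hq, bilin_twoBlocks, twoBlocksEquation, algHom_C]
    ring

theorem comap_span_oneBlockEquation :
    (Ideal.span {oneBlockEquation}).comap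
        (aeval (R := ℂ) (Sum.elim ![1, X 0, -X 2 - X 0 * X 1] ![X 2, X 1, 1])) =
      chartIdeal (bilin !![0, 1, 0; 0, 0, 1; 0, 0, 0]) 0 2 := by
  set q := bilin !![0, 1, 0; 0, 0, 1; 0, 0, 0] with hq
  have hx : xv 0 - 1 ∈ chartIdeal q 0 2 := chartEquations_mem q 0 2 2
  have hy : yv 2 - 1 ∈ chartIdeal q 0 2 := chartEquations_mem q 0 2 3
  have hx₂ : xv 2 + yv 0 + xv 1 * yv 1 ∈ chartIdeal q 0 2 := by
    convert sub_mem (sub_mem (chartEquations_mem q 0 2 0) (Ideal.mul_mem_left _ (yv 0) hx))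
      (Ideal.mul_mem_left _ (xv 2) hy) using 1
    simp only [chartEquations, incidence_eq, Matrix.cons_val_zero]
    ring
  refine comap_span_singleton_eq (ζ := aeval ![xv 1, yv 1, yv 0])
    (chartIdeal_le ?_ ?_ (by simp) (by simp)) ?_ ?_
  · simp [incidence_eq]
  · rw [Ideal.mem_comap, Ideal.mem_span_singleton, hq, bilin_oneBlock]
    refine dvd_of_eq ?_
    simp [oneBlockEquation]
    ring
  · rintro (s | s) <;> fin_cases s
    · simpa using neg_mem hx
    · simp
    · convert neg_mem hx₂ using 1
      simp
      ring
    · simp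
    · simp
    · simpa using neg_mem hy
  · convert sub_mem (chartEquations_mem q 0 2 1) (Ideal.mul_mem_left _ (yv 1) hx₂) using 1
    simp [chartEquations, hq, bilin_oneBlock, oneBlockEquation]
    ring

theorem mem_singularLocus_twoBlocks (hB : SpansModOne B) {l : ℂ} (hl : l ≠ 0)
    [(Ideal.span {incidence, bilin !![l, 0, 0; 0, 0, 1; 0, 0, 0]}).IsPrime] :
    (isZeroOf_twoBlocks l).point hB ∈ singularLocus
        ((Ideal.span {incidence, bilin !![l, 0, 0; 0, 0, 1; 0, 0, 0]}).comap (segre B)) ∧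
      HasMultiplicityAt
        ((Ideal.span {incidence, bilin !![l, 0, 0; 0, 0, 1; 0, 0, 0]}).comap (segre B))
        ((isZeroOf_twoBlocks l).point hB) 2 := by
  refine (isZeroOf_twoBlocks l).mem_singularLocus_and_hasMultiplicityAt_of_comap_eq hB (i := 1)
    (j := 2) rfl rfl le_rfl (order_twoBlocksEquation hl)
    (surjective_of_apply_apply_X (ζ := aeval ![xv 0, yv 0, xv 2]) fun k => ?_)
    (comap_span_twoBlocksEquation l) ?_
  · fin_cases k <;> simp
  · rintro (s | s) <;> fin_cases s <;> simp

theorem mem_singularLocus_oneBlock (hB : SpansModOne B)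
    [(Ideal.span {incidence, bilin !![0, 1, 0; 0, 0, 1; 0, 0, 0]}).IsPrime] :
    isZeroOf_oneBlock.point hB ∈ singularLocus
        ((Ideal.span {incidence, bilin !![0, 1, 0; 0, 0, 1; 0, 0, 0]}).comap (segre B)) ∧
      HasMultiplicityAt
        ((Ideal.span {incidence, bilin !![0, 1, 0; 0, 0, 1; 0, 0, 0]}).comap (segre B))
        (isZeroOf_oneBlock.point hB) 2 := by
  refine isZeroOf_oneBlock.mem_singularLocus_and_hasMultiplicityAt_of_comap_eq hB (i := 0)
    (j := 2) rfl rfl le_rfl order_oneBlockEquation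
    (surjective_of_apply_apply_X (ζ := aeval ![xv 1, yv 1, yv 0]) fun k => ?_)
    comap_span_oneBlockEquation ?_
  · fin_cases k <;> simp
  · rintro (s | s) <;> fin_cases s <;> simp

theorem IsZeroOf.point_eq_point (hB : SpansModOne B) {q : BiPoly} {x y x' y' : Fin 3 → ℂ} {a b : ℂ}
    (h : IsZeroOf (Ideal.span {incidence, q}) x y) (h' : IsZeroOf (Ideal.span {incidence, q}) x' y')
    (hx : x = a • x') (hy : y = b • y') : h.point hB = h'.point hB := by
  subst hx hy
  refine (Projectivization.mk_eq_mk_iff' ..).2 ⟨a * b, funext fun i => ?_⟩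
  simp [segrePoint, Matrix.mulVec_smul, mul_assoc]

section Eigenvectors

variable {x y : Fin 3 → ℂ} {r : ℂ}

theorem eq_smul_of_eigenvectors_twoBlocks {l : ℂ} (hl : l ≠ 0) (hx₀ : x ≠ 0) (hy₀ : y ≠ 0)
    (hyx : y ⬝ᵥ x = 0) (hx : !![l, 0, 0; 0, 0, 1; 0, 0, 0].mulVec x = r • x)
    (hy : !![l, 0, 0; 0, 0, 1; 0, 0, 0].vecMul y = r • y) :
    x = x 1 • ![0, 1, 0] ∧ y = y 2 • ![0, 0, 1] := by
  simp [funext_iff, Fin.forall_fin_succ, dotProduct, Fin.sum_univ_three, Matrix.vecHead,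
    Matrix.vecTail] at hx hy hyx hx₀ hy₀ ⊢
  grind

theorem eq_smul_of_eigenvectors_oneBlock (hx₀ : x ≠ 0)
    (hx : !![0, 1, 0; 0, 0, 1; 0, 0, 0].mulVec x = r • x)
    (hy : !![0, 1, 0; 0, 0, 1; 0, 0, 0].vecMul y = r • y) :
    x = x 0 • ![1, 0, 0] ∧ y = y 2 • ![0, 0, 1] := by
  simp [funext_iff, Fin.forall_fin_succ, dotProduct, Fin.sum_univ_three, Matrix.vecHead,
    Matrix.vecTail] at hx hy hx₀ ⊢
  grind

theorem dotProduct_ne_zero_of_eigenvectors_diagonal {l m : ℂ} (hl : l ≠ 0) (hm : m ≠ 0)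
    (hlm : l ≠ m) (hx₀ : x ≠ 0) (hy₀ : y ≠ 0)
    (hx : !![l, 0, 0; 0, m, 0; 0, 0, 0].mulVec x = r • x)
    (hy : !![l, 0, 0; 0, m, 0; 0, 0, 0].vecMul y = r • y) : y ⬝ᵥ x ≠ 0 := by
  simp [funext_iff, Fin.forall_fin_succ, dotProduct, Fin.sum_univ_three, Matrix.vecHead,
    Matrix.vecTail] at hx hy hx₀ hy₀ ⊢
  grind

end Eigenvectors

theorem singularLocus_twoBlocks (hB : SpansModOne B) {l : ℂ} (hl : l ≠ 0)
    [(Ideal.span {incidence, bilin !![l, 0, 0; 0, 0, 1; 0, 0, 0]}).IsPrime] :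
    singularLocus ((Ideal.span {incidence, bilin !![l, 0, 0; 0, 0, 1; 0, 0, 0]}).comap (segre B)) =
      {(isZeroOf_twoBlocks l).point hB} := by
  refine Set.Subset.antisymm (fun p hp => ?_)
    (Set.singleton_subset_iff.2 (mem_singularLocus_twoBlocks hB hl).1)
  obtain ⟨x, y, h, ⟨r, hx, hy⟩, rfl⟩ := exists_eigenvectors_of_mem_singularLocus hB hp
  obtain ⟨hx', hy'⟩ := eq_smul_of_eigenvectors_twoBlocks hl h.vec_ne_zero h.covec_ne_zero
    (h.dotProduct_eq_zero (incidence_mem_span _)) hx hy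
  exact h.point_eq_point hB _ hx' hy'

theorem singularLocus_oneBlock (hB : SpansModOne B)
    [(Ideal.span {incidence, bilin !![0, 1, 0; 0, 0, 1; 0, 0, 0]}).IsPrime] :
    singularLocus ((Ideal.span {incidence, bilin !![0, 1, 0; 0, 0, 1; 0, 0, 0]}).comap (segre B)) =
      {isZeroOf_oneBlock.point hB} := by
  refine Set.Subset.antisymm (fun p hp => ?_)
    (Set.singleton_subset_iff.2 (mem_singularLocus_oneBlock hB).1)
  obtain ⟨x, y, h, ⟨r, hx, hy⟩, rfl⟩ := exists_eigenvectors_of_mem_singularLocus hB hp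
  obtain ⟨hx', hy'⟩ := eq_smul_of_eigenvectors_oneBlock h.vec_ne_zero hx hy
  exact h.point_eq_point hB _ hx' hy'

end DoublePoint

theorem singularLocus_diagonal {ι : Type} {B : ι → Matrix (Fin 3) (Fin 3) ℂ}
    (hB : SpansModOne B) {l m : ℂ} (hl : l ≠ 0) (hm : m ≠ 0) (hlm : l ≠ m)
    [(Ideal.span {incidence, bilin !![l, 0, 0; 0, m, 0; 0, 0, 0]}).IsPrime] :
    singularLocus ((Ideal.span {incidence, bilin !![l, 0, 0; 0, m, 0; 0, 0, 0]}).comap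
      (segre B)) = ∅ := by
  refine Set.eq_empty_iff_forall_notMem.2 fun p hp => ?_
  obtain ⟨x, y, h, ⟨r, hx, hy⟩, -⟩ := exists_eigenvectors_of_mem_singularLocus hB hp
  exact dotProduct_ne_zero_of_eigenvectors_diagonal hl hm hlm h.vec_ne_zero h.covec_ne_zero hx hy
    (h.dotProduct_eq_zero (incidence_mem_span _))

/-! ### Reducible sections -/

theorem isPrime_span_incidence_X (s : Fin 3 ⊕ Fin 3) :
    (Ideal.span {incidence, (X s : BiPoly)}).IsPrime :=
  isPrime_span_pair_X (prime_killVar_incidence s)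

theorem span_inf_span_le {s t : Fin 3 ⊕ Fin 3}
    (hst : (X s : BiPoly) ∉ Ideal.span {incidence, (X t : BiPoly)}) :
    Ideal.span {incidence, (X s : BiPoly)} ⊓ Ideal.span {incidence, (X t : BiPoly)} ≤
      Ideal.span {incidence, (X t * X s : BiPoly)} := by
  rintro g ⟨hs, ht⟩
  obtain ⟨a, b, rfl⟩ := Ideal.mem_span_pair.1 hs
  have hbs : b * X s ∈ Ideal.span {incidence, (X t : BiPoly)} :=
    (Submodule.add_mem_iff_right _ (Ideal.mul_mem_left _ a (incidence_mem_span _))).1 ht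
  obtain ⟨c, d, rfl⟩ := Ideal.mem_span_pair.1
    (((isPrime_span_incidence_X t).mem_or_mem hbs).resolve_right hst)
  exact Ideal.mem_span_pair.2 ⟨a + c * X s, d, by ring⟩

theorem isZeroOf_X {s : Fin 3 ⊕ Fin 3} {a b : Fin 3} (hab : a ≠ b) (ha : s ≠ .inl a)
    (hb : s ≠ .inr b) :
    IsZeroOf (Ideal.span {incidence, (X s : BiPoly)}) (Pi.single a 1) (Pi.single b 1) := by
  refine isZeroOf_span_pair (by simp) (by simp) ?_ ?_
  · rw [eval_incidence, single_dotProduct, Pi.single_eq_of_ne hab.symm, mul_zero]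
  · rcases s with s | s
    · have hs : s ≠ a := fun h => ha (by rw [h])
      simp [hs]
    · have hs : s ≠ b := fun h => hb (by rw [h])
      simp [hs]

section Reducible

variable {ι : Type} {B : ι → Matrix (Fin 3) (Fin 3) ℂ}

theorem not_comap_le_comap_of_isZeroOf (hB : SpansModOne B) {I J : Ideal BiPoly}
    (hI : incidence ∈ I) (hJ : incidence ∈ J) {x y : Fin 3 → ℂ} (h : IsZeroOf J x y) {a b : Fin 3}
    (ha : y a ≠ 0) (hb : x b ≠ 0) (hmem : yv a * xv b ∈ I) :
    ¬ I.comap (segre B) ≤ J.comap (segre B) := by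
  intro hle
  obtain ⟨l, -, hl⟩ := exists_linear hB (Matrix.single a b 1)
  rw [bilin_single] at hl
  have hlI : segre B l ∈ I :=
    (Submodule.sub_mem_iff_right _ hmem).1 ((Ideal.span_singleton_le_iff_mem _).2 hI hl)
  have hJmem : yv a * xv b ∈ J :=
    (Submodule.sub_mem_iff_left _ (Ideal.mem_comap.1 (hle hlI))).1
      ((Ideal.span_singleton_le_iff_mem _).2 hJ hl)
  simpa [ha, hb] using h.eval_eq_zero _ hJmem

theorem saturation_comap_span_X_mul_X (hB : SpansModOne B) {s t : Fin 3 ⊕ Fin 3}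
    {x y x' y' : Fin 3 → ℂ} (hs : IsZeroOf (Ideal.span {incidence, (X s : BiPoly)}) x y)
    (ht : IsZeroOf (Ideal.span {incidence, (X t : BiPoly)}) x' y')
    (hst : (X s : BiPoly) ∉ Ideal.span {incidence, (X t : BiPoly)}) :
    saturation ((Ideal.span {incidence, (X t * X s : BiPoly)}).comap (segre B)) =
      (Ideal.span {incidence, (X s : BiPoly)}).comap (segre B) ⊓
        (Ideal.span {incidence, (X t : BiPoly)}).comap (segre B) := by
  have hle {u : Fin 3 ⊕ Fin 3} {x y : Fin 3 → ℂ}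
      (hu : IsZeroOf (Ideal.span {incidence, (X u : BiPoly)}) x y)
      (hmem : (X t * X s : BiPoly) ∈ Ideal.span {incidence, (X u : BiPoly)}) :
      saturation ((Ideal.span {incidence, (X t * X s : BiPoly)}).comap (segre B)) ≤
        (Ideal.span {incidence, (X u : BiPoly)}).comap (segre B) := by
    have := isPrime_span_incidence_X u
    obtain ⟨n, hn⟩ := exists_X_notMem hB (incidence_mem_span _) hu
    refine saturation_le (Ideal.comap_isPrime _ _) (Ideal.comap_mono ?_) hn
    rw [Ideal.span_le, Set.pair_subset_iff]
    exact ⟨incidence_mem_span _, hmem⟩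
  refine le_antisymm (le_inf (hle hs (Ideal.mul_mem_left _ _ (mem_span_incidence _)))
    (hle ht (Ideal.mul_mem_right _ _ (mem_span_incidence _)))) ?_
  rw [← Ideal.comap_inf]
  exact (Ideal.comap_mono (span_inf_span_le hst)).trans (le_saturation _)

end Reducible

/-! ### Differential forms of degree two on a field -/

section Wedge

variable {R M : Type*} [CommRing R] [AddCommGroup M] [Module R M]

/-- The exterior product of two vectors, as a bilinear map. -/
def wedge : M →ₗ[R] M →ₗ[R] ⋀[R]^2 M :=
  LinearMap.mk₂ R (fun a b => exteriorPower.ιMulti R 2 ![a, b])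
    (fun a a' b => (exteriorPower.ιMulti R 2).toMultilinearMap.cons_add ![b] a a')
    (fun c a b => (exteriorPower.ιMulti R 2).toMultilinearMap.cons_smul ![b] c a)
    (fun a b b' =>
      ((exteriorPower.ιMulti R 2).curryLeft a).toMultilinearMap.cons_add ![] b b')
    (fun c a b => ((exteriorPower.ιMulti R 2).curryLeft a).toMultilinearMap.cons_smul ![] c b)

theorem wedge_isAlt : (wedge : M →ₗ[R] M →ₗ[R] ⋀[R]^2 M).IsAlt := fun a =>
  (exteriorPower.ιMulti R 2).map_eq_zero_of_eq ![a, a] (i := 0) (j := 1) rfl (by decide)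

theorem wedge_swap (a b : M) : wedge (R := R) a b = -wedge b a := (wedge_isAlt.neg b a).symm

-- `(ω₁ - ω₀) ∧ (ω₂ - ω₀)` is up to sign independent of the numbering.
theorem exists_units_wedge_sub_sub (ω : Fin 3 → M) {i j k : Fin 3} (hij : i ≠ j) (hik : i ≠ k)
    (hjk : j ≠ k) : ∃ e : ℤˣ, wedge (R := R) (ω k - ω i) (ω j - ω k) =
      (e : ℤ) • wedge (ω 1 - ω 0) (ω 2 - ω 0) := by
  have h₁₀ := wedge_swap (R := R) (ω 1) (ω 0)
  have h₂₀ := wedge_swap (R := R) (ω 2) (ω 0)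
  have h₂₁ := wedge_swap (R := R) (ω 2) (ω 1)
  fin_cases i <;> fin_cases j <;> fin_cases k <;>
    first | exact absurd rfl hij | exact absurd rfl hik | exact absurd rfl hjk | skip
  all_goals
    simp only [map_sub, LinearMap.sub_apply, wedge_isAlt _, Fin.zero_eta, Fin.mk_one,
      Fin.reduceFinMk, h₁₀, h₂₀, h₂₁]
    first
      | (refine ⟨1, ?_⟩; simp only [Units.val_one]; module)
      | (refine ⟨-1, ?_⟩; simp only [Units.val_neg, Units.val_one]; module)

end Wedge

section Forms

open KaehlerDifferential (D)

variable {K : Type} [Field K] [Algebra ℂ K]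

theorem D_mem_span_of_mem_adjoin {R : Subalgebra ℂ K} {S : Set K} (hS : S ⊆ R) {a : K}
    (ha : a ∈ Algebra.adjoin ℂ S) : D ℂ K a ∈ Submodule.span R (D ℂ K '' S) := by
  have hle : Algebra.adjoin ℂ S ≤ R := Algebra.adjoin_le hS
  induction ha using Algebra.adjoin_induction with
  | mem x hx => exact Submodule.subset_span (Set.mem_image_of_mem _ hx)
  | algebraMap r => simp
  | add x y _ _ hx hy => simpa using add_mem hx hy
  | mul x y hx' hy' hx hy =>
    rw [Derivation.leibniz]
    exact add_mem (Submodule.smul_mem _ (⟨x, hle hx'⟩ : R) hy)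
      (Submodule.smul_mem _ (⟨y, hle hy'⟩ : R) hx)

theorem D_mem_of_mul_eq {R : Subalgebra ℂ K} {M : Submodule R Ω[K⁄ℂ]} {z s a : K} (hz : z ∈ R)
    (hs : s ≠ 0) (hsR : s⁻¹ ∈ R) (hzs : z * s = a) (hDs : D ℂ K s ∈ M) (hDa : D ℂ K a ∈ M) :
    D ℂ K z ∈ M := by
  have hsmul : s • D ℂ K z = D ℂ K a - z • D ℂ K s := by
    rw [← hzs, Derivation.leibniz, add_sub_cancel_left]
  rw [← inv_smul_smul₀ hs (D ℂ K z), hsmul]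
  exact M.smul_mem (⟨s⁻¹, hsR⟩ : R) (sub_mem hDa (M.smul_mem (⟨z, hz⟩ : R) hDs))

theorem regularTwoForms_eq_span {R : Subalgebra ℂ K} {u v : K} (hu : u ∈ R) (hv : v ∈ R)
    (hR : ∀ z ∈ R, ∃ a ∈ Algebra.adjoin ℂ {u, v}, ∃ s ∈ Algebra.adjoin ℂ {u, v},
      s ≠ 0 ∧ s⁻¹ ∈ R ∧ z * s = a) :
    regularTwoForms R = Submodule.span R {wedgeD u v} := by
  have huv : {u, v} ⊆ (R : Set K) := Set.pair_subset hu hv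
  have hD (z) (hz : z ∈ R) : ∃ α β : R, α • D ℂ K u + β • D ℂ K v = D ℂ K z := by
    obtain ⟨a, ha, s, hs, hs₀, hsR, h⟩ := hR z hz
    rw [← Submodule.mem_span_pair, ← Set.image_pair]
    exact D_mem_of_mul_eq hz hs₀ hsR h (D_mem_span_of_mem_adjoin huv hs)
      (D_mem_span_of_mem_adjoin huv ha)
  refine le_antisymm (Submodule.span_le.2 ?_)
    ((Submodule.span_singleton_le_iff_mem ..).2 (Submodule.subset_span ⟨u, hu, v, hv, rfl⟩))
  rintro _ ⟨a, ha, b, hb, rfl⟩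
  obtain ⟨α, β, hab⟩ := hD a ha
  obtain ⟨γ, δ, hcd⟩ := hD b hb
  refine Submodule.mem_span_singleton.2 ⟨α * δ - β * γ, ?_⟩
  change ((α : K) * δ - β * γ) • wedge (R := K) (D ℂ K u) (D ℂ K v) = wedge (D ℂ K a) (D ℂ K b)
  rw [← hab, ← hcd]
  simp only [Subalgebra.smul_def, map_add, map_smul, LinearMap.add_apply, LinearMap.smul_apply,
    wedge_isAlt _, wedge_swap (D ℂ K v)]
  module

/-- The logarithmic differential `da / a`. -/
def dlog (a : K) : Ω[K⁄ℂ] := a⁻¹ • D ℂ K a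

theorem dlog_mul {a b : K} (ha : a ≠ 0) (hb : b ≠ 0) : dlog (a * b) = dlog a + dlog b := by
  rw [dlog, dlog, dlog, Derivation.leibniz, smul_add, smul_smul, smul_smul, add_comm]
  congr 2 <;> field_simp

theorem dlog_algebraMap (c : ℂ) : dlog (algebraMap ℂ K c) = 0 := by simp [dlog]

theorem dlog_one : dlog (1 : K) = 0 := by simp [dlog]

theorem wedgeD_eq_smul {a b : K} (ha : a ≠ 0) (hb : b ≠ 0) :
    wedgeD a b = (a * b) • wedge (dlog a) (dlog b) := by
  have hD {c : K} (hc : c ≠ 0) : D ℂ K c = c • dlog c := (smul_inv_smul₀ hc _).symm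
  change wedge (D ℂ K a) (D ℂ K b) = _
  rw [hD ha, hD hb, map_smul, map_smul, LinearMap.smul_apply, smul_smul, mul_comm]

end Forms

/-! ### The canonical sheaf of the nonsingular sections -/

section CoordinateMap

variable {ι : Type} {B : ι → Matrix (Fin 3) (Fin 3) ℂ} {q : BiPoly} {i j : Fin 3}

/-- `χ` expresses the functions on the chart `xᵢ = 1`, `yⱼ = 1` of the section `q = 0` of the flag
variety as rational functions on the projective image of that section. -/
structure IsCoordinateMap (hB : SpansModOne B) (q : BiPoly) [(Ideal.span {incidence, q}).IsPrime]
    (i j : Fin 3)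
    (χ : BiPoly →ₐ[ℂ] FunctionField ((Ideal.span {incidence, q}).comap (segre B))) : Prop where
  ker_eq : RingHom.ker χ = chartIdeal q i j
  mul_map_segre {c : FunctionField ((Ideal.span {incidence, q}).comap (segre B))}
    {f g : MvPolynomial ι ℂ} (hc : IsFraction _ c f g)
    (hg : g ∉ (Ideal.span {incidence, q}).comap (segre B)) : c * χ (segre B g) = χ (segre B f)
  mem_localRing_iff {x y : Fin 3 → ℂ} (h : IsZeroOf (Ideal.span {incidence, q}) x y)
    (hi : x i = 1) (hj : y j = 1)
    {z : FunctionField ((Ideal.span {incidence, q}).comap (segre B))} :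
    z ∈ localRing _ (h.point hB) ↔ ∃ a s, eval (Sum.elim x y) s ≠ 0 ∧ z * χ s = χ a

theorem exists_isCoordinateMap (hB : SpansModOne B) (hq : q ∈ biPart (1, 1))
    [(Ideal.span {incidence, q}).IsPrime] (hi : xv i ∉ Ideal.span {incidence, q})
    (hj : yv j ∉ Ideal.span {incidence, q}) : ∃ χ, IsCoordinateMap hB q i j χ := by
  have hψ := Ideal.Quotient.mkₐ_surjective ℂ (chartIdeal q i j)
  set ψ := Ideal.Quotient.mkₐ ℂ (chartIdeal q i j)
  have hker : RingHom.ker ψ = chartIdeal q i j := Ideal.Quotient.mkₐ_ker ℂ _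
  obtain ⟨l, hl⟩ := exists_isChart hB hq hi hj hψ hker
  obtain ⟨κ, hκ, hκl⟩ := hl.exists_embedding
  refine ⟨κ.comp ψ, ?_, fun {c f g} hc hg => ?_, fun {x y} h hxi hyj z => ?_⟩
  · ext a
    rw [RingHom.mem_ker, AlgHom.comp_apply, map_eq_zero_iff κ hκ, ← RingHom.mem_ker, hker]
  · obtain ⟨⟨n, hf, hg'⟩, hc⟩ := hc
    change c * κ ((ψ.comp (segre B)) g) = κ ((ψ.comp (segre B)) f)
    have hg₀ := mt (toConeField_eq_zero_iff _).1 hg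
    have hl₀ := mt (toConeField_eq_zero_iff _).1 hl.notMem
    rw [hκl, hκl]
    refine incl_injective _ ?_
    rw [map_mul, incl_dehom _ _ hg', incl_dehom _ _ hf, hc]
    field_simp
  · let ev := Ideal.Quotient.liftₐ (chartIdeal q i j) (aeval (Sum.elim x y))
      fun _ ha => h.chartIdeal_le_ker hxi hyj ha
    have hev (f) : ev ((ψ.comp (segre B)) f) = eval (segrePoint B x y) f := eval_segre x y f
    constructor
    · intro hz
      obtain ⟨a, s, hs, hz⟩ :=
        hl.exists_mul_eq_of_mem_localRing hev (h.segrePoint_ne_zero hB) hκl hz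
      obtain ⟨a, rfl⟩ := hψ a
      obtain ⟨s, rfl⟩ := hψ s
      exact ⟨a, s, hs, hz⟩
    · rintro ⟨a, s, hs, hz⟩
      exact hl.mem_localRing_of_mul_eq hev (h.segrePoint_ne_zero hB) hκ hκl (a := ψ a) (s := ψ s)
        hs hz

namespace IsCoordinateMap

variable {hB : SpansModOne B} [(Ideal.span {incidence, q}).IsPrime]
  {χ : BiPoly →ₐ[ℂ] FunctionField ((Ideal.span {incidence, q}).comap (segre B))}
  {x y : Fin 3 → ℂ}

theorem map_eq_zero (hχ : IsCoordinateMap hB q i j χ) {f : BiPoly}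
    (hf : f ∈ Ideal.span {incidence, q}) : χ f = 0 := by
  rw [← RingHom.mem_ker, hχ.ker_eq]
  exact span_le_chartIdeal q i j hf

theorem map_ne_zero (hχ : IsCoordinateMap hB q i j χ)
    (h : IsZeroOf (Ideal.span {incidence, q}) x y) (hi : x i = 1) (hj : y j = 1) {s : BiPoly}
    (hs : eval (Sum.elim x y) s ≠ 0) : χ s ≠ 0 := fun h₀ =>
  hs (h.chartIdeal_le_ker hi hj (hχ.ker_eq ▸ RingHom.mem_ker.2 h₀))

theorem map_mem_localRing (hχ : IsCoordinateMap hB q i j χ)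
    (h : IsZeroOf (Ideal.span {incidence, q}) x y) (hi : x i = 1) (hj : y j = 1) (a : BiPoly) :
    χ a ∈ localRing _ (h.point hB) :=
  (hχ.mem_localRing_iff h hi hj).2 ⟨a, 1, by simp, by simp⟩

theorem inv_map_mem_localRing (hχ : IsCoordinateMap hB q i j χ)
    (h : IsZeroOf (Ideal.span {incidence, q}) x y) (hi : x i = 1) (hj : y j = 1) {s : BiPoly}
    (hs : eval (Sum.elim x y) s ≠ 0) : (χ s)⁻¹ ∈ localRing _ (h.point hB) :=
  (hχ.mem_localRing_iff h hi hj).2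
    ⟨1, s, hs, by rw [inv_mul_cancel₀ (hχ.map_ne_zero h hi hj hs), map_one]⟩

end IsCoordinateMap

end CoordinateMap

theorem span_singleton_smul_eq_of_inv_mem {K : Type} [Field K] [Algebra ℂ K] {R : Subalgebra ℂ K}
    {r : K} (hr : r ∈ R) (hr' : r⁻¹ ∈ R) (h₀ : r ≠ 0) (w : TwoForms K) :
    Submodule.span R {r • w} = Submodule.span R {w} := by
  have hunit : IsUnit (⟨r, hr⟩ : R) :=
    IsUnit.of_mul_eq_one ⟨r⁻¹, hr'⟩ (Subtype.ext (mul_inv_cancel₀ h₀))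
  exact Submodule.span_singleton_smul_eq hunit w

section ConstantRatios

variable {K : Type} [Field K] [Algebra ℂ K] {x y : Fin 3 → K} {c : Fin 3 → ℂ} {t : K}
  {i j k : Fin 3}

theorem mem_adjoin_of_mul_eq (hc : ∀ a, c a ≠ 0) (hxy : ∀ a, x a * y a = algebraMap ℂ K (c a) * t)
    (hij : i ≠ j) (hik : i ≠ k) (hjk : j ≠ k) (hi : x i = 1) (hj : y j = 1) (a : Fin 3) :
    x a ∈ Algebra.adjoin ℂ {x k, y k} := by
  have hx : x k ∈ Algebra.adjoin ℂ {x k, y k} := Algebra.subset_adjoin (by simp)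
  have hy : y k ∈ Algebra.adjoin ℂ {x k, y k} := Algebra.subset_adjoin (by simp)
  obtain rfl | rfl | rfl : a = k ∨ a = i ∨ a = j := by omega
  · exact hx
  · rw [hi]
    exact one_mem _
  · have h : x a = algebraMap ℂ K (c a * (c k)⁻¹) * (x k * y k) := by
      rw [hxy, ← mul_assoc, ← map_mul, inv_mul_cancel_right₀ (hc k), ← hxy, hj, mul_one]
    rw [h]
    exact mul_mem (Subalgebra.algebraMap_mem _ _) (mul_mem hx hy)

-- `dlog xₐ + dlog yₐ` is independent of `a`, so `dlog yₖ = dlog xⱼ - dlog xₖ`.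
theorem exists_units_wedgeD_eq (hc : ∀ a, c a ≠ 0)
    (hxy : ∀ a, x a * y a = algebraMap ℂ K (c a) * t) (ht : t ≠ 0) (hij : i ≠ j) (hik : i ≠ k)
    (hjk : j ≠ k) (hi : x i = 1) (hj : y j = 1) :
    ∃ e : ℤˣ, wedgeD (x k) (y k) = algebraMap ℂ K (c k * (e : ℤ)) •
      t • wedge (dlog (x 1) - dlog (x 0)) (dlog (x 2) - dlog (x 0)) := by
  have hc' (a) : algebraMap ℂ K (c a) ≠ 0 := (map_ne_zero _).2 (hc a)
  have hne (a) : x a * y a ≠ 0 := by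
    rw [hxy]
    exact mul_ne_zero (hc' a) ht
  have hadd (a) : dlog (x a) + dlog (y a) = dlog t := by
    rw [← dlog_mul (left_ne_zero_of_mul (hne a)) (right_ne_zero_of_mul (hne a)), hxy,
      dlog_mul (hc' a) ht, dlog_algebraMap, zero_add]
  have hu : dlog (x k) = dlog (x k) - dlog (x i) := by rw [hi, dlog_one, sub_zero]
  have hv : dlog (y k) = dlog (x j) - dlog (x k) := by
    rw [eq_sub_iff_add_eq', hadd, ← hadd j, hj, dlog_one, add_zero]
  obtain ⟨e, he⟩ := exists_units_wedge_sub_sub (R := K) (fun a => dlog (x a)) hij hik hjk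
  refine ⟨e, ?_⟩
  rw [wedgeD_eq_smul (left_ne_zero_of_mul (hne k)) (right_ne_zero_of_mul (hne k)), hu, hv, he,
    hxy, ← Int.cast_smul_eq_zsmul K, smul_smul, smul_smul, map_mul, map_intCast]
  congr 1
  ring

theorem range_le_adjoin {χ : BiPoly →ₐ[ℂ] K} (hc : ∀ a, c a ≠ 0)
    (hxy : ∀ a, χ (xv a) * χ (yv a) = algebraMap ℂ K (c a) * t) (hij : i ≠ j) (hik : i ≠ k)
    (hjk : j ≠ k) (hi : χ (xv i) = 1) (hj : χ (yv j) = 1) :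
    χ.range ≤ Algebra.adjoin ℂ {χ (xv k), χ (yv k)} := by
  have hrange : χ.range = Algebra.adjoin ℂ (Set.range fun s => χ (X s)) := by
    rw [Algebra.adjoin_range_eq_range_aeval]
    exact congr_arg AlgHom.range (aeval_unique χ)
  rw [hrange, Algebra.adjoin_le_iff]
  rintro _ ⟨a | a, rfl⟩
  · exact mem_adjoin_of_mul_eq hc hxy hij hik hjk hi hj a
  · rw [Set.pair_comm]
    exact mem_adjoin_of_mul_eq hc (fun a => (mul_comm _ _).trans (hxy a)) hij.symm hjk hik hj hi a

theorem regularTwoForms_eq_span_smul_wedge {χ : BiPoly →ₐ[ℂ] K} {R : Subalgebra ℂ K}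
    (hc : ∀ a, c a ≠ 0) (hxy : ∀ a, χ (xv a) * χ (yv a) = algebraMap ℂ K (c a) * t) (ht : t ≠ 0)
    (hij : i ≠ j) (hi : χ (xv i) = 1) (hj : χ (yv j) = 1) (hR : ∀ a, χ a ∈ R)
    (hR' : ∀ z ∈ R, ∃ a s, χ s ≠ 0 ∧ (χ s)⁻¹ ∈ R ∧ z * χ s = χ a) :
    regularTwoForms R = Submodule.span R {t •
      wedge (dlog (χ (xv 1)) - dlog (χ (xv 0))) (dlog (χ (xv 2)) - dlog (χ (xv 0)))} := by
  obtain ⟨k, hik, hjk⟩ := (by decide : ∀ i j : Fin 3, ∃ k, i ≠ k ∧ j ≠ k) i j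
  have hadj (a) : χ a ∈ Algebra.adjoin ℂ {χ (xv k), χ (yv k)} :=
    range_le_adjoin hc hxy hij hik hjk hi hj ⟨a, rfl⟩
  obtain ⟨e, he⟩ := exists_units_wedgeD_eq (x := fun a => χ (xv a)) hc hxy ht hij hik hjk hi hj
  rw [regularTwoForms_eq_span (hR (xv k)) (hR (yv k)) fun z hz => ?_, he,
    span_singleton_smul_eq_of_inv_mem]
  · exact Subalgebra.algebraMap_mem _ _
  · rw [← map_inv₀]
    exact Subalgebra.algebraMap_mem _ _
  · exact (map_ne_zero _).2 (mul_ne_zero (hc k) (Int.cast_ne_zero.2 e.ne_zero))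
  · obtain ⟨a, s, hs, hs', hz⟩ := hR' z hz
    exact ⟨χ a, hadj a, χ s, hadj s, hs, hs', hz⟩

theorem span_smul_wedge_eq {R : Subalgebra ℂ K} {ξ : Fin 3 → K} {r z : K} (hx : ∀ k, x k ≠ 0)
    (hξ : ∀ k, ξ k * x 0 = x k) (hr : r ∈ R) (hr' : r⁻¹ ∈ R) (hr₀ : r ≠ 0) (hz : z * r = t) :
    Submodule.span R
      {(t • wedge (dlog (x 1) - dlog (x 0)) (dlog (x 2) - dlog (x 0)) : TwoForms K)} =
      Submodule.span R {(z • wedge (dlog (ξ 1)) (dlog (ξ 2)) : TwoForms K)} := by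
  have hdlog (k) : dlog (x k) - dlog (x 0) = dlog (ξ k) := by
    have hξ₀ : ξ k * x 0 ≠ 0 := hξ k ▸ hx k
    rw [← hξ, dlog_mul (left_ne_zero_of_mul hξ₀) (hx 0), add_sub_cancel_right]
  rw [hdlog, hdlog, ← hz, mul_comm, mul_smul, span_singleton_smul_eq_of_inv_mem hr hr' hr₀]

end ConstantRatios

section Torus

variable {N : Matrix (Fin 3) (Fin 3) ℂ} {c : Fin 3 → ℂ} {ι : Type}
  {B : ι → Matrix (Fin 3) (Fin 3) ℂ} {i j : Fin 3} {x y : Fin 3 → ℂ}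

theorem IsZeroOf.smul_covec (h : IsZeroOf (Ideal.span {incidence, bilin N}) x y) {a : ℂ}
    (ha : a ≠ 0) : IsZeroOf (Ideal.span {incidence, bilin N}) x (a • y) := by
  refine isZeroOf_span_pair h.vec_ne_zero (smul_ne_zero ha h.covec_ne_zero) ?_ ?_
  · rw [eval_incidence, smul_dotProduct, h.dotProduct_eq_zero (incidence_mem_span _), smul_zero]
  · have hN := h.eval_eq_zero _ (mem_span_incidence _)
    rw [eval_bilin] at hN ⊢
    rw [smul_dotProduct, hN, smul_zero]

theorem exists_isZeroOf_ne_of_mem_points (hB : SpansModOne B) (hc : ∀ k, c k ≠ 0)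
    (hN : ∀ k, xv k * yv k - C (c k) * (xv 0 * yv 0) ∈ Ideal.span {incidence, bilin N})
    {p : ℙ ℂ (ι → ℂ)} (hp : p ∈ points ((Ideal.span {incidence, bilin N}).comap (segre B))) :
    ∃ x y, ∃ h : IsZeroOf (Ideal.span {incidence, bilin N}) x y,
      (∃ i j, i ≠ j ∧ x i = 1 ∧ y j = 1) ∧ p = h.point hB := by
  obtain ⟨x, y, h, ⟨i, hi⟩, ⟨j, hj⟩, rfl⟩ := exists_isZeroOf_of_mem_points hB hp
  obtain hij | rfl := ne_or_eq i j
  · exact ⟨x, y, h, ⟨i, j, hij, hi, hj⟩, rfl⟩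
  have hk (k) : x k * y k = c k * (x 0 * y 0) := by
    simpa [sub_eq_zero] using h.eval_eq_zero _ (hN k)
  have h₀ : x 0 * y 0 ≠ 0 := fun h₀ => by simpa [h₀, hi, hj] using hk i
  obtain ⟨j, hij⟩ := exists_ne i
  have hyj : y j ≠ 0 := right_ne_zero_of_mul (a := x j) <| by
    rw [hk]
    exact mul_ne_zero (hc j) h₀
  refine ⟨x, (y j)⁻¹ • y, h.smul_covec (inv_ne_zero hyj), ⟨i, j, hij.symm, hi, ?_⟩, ?_⟩
  · simp [hyj]
  · exact h.point_eq_point hB _ (one_smul ℂ x).symm (smul_inv_smul₀ hyj y).symm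

variable [(Ideal.span {incidence, bilin N}).IsPrime] {hB : SpansModOne B}
  {χ : BiPoly →ₐ[ℂ] FunctionField ((Ideal.span {incidence, bilin N}).comap (segre B))}

theorem IsCoordinateMap.map_xv_mul_yv_ne_zero (hχ : IsCoordinateMap hB (bilin N) i j χ)
    (h₀ : xv 0 * yv 0 ∉ Ideal.span {incidence, bilin N})
    (h : IsZeroOf (Ideal.span {incidence, bilin N}) x y) (hi : x i = 1) (hj : y j = 1) :
    χ (xv 0) * χ (yv 0) ≠ 0 := by
  rw [← map_mul, Ne, ← RingHom.mem_ker, hχ.ker_eq]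
  exact mt (mem_of_mem_chartIdeal (bilin_mem _) (h.xv_notMem (hi ▸ one_ne_zero))
    (h.yv_notMem (hj ▸ one_ne_zero)) ((xv_mem 0).mul (yv_mem 0))) h₀

theorem IsCoordinateMap.map_xv_mul_yv (hχ : IsCoordinateMap hB (bilin N) i j χ)
    (hN : ∀ k, xv k * yv k - C (c k) * (xv 0 * yv 0) ∈ Ideal.span {incidence, bilin N})
    (k : Fin 3) : χ (xv k) * χ (yv k) = algebraMap ℂ _ (c k) * (χ (xv 0) * χ (yv 0)) := by
  simpa only [map_sub, map_mul, algHom_C, sub_eq_zero] using hχ.map_eq_zero (hN k)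

theorem IsCoordinateMap.regularTwoForms_eq (hχ : IsCoordinateMap hB (bilin N) i j χ)
    (hc : ∀ k, c k ≠ 0)
    (hN : ∀ k, xv k * yv k - C (c k) * (xv 0 * yv 0) ∈ Ideal.span {incidence, bilin N})
    (h₀ : xv 0 * yv 0 ∉ Ideal.span {incidence, bilin N})
    (h : IsZeroOf (Ideal.span {incidence, bilin N}) x y) (hij : i ≠ j) (hi : x i = 1)
    (hj : y j = 1) :
    regularTwoForms (localRing _ (h.point hB)) = Submodule.span (localRing _ (h.point hB))
      {(χ (xv 0) * χ (yv 0)) •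
        wedge (dlog (χ (xv 1)) - dlog (χ (xv 0))) (dlog (χ (xv 2)) - dlog (χ (xv 0)))} := by
  refine regularTwoForms_eq_span_smul_wedge hc (hχ.map_xv_mul_yv hN)
    (hχ.map_xv_mul_yv_ne_zero h₀ h hi hj) hij (map_xv_eq_one hχ.ker_eq)
    (map_yv_eq_one hχ.ker_eq) (hχ.map_mem_localRing h hi hj) fun z hz => ?_
  obtain ⟨a, s, hs, hz⟩ := (hχ.mem_localRing_iff h hi hj).1 hz
  exact ⟨a, s, hχ.map_ne_zero h hi hj hs, hχ.inv_map_mem_localRing h hi hj hs, hz⟩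

theorem IsCoordinateMap.map_segre {L : Fin 3 → MvPolynomial ι ℂ}
    (hχ : IsCoordinateMap hB (bilin N) i j χ)
    (hL : ∀ k, yv 0 * xv k - segre B (L k) ∈ Ideal.span {incidence, bilin N}) (k : Fin 3) :
    χ (segre B (L k)) = χ (yv 0) * χ (xv k) := by
  rw [← map_mul, eq_comm, ← sub_eq_zero, ← map_sub]
  exact hχ.map_eq_zero (hL k)

theorem IsCoordinateMap.mul_map_xv_eq {L : Fin 3 → MvPolynomial ι ℂ}
    (hχ : IsCoordinateMap hB (bilin N) i j χ)
    (hL : ∀ k, yv 0 * xv k - segre B (L k) ∈ Ideal.span {incidence, bilin N})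
    (hL₀ : L 0 ∉ (Ideal.span {incidence, bilin N}).comap (segre B)) (h₀ : χ (yv 0) ≠ 0)
    {k : Fin 3} {z : FunctionField ((Ideal.span {incidence, bilin N}).comap (segre B))}
    (hz : IsFraction _ z (L k) (L 0)) : z * χ (xv 0) = χ (xv k) := by
  have hmul := hχ.mul_map_segre hz hL₀
  rw [hχ.map_segre hL, hχ.map_segre hL, mul_left_comm] at hmul
  exact mul_left_cancel₀ h₀ hmul

theorem IsCoordinateMap.regularTwoForms_eq_span_smul (hχ : IsCoordinateMap hB (bilin N) i j χ)
    (hc : ∀ k, c k ≠ 0)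
    (hN : ∀ k, xv k * yv k - C (c k) * (xv 0 * yv 0) ∈ Ideal.span {incidence, bilin N})
    (h₀ : xv 0 * yv 0 ∉ Ideal.span {incidence, bilin N})
    (h : IsZeroOf (Ideal.span {incidence, bilin N}) x y) (hij : i ≠ j) (hi : x i = 1)
    (hj : y j = 1) {z : FunctionField ((Ideal.span {incidence, bilin N}).comap (segre B))}
    {ξ : Fin 3 → FunctionField ((Ideal.span {incidence, bilin N}).comap (segre B))}
    (hξ : ∀ k, ξ k * χ (xv 0) = χ (xv k)) {s : BiPoly} (hs : eval (Sum.elim x y) s ≠ 0)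
    (hz : z * χ s = χ (xv 0) * χ (yv 0)) :
    regularTwoForms (localRing _ (h.point hB)) =
      Submodule.span (localRing _ (h.point hB)) {z • wedge (dlog (ξ 1)) (dlog (ξ 2))} := by
  have hne (k) : χ (xv k) * χ (yv k) ≠ 0 := by
    rw [hχ.map_xv_mul_yv hN]
    exact mul_ne_zero ((_root_.map_ne_zero _).2 (hc k)) (hχ.map_xv_mul_yv_ne_zero h₀ h hi hj)
  exact (hχ.regularTwoForms_eq hc hN h₀ h hij hi hj).trans <|
    span_smul_wedge_eq (x := fun k => χ (xv k)) (fun k => left_ne_zero_of_mul (hne k)) hξ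
      (hχ.map_mem_localRing h hi hj s) (hχ.inv_map_mem_localRing h hi hj hs)
      (hχ.map_ne_zero h hi hj hs) hz

theorem canonicalIsMinusOne_of_sub_mem (hB : SpansModOne B) (hc : ∀ k, c k ≠ 0)
    (hN : ∀ k, xv k * yv k - C (c k) * (xv 0 * yv 0) ∈ Ideal.span {incidence, bilin N})
    (h₀ : xv 0 * yv 0 ∉ Ideal.span {incidence, bilin N}) :
    CanonicalIsMinusOne ((Ideal.span {incidence, bilin N}).comap (segre B)) := by
  set P := (Ideal.span {incidence, bilin N}).comap (segre B)
  choose L hL hLmem using fun k => exists_linear hB (Matrix.single 0 k 1)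
  simp only [bilin_single] at hLmem
  replace hLmem k := span_incidence_le (bilin N) (hLmem k)
  have hL₀ : L 0 ∉ P := fun hL₀ => h₀ <| by
    rw [mul_comm]
    exact (Submodule.sub_mem_iff_left _ (Ideal.mem_comap.1 hL₀)).1 (hLmem 0)
  choose ξ hξ using fun k => exists_isFraction P (hL k) (hL 0) hL₀
  refine ⟨L 0, hL 0, hL₀, wedge (dlog (ξ 1)) (dlog (ξ 2)), fun p hp g hg hgp z hz => ?_⟩
  by_contra hne
  obtain ⟨x, y, h, ⟨i, j, hij, hi, hj⟩, rfl⟩ := exists_isZeroOf_ne_of_mem_points hB hc hN hp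
  obtain ⟨χ, hχ⟩ := exists_isCoordinateMap hB (bilin_mem _) (h.xv_notMem (hi ▸ one_ne_zero))
    (h.yv_notMem (hj ▸ one_ne_zero))
  have hχ₀ := hχ.map_xv_mul_yv_ne_zero h₀ h hi hj
  have hgs : eval (Sum.elim x y) (segre B g) ≠ 0 := by
    rw [eval_segre]
    exact mt (mem_vanishingIdeal_mk (h.segrePoint_ne_zero hB) hg).2 hgp
  have hξχ (k) : ξ k * χ (xv 0) = χ (xv k) :=
    hχ.mul_map_xv_eq hLmem hL₀ (right_ne_zero_of_mul hχ₀) (hξ k)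
  refine hne (hχ.regularTwoForms_eq_span_smul hc hN h₀ h hij hi hj hξχ hgs ?_)
  rw [hχ.mul_map_segre hz fun hgP => hgp (hp hgP), hχ.map_segre hLmem, mul_comm]

end Torus

section Diagonal

variable {l m : ℂ}

/-- The constants `xₖ yₖ / (x₀ y₀)` on the section given by the diagonal matrix with entries
`l`, `m`, `0`. -/
def ratios (l m : ℂ) : Fin 3 → ℂ := ![1, -(l / m), l / m - 1]

theorem ratios_ne_zero (hl : l ≠ 0) (hm : m ≠ 0) (hlm : l ≠ m) (k : Fin 3) :
    ratios l m k ≠ 0 := by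
  fin_cases k
  · exact one_ne_zero
  · exact neg_ne_zero.2 (div_ne_zero hl hm)
  · exact sub_ne_zero.2 fun h => hlm ((div_eq_one_iff_eq hm).1 h)

theorem bilin_diagonal (l m : ℂ) : bilin !![l, 0, 0; 0, m, 0; 0, 0, 0] =
    C l * (xv 0 * yv 0) + C m * (xv 1 * yv 1) := by
  simp [bilin_apply, Fin.sum_univ_three]
  ring

theorem xv_mul_yv_sub_mem (hm : m ≠ 0) (k : Fin 3) :
    xv k * yv k - C (ratios l m k) * (xv 0 * yv 0) ∈
      Ideal.span {incidence, bilin !![l, 0, 0; 0, m, 0; 0, 0, 0]} := by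
  have hC : (C m⁻¹ * C m : BiPoly) = 1 := by rw [← C_mul, inv_mul_cancel₀ hm, C_1]
  rw [Ideal.mem_span_pair, incidence_eq, bilin_diagonal]
  fin_cases k
  · exact ⟨0, 0, by simp [ratios]⟩
  · refine ⟨0, C m⁻¹, ?_⟩
    simp only [ratios, div_eq_mul_inv, Fin.mk_one, Matrix.cons_val_one, Matrix.cons_val_zero,
      C_neg, C_mul]
    linear_combination xv 1 * yv 1 * hC
  · refine ⟨1, -C m⁻¹, ?_⟩
    simp only [ratios, div_eq_mul_inv, Fin.reduceFinMk, Matrix.cons_val, C_sub, C_mul, C_1]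
    linear_combination -(xv 1 * yv 1) * hC

theorem isZeroOf_diagonal (hm : m ≠ 0) :
    IsZeroOf (Ideal.span {incidence, bilin !![l, 0, 0; 0, m, 0; 0, 0, 0]}) 1 (ratios l m) := by
  refine isZeroOf_span_pair one_ne_zero (fun h => one_ne_zero (congr_fun h 0)) ?_ ?_
  · simp [incidence_eq, ratios]
    ring
  · simp [bilin_diagonal, ratios]
    field_simp
    ring

theorem canonicalIsMinusOne_diagonal {ι : Type} {B : ι → Matrix (Fin 3) (Fin 3) ℂ}
    [(Ideal.span {incidence, bilin !![l, 0, 0; 0, m, 0; 0, 0, 0]}).IsPrime] (hB : SpansModOne B)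
    (hl : l ≠ 0) (hm : m ≠ 0) (hlm : l ≠ m) :
    CanonicalIsMinusOne ((Ideal.span {incidence, bilin !![l, 0, 0; 0, m, 0; 0, 0, 0]}).comap
      (segre B)) :=
  canonicalIsMinusOne_of_sub_mem hB (ratios_ne_zero hl hm hlm) (xv_mul_yv_sub_mem hm) fun h => by
    simpa [ratios] using (isZeroOf_diagonal hm).eval_eq_zero _ h

end Diagonal

/-! ### Hyperplane sections -/

theorem not_isPrime_radical_inf {R : Type*} [CommSemiring R] {P Q : Ideal R} [P.IsPrime]
    [Q.IsPrime] (hPQ : ¬ P ≤ Q) (hQP : ¬ Q ≤ P) : ¬ (P ⊓ Q).radical.IsPrime := by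
  intro h
  rw [Ideal.radical_inf, Ideal.IsPrime.radical ‹_›, Ideal.IsPrime.radical ‹_›] at h
  obtain hle | hle := h.inf_le.1 le_rfl
  · exact hPQ (hle.trans inf_le_right)
  · exact hQP (hle.trans inf_le_left)

section Section

variable {ι : Type}

/-- `I` is the ideal of an integral surface of degree six that spans a `ℙ⁶` and is a nonsingular
Del Pezzo surface or has exactly one singular point, of multiplicity two: the irreducible case of
the classification of hyperplane sections. -/
def IsIntegralSextic (I : Ideal (MvPolynomial ι ℂ)) : Prop :=
  ∃ _ : I.IsPrime, IsIrreducibleSurface I 6 ∧ SpansDim I 6 ∧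
    (IsNonsingularDelPezzo I 6 ∨ ∃ p, singularLocus I = {p} ∧ HasMultiplicityAt I p 2)

/-- `I` is the ideal of a union of two integral surfaces of degree three, neither of which contains
the other: the reducible case of the classification of hyperplane sections. -/
def IsCubicPair (I : Ideal (MvPolynomial ι ℂ)) : Prop :=
  ∃ P₁ P₂ : Ideal (MvPolynomial ι ℂ), ¬ P₁ ≤ P₂ ∧ ¬ P₂ ≤ P₁ ∧
    IsIrreducibleSurface P₁ 3 ∧ IsIrreducibleSurface P₂ 3 ∧ I = P₁ ⊓ P₂

variable {B : ι → Matrix (Fin 3) (Fin 3) ℂ} {q : BiPoly}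

theorem saturation_comap_of_isPrime (hB : SpansModOne B) [(Ideal.span {incidence, q}).IsPrime]
    {x y : Fin 3 → ℂ} (h : IsZeroOf (Ideal.span {incidence, q}) x y) :
    saturation ((Ideal.span {incidence, q}).comap (segre B)) =
      (Ideal.span {incidence, q}).comap (segre B) := by
  obtain ⟨i, hi⟩ := exists_X_notMem hB (incidence_mem_span q) h
  exact le_antisymm (saturation_le (Ideal.comap_isPrime _ _) le_rfl hi) (le_saturation _)

theorem not_incidence_dvd (hq : eval (Sum.elim ![1, 1, 0] ![1, -1, 0]) q ≠ 0) :
    ¬ incidence ∣ q :=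
  not_dvd_of_eval_ne_zero (Sum.elim ![1, 1, 0] ![1, -1, 0]) (by simp [incidence_eq]) hq

theorem not_killVar_incidence_dvd (hq : eval (Sum.elim ![1, 1, 0] ![1, -1, 0]) q ≠ 0) :
    ¬ killVar (.inl 2) incidence ∣ killVar (.inl 2) q := by
  refine not_dvd_of_eval_ne_zero (Sum.elim ![1, 1, 0] ![1, -1, 0]) ?_ ?_ <;>
    rw [eval_killVar (by simp)]
  · simp [incidence_eq]
  · exact hq

theorem isIntegralSextic_saturation (hB : SpansModOne B) (hq : q ∈ biPart (1, 1))
    (hdvd : ¬ incidence ∣ q) [hJ : (Ideal.span {incidence, q}).IsPrime] {x y : Fin 3 → ℂ}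
    (h : IsZeroOf (Ideal.span {incidence, q}) x y)
    (hsing : singularLocus ((Ideal.span {incidence, q}).comap (segre B)) = ∅ ∧
        CanonicalIsMinusOne ((Ideal.span {incidence, q}).comap (segre B)) ∨
      ∃ p, singularLocus ((Ideal.span {incidence, q}).comap (segre B)) = {p} ∧
        HasMultiplicityAt ((Ideal.span {incidence, q}).comap (segre B)) p 2) :
    IsIntegralSextic (saturation ((Ideal.span {incidence, q}).comap (segre B))) := by
  rw [saturation_comap_of_isPrime hB h]
  have hsurf := isIrreducibleSurface_six hB hq hdvd hJ
  have hspan := spansDim_six hB hq hdvd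
  exact ⟨inferInstance, hsurf, hspan, hsing.imp_left fun ⟨hs, hc⟩ => ⟨hsurf, hspan, hs, hc⟩⟩

theorem isIntegralSextic_diagonal (hB : SpansModOne B) {l m : ℂ} (hl : l ≠ 0) (hm : m ≠ 0)
    (hlm : l ≠ m) :
    IsIntegralSextic (saturation
      ((Ideal.span {incidence, bilin !![l, 0, 0; 0, m, 0; 0, 0, 0]}).comap (segre B))) := by
  have hne : eval (Sum.elim ![1, 1, 0] ![1, -1, 0])
      (C l * (xv 0 * yv 0) + C m * (xv 1 * yv 1) : BiPoly) ≠ 0 := by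
    simpa [← sub_eq_add_neg, sub_eq_zero] using hlm
  have hJ := isPrime_span_incidence_two_terms (by decide) hl hm (not_killVar_incidence_dvd hne)
  rw [← bilin_diagonal] at hne hJ
  exact isIntegralSextic_saturation hB (bilin_mem _) (not_incidence_dvd hne) (isZeroOf_diagonal hm)
    (.inl ⟨singularLocus_diagonal hB hl hm hlm, canonicalIsMinusOne_diagonal hB hl hm hlm⟩)

theorem isIntegralSextic_twoBlocks (hB : SpansModOne B) {l : ℂ} (hl : l ≠ 0) :
    IsIntegralSextic (saturation
      ((Ideal.span {incidence, bilin !![l, 0, 0; 0, 0, 1; 0, 0, 0]}).comap (segre B))) := by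
  have hne : eval (Sum.elim ![1, 1, 0] ![1, -1, 0])
      (C l * (xv 0 * yv 0) + C 1 * (xv 2 * yv 1) : BiPoly) ≠ 0 := by
    simpa using hl
  have hJ := isPrime_span_incidence_two_terms (by decide) hl one_ne_zero
    (not_killVar_incidence_dvd hne)
  rw [C_1, one_mul, ← bilin_twoBlocks] at hne hJ
  exact isIntegralSextic_saturation hB (bilin_mem _) (not_incidence_dvd hne) (isZeroOf_twoBlocks l)
    (.inr ⟨_, singularLocus_twoBlocks hB hl, (mem_singularLocus_twoBlocks hB hl).2⟩)

theorem isIntegralSextic_oneBlock (hB : SpansModOne B) :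
    IsIntegralSextic (saturation
      ((Ideal.span {incidence, bilin !![0, 1, 0; 0, 0, 1; 0, 0, 0]}).comap (segre B))) := by
  have hne : eval (Sum.elim ![1, 1, 0] ![1, -1, 0])
      (C 1 * (xv 1 * yv 0) + C 1 * (xv 2 * yv 1) : BiPoly) ≠ 0 := by
    simp
  have hJ := isPrime_span_incidence_two_terms (by decide) one_ne_zero one_ne_zero
    (not_killVar_incidence_dvd hne)
  rw [C_1, one_mul, one_mul, ← bilin_oneBlock] at hne hJ
  exact isIntegralSextic_saturation hB (bilin_mem _) (not_incidence_dvd hne) isZeroOf_oneBlock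
    (.inr ⟨_, singularLocus_oneBlock hB, (mem_singularLocus_oneBlock hB).2⟩)

theorem isCubicPair_saturation (hB : SpansModOne B) {j k : Fin 3} (hk : k ≠ 2) (hkj : k ≠ j) :
    IsCubicPair (saturation
      ((Ideal.span {incidence, (yv j * xv 2 : BiPoly)}).comap (segre B))) := by
  have hs := isZeroOf_X (s := .inl 2) hkj (by simpa using hk.symm) (by simp)
  have ht := isZeroOf_X (s := .inr j) hk.symm (by simp) (by simpa using hkj.symm)
  refine ⟨_, _, ?_, ?_, isIrreducibleSurface_three hB (.inl 2),
    isIrreducibleSurface_three hB (.inr j), saturation_comap_span_X_mul_X hB hs ht fun hmem => ?_⟩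
  · exact not_comap_le_comap_of_isZeroOf hB (incidence_mem_span _) (incidence_mem_span _) ht
      (a := k) (b := 2) (by simp) (by simp) (Ideal.mul_mem_left _ _ (mem_span_incidence _))
  · exact not_comap_le_comap_of_isZeroOf hB (incidence_mem_span _) (incidence_mem_span _) hs
      (a := j) (b := k) (by simp) (by simp) (Ideal.mul_mem_right _ _ (mem_span_incidence _))
  · simpa using ht.eval_eq_zero _ hmem

theorem bilin_rankOneDiagonal (l : ℂ) :
    bilin !![0, 0, 0; 0, 0, 0; 0, 0, l] = C l * (yv 2 * xv 2) := by
  simp [bilin_apply, Fin.sum_univ_three]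

theorem bilin_rankOneNilpotent : bilin !![0, 0, 1; 0, 0, 0; 0, 0, 0] = yv 0 * xv 2 := by
  simp [bilin_apply, Fin.sum_univ_three]

theorem IsNormalForm.isIntegralSextic_or_isCubicPair {N : Matrix (Fin 3) (Fin 3) ℂ}
    (hN : IsNormalForm N) (hB : SpansModOne B) :
    IsIntegralSextic (saturation ((Ideal.span {incidence, bilin N}).comap (segre B))) ∨
      IsCubicPair (saturation ((Ideal.span {incidence, bilin N}).comap (segre B))) := by
  cases hN with
  | diagonal l m hl hm hlm => exact .inl (isIntegralSextic_diagonal hB hl hm hlm)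
  | twoBlocks l hl => exact .inl (isIntegralSextic_twoBlocks hB hl)
  | oneBlock => exact .inl (isIntegralSextic_oneBlock hB)
  | rankOneDiagonal l hl =>
    have hspan : Ideal.span {incidence, C l * (yv 2 * xv 2)} =
        Ideal.span {incidence, (yv 2 * xv 2 : BiPoly)} := by
      rw [Ideal.span_insert, Ideal.span_insert _ {yv 2 * xv 2},
        Ideal.span_singleton_mul_left_unit ((isUnit_iff_ne_zero.2 hl).map C)]
    rw [bilin_rankOneDiagonal, hspan]
    exact .inr (isCubicPair_saturation hB (k := 0) (by decide) (by decide))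
  | rankOneNilpotent =>
    rw [bilin_rankOneNilpotent]
    exact .inr (isCubicPair_saturation hB (k := 1) (by decide) (by decide))

theorem exists_hyperplaneSection_eq_saturation [Finite ι] (b : Module.Basis ι ℂ Sections)
    {h : MvPolynomial ι ℂ} (h_linear : h.IsHomogeneous 1) (h_ne : h ≠ 0) :
    ∃ (e : Module.Basis (Fin 3) ℂ V) (N : Matrix (Fin 3) (Fin 3) ℂ), IsNormalForm N ∧
      hyperplaneSection (Set.range (naturalEmbedding b)) h =
        saturation ((Ideal.span {incidence, bilin N}).comap (segre (sectionMatrix b e))) := by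
  obtain ⟨A, hA, hsegre⟩ := exists_endomorphism b h_linear h_ne
  obtain ⟨r, e, hN⟩ := exists_isNormalForm_sub_smul (by simp) hA
  have hh : segre (sectionMatrix b e) h =
      C 1 * bilin (LinearMap.toMatrix e e (A - r • 1)) + C r * incidence := by
    rw [hsegre e, map_sub, map_smul, LinearMap.toMatrix_one, map_sub, map_smul, smul_eq_C_mul,
      C_1, one_mul]
    exact (sub_add_cancel _ _).symm
  refine ⟨e, _, hN, ?_⟩
  rw [hyperplaneSection, vanishingIdeal_range b e,
    comap_segre_sup (spansModOne_sectionMatrix b e) (bilin_mem _) one_ne_zero hh]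

end Section

end TangentPlane

end

open TangentPlane in
theorem theorem1 (b : Module.Basis (Fin 8) ℂ Sections)
    (h : MvPolynomial (Fin 8) ℂ) (h_linear : h.IsHomogeneous 1) (h_ne : h ≠ 0) :
    ((IsIrreducibleSurface (hyperplaneSection (Set.range (naturalEmbedding b)) h) 6 ∧
        SpansDim (hyperplaneSection (Set.range (naturalEmbedding b)) h) 6) ∨
      ∃ P₁ P₂ : Ideal (MvPolynomial (Fin 8) ℂ), P₁ ≠ P₂ ∧
        IsIrreducibleSurface P₁ 3 ∧ IsIrreducibleSurface P₂ 3 ∧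
        hyperplaneSection (Set.range (naturalEmbedding b)) h = P₁ ⊓ P₂) ∧
    ((hyperplaneSection (Set.range (naturalEmbedding b)) h).radical.IsPrime →
      ∃ _ : (hyperplaneSection (Set.range (naturalEmbedding b)) h).IsPrime,
        IsNonsingularDelPezzo (hyperplaneSection (Set.range (naturalEmbedding b)) h) 6 ∨
        ∃ p, singularLocus (hyperplaneSection (Set.range (naturalEmbedding b)) h) = {p} ∧
          (HasMultiplicityAt (hyperplaneSection (Set.range (naturalEmbedding b)) h) p 2 ∨
            HasMultiplicityAt (hyperplaneSection (Set.range (naturalEmbedding b)) h) p 3)) := by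
  obtain ⟨e, N, hN, hI⟩ := exists_hyperplaneSection_eq_saturation b h_linear h_ne
  rw [hI]
  obtain ⟨hprime, hsurf, hspan, hsing⟩ | ⟨P₁, P₂, h₁₂, h₂₁, h₁, h₂, hP⟩ :=
    hN.isIntegralSextic_or_isCubicPair (spansModOne_sectionMatrix b e)
  · exact ⟨.inl ⟨hsurf, hspan⟩, fun _ => ⟨hprime, hsing.imp_right fun ⟨p, hp, h2⟩ =>
      ⟨p, hp, .inl h2⟩⟩⟩
  · have := h₁.isPrime
    have := h₂.isPrime
    exact ⟨.inr ⟨P₁, P₂, fun h => h₁₂ h.le, h₁, h₂, hP⟩, fun hrad =>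
      absurd (hP ▸ hrad) (not_isPrime_radical_inf h₁₂ h₂₁)⟩
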